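/- **Setting.** Let $f\colon\mathbb R\to[0,\infty)$ be a smooth, even probability density such that for every $n\in\mathbb N$ there is $C_n$ with $|f(x)|\le C_n\langle x\rangle^{-n}$ for all $x$, where $\langle x\rangle:=\sqrt{1+x^2}$. Fix constants $\delta,\kappa,\gamma,c_0>0$. Let $N,W$ be positive integers with $$N^\delta\le W\le N,\qquad \int_{-N/(2W)}^{N/(2W)}f(t)\,dt\ \ge\ c_0 .$$ (The last condition holds automatically, for suitable $c_0$ depending only on $f$, if $W\le\varepsilon N$ with $\varepsilon>0$ small enough depending on $f$, and for all $W\le N$ if $\int_{-1/2}^{1/2}f>0$.) Put $\mathbb T:=[-N/2,N/2)\cap\mathbb Z$; for $i\in\mathbb Z$ let $[i]_N$ be the element of $\mathbb T$ congruent to $i$ modulo $N$, and $|i|_N:=|[i]_N|$. Let $S=(s_{xy})_{x,y\in\mathbb T}$, $$s_{xy}:=\frac1Z f\Big(\frac{[x-y]_N}{W}\Big),\quad Z:=\sum_{u\in\mathbb T}f\Big(\frac uW\Big),\quad M:=\frac1{\max_{x,y}s_{xy}},\quad D:=\frac12\sum_{u\in\mathbb T}\Big(\frac uW\Big)^2s_{u0}.$$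 For $z=E+i\eta$ with $\eta>0$ let $$m=m(z):=\frac1{2\pi}\int_{-2}^2\frac{\sqrt{4-\xi^2}}{\xi-z}\,d\xi,\qquad \alpha:=\frac2{\sqrt{4-E^2}},\qquad \Theta:=\frac{|m|^2S}{1-|m|^2S},$$ $$\mathbf S:=\{E+i\eta:\ -2+\kappa\le E\le 2-\kappa,\ M^{-1+\gamma}\le\eta\le10\},\qquad \Phi^2:=\max\Big\{\frac1{N\eta},\frac1{W\sqrt\eta}\Big\},$$ $$\theta_x:=\frac{|m|^2}{2W\sqrt{D\alpha\eta}}\sum_{k\in\mathbb Z}\exp\Big[-\frac{\sqrt{\alpha\eta}}{W\sqrt D}\,|x+kN|\Big],$$ $$\Upsilon^{(K)}_{xy}:=\frac1{N\eta}+\frac1{W\sqrt\eta}\exp\Big[-\frac{\sqrt{\alpha\eta}}{W\sqrt D}|x-y|_N\Big]+\frac1W\Big\langle\frac{\sqrt\eta\,|x-y|_N}{W}\Big\rangle^{-K}.$$ **Proposition (Deterministic diffusion profile).** In the following, all constants and thresholds $N_0$ may depend on $f,\delta,\kappa,\gamma,c_0$, and in (i), (ii) also on $c$, but not on $N,W,z,x,y$;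 the estimates hold for all $N\ge N_0$ and all $W$ as above. (i) Let $c>0$. There are $C$ and $N_0$, and for each $K\in\mathbb N$ a constant $C_K$, such that for all $z\in\mathbf S$ with $\eta\le N^{-c}$ and all $x,y\in\mathbb T$, $$\big|\Theta_{xy}-\theta_{x-y}\big|\ \le\ \frac C{W^2}+\frac{C_K}{W}\Big\langle\frac{\sqrt\eta\,|x-y|_N}{W}\Big\rangle^{-K}.$$ (ii) Let $c>0$. There are $a,b>0$ and $N_0$ such that for all $z\in\mathbf S$ with $\eta\le N^{-c}$, $$a\,\Phi^2\ \le\ \max_{x,y\in\mathbb T}\Theta_{xy}\ \le\ b\,\Phi^2 .$$ (iii) There is $N_0$, and for each $K\in\mathbb N$ a constant $C_K$, such that if $N\le W^2$, then for all $z\in\mathbf S$ with $(W/N)^2\le\eta\le1$ and all $x,y\in\mathbb T$, $$\Theta_{xy}\ \le\ C_K\,\Upsilon^{(K)}_{xy}.$$ -/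

import Mathlib

namespace BandProfile

noncomputable section

/-- The Japanese bracket `⟨u⟩ = √(1 + u²)`. -/
def bracket (u : ℝ) : ℝ := Real.sqrt (1 + u ^ 2)

/-- The standing assumptions on the band profile in dimension one: a smooth, symmetric probability
density `f` on `ℝ` with `|f x| ≤ Cₙ ⟨x⟩⁻ⁿ` for every `n`. Only `f` itself is assumed to decay. -/
structure IsBandDensity (f : ℝ → ℝ) : Prop where
  smooth : ContDiff ℝ (⊤ : ℕ∞) f
  symm : ∀ x, f (-x) = f x
  nonneg : ∀ x, 0 ≤ f x
  integral_eq_one : ∫ x, f x = 1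
  decay : ∀ n : ℕ, ∃ C : ℝ, ∀ x, |f x| ≤ C * bracket x ^ (-(n : ℤ))

/-- The discrete torus `𝕋 = [-N/2, N/2) ∩ ℤ` as a finite set of integers
(see `mem_torus`). -/
def torus (N : ℕ) : Finset ℤ := Finset.Ico (-((N : ℤ) / 2)) (((N : ℤ) + 1) / 2)

theorem mem_torus (N : ℕ) (i : ℤ) :
    i ∈ torus N ↔ -(N : ℝ) / 2 ≤ (i : ℝ) ∧ (i : ℝ) < (N : ℝ) / 2 := by
  have h1 : -(N : ℝ) / 2 ≤ (i : ℝ) ↔ -(N : ℤ) ≤ 2 * i := by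
    rw [← @Int.cast_le ℝ]; push_cast
    constructor <;> intro h <;> linarith
  have h2 : (i : ℝ) < (N : ℝ) / 2 ↔ 2 * i < (N : ℤ) := by
    rw [← @Int.cast_lt ℝ]; push_cast
    constructor <;> intro h <;> linarith
  rw [h1, h2, torus, Finset.mem_Ico]
  omega

/-- The torus as an index type. -/
abbrev Torus (N : ℕ) : Type := {i : ℤ // i ∈ torus N}

/-- The canonical representative `[i]_N`: the element of `i + Nℤ` lying in `[-N/2, N/2)`
(see `rep_mem_torus` and `rep_emod`). -/
def rep (N : ℕ) (i : ℤ) : ℤ := Int.bmod i N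

theorem rep_mem_torus {N : ℕ} (hN : 0 < N) (i : ℤ) : rep N i ∈ torus N := by
  rw [torus, Finset.mem_Ico, rep]
  exact ⟨Int.le_bmod hN, Int.bmod_lt hN⟩

theorem rep_emod (N : ℕ) (i : ℤ) : rep N i % (N : ℤ) = i % (N : ℤ) := by
  rw [rep, Int.bmod_emod]

/-- The periodic distance `|i|_N = |[i]_N|`. -/
def perAbs (N : ℕ) (i : ℤ) : ℝ := |((rep N i : ℤ) : ℝ)|

/-- The normalization constant `Z_{N,W} = ∑_{u ∈ 𝕋} f (u / W)`. -/
def normZ (f : ℝ → ℝ) (N W : ℕ) : ℝ := ∑ u ∈ torus N, f ((u : ℝ) / (W : ℝ))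

/-- The variance matrix `s_{ij} = Z⁻¹ f ([i - j]_N / W)`. -/
def S (f : ℝ → ℝ) (N W : ℕ) : Matrix (Torus N) (Torus N) ℝ :=
  Matrix.of fun i j => (normZ f N W)⁻¹ * f (((rep N (i.1 - j.1) : ℤ) : ℝ) / (W : ℝ))

/-- `M = 1 / max_{i,j} s_{ij}`. -/
def M (f : ℝ → ℝ) (N W : ℕ) : ℝ := 1 / (⨆ p : Torus N × Torus N, S f N W p.1 p.2)

/-- The unrenormalized diffusion constant `D = ½ ∑_{u ∈ 𝕋} (u / W)² s_{u0}`. -/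
def diffD (f : ℝ → ℝ) (N W : ℕ) : ℝ :=
  (1 / 2) * ∑ u ∈ torus N,
    ((u : ℝ) / (W : ℝ)) ^ 2 * ((normZ f N W)⁻¹ * f (((rep N (u - 0) : ℤ) : ℝ) / (W : ℝ)))

/-- The Stieltjes transform of the semicircle law,
`m(z) = (2π)⁻¹ ∫_{-2}^{2} √(4 - ξ²) / (ξ - z) dξ`. -/
def msc (z : ℂ) : ℂ :=
  (1 / (2 * (Real.pi : ℂ))) *
    ∫ ξ in (-2 : ℝ)..2, ((Real.sqrt (4 - ξ ^ 2) : ℝ) : ℂ) / ((ξ : ℂ) - z)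

/-- `α(E) = 2 / √(4 - E²)` with `E = Re z`. -/
def alpha (z : ℂ) : ℝ := 2 / Real.sqrt (4 - z.re ^ 2)

/-- The spectral domain: `z = E + iη` with `-2 + κ ≤ E ≤ 2 - κ` and `M^{-1+γ} ≤ η ≤ 10`. -/
def specDomain (f : ℝ → ℝ) (κ γ : ℝ) (N W : ℕ) : Set ℂ :=
  {z | -2 + κ ≤ z.re ∧ z.re ≤ 2 - κ ∧ M f N W ^ (-1 + γ) ≤ z.im ∧ z.im ≤ 10}

/-- The deterministic profile `Θ = |m|² S (1 - |m|² S)⁻¹`. -/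
def Theta (f : ℝ → ℝ) (N W : ℕ) (z : ℂ) : Matrix (Torus N) (Torus N) ℝ :=
  (‖msc z‖ ^ 2 • S f N W) * (1 - ‖msc z‖ ^ 2 • S f N W)⁻¹

/-- `max_{x,y} Θ_{xy}`. -/
def maxTheta (f : ℝ → ℝ) (N W : ℕ) (z : ℂ) : ℝ :=
  ⨆ p : Torus N × Torus N, Theta f N W z p.1 p.2

/-- The `N`-periodic profile
`θ_x = |m|² / (2 W √(D α η)) ∑_{k ∈ ℤ} exp (-(√(α η) / (W √D)) |x + k N|)`. -/
def theta (f : ℝ → ℝ) (N W : ℕ) (z : ℂ) (x : ℤ) : ℝ :=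
  ‖msc z‖ ^ 2 / (2 * (W : ℝ) * Real.sqrt (diffD f N W * alpha z * z.im)) *
    ∑' k : ℤ, Real.exp
      (-(Real.sqrt (alpha z * z.im) / ((W : ℝ) * Real.sqrt (diffD f N W))
          * |(x : ℝ) + (k : ℝ) * (N : ℝ)|))

/-- The squared control parameter `Φ² = max {1 / (N η), 1 / (W √η)}`. -/
def PhiSq (N W : ℕ) (z : ℂ) : ℝ :=
  max (1 / ((N : ℝ) * z.im)) (1 / ((W : ℝ) * Real.sqrt z.im))

/-- `Υ_{xy}^{(K)} = 1/(N η) + 1/(W √η) exp (-(√(α η) / (W √D)) |x - y|_N)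
+ (1/W) ⟨√η |x - y|_N / W⟩^{-K}`. -/
def Upsilon (f : ℝ → ℝ) (K N W : ℕ) (z : ℂ) (x y : Torus N) : ℝ :=
  1 / ((N : ℝ) * z.im)
    + 1 / ((W : ℝ) * Real.sqrt z.im) *
      Real.exp (-(Real.sqrt (alpha z * z.im) / ((W : ℝ) * Real.sqrt (diffD f N W))
        * perAbs N (x.1 - y.1)))
    + 1 / (W : ℝ) * bracket (Real.sqrt z.im * perAbs N (x.1 - y.1) / (W : ℝ)) ^ (-(K : ℤ))

/-- The admissible pairs of size `N` and band width `W`: `N^δ ≤ W ≤ N`, and the density `f` puts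
mass at least `c₀` on the window `[-N/(2W), N/(2W)]` that is seen by the torus.
The last condition only matters when `W` is comparable with `N`. -/
structure Admissible (f : ℝ → ℝ) (δ c₀ : ℝ) (N W : ℕ) : Prop where
  lower : (N : ℝ) ^ δ ≤ (W : ℝ)
  upper : W ≤ N
  mass : c₀ ≤ ∫ t in (-((N : ℝ) / (2 * (W : ℝ))))..((N : ℝ) / (2 * (W : ℝ))), f t

end

end BandProfile

namespace BandProfile
open Finset Real

/-! Write r = |m|². Since S is a symmetric circulant stochastic matrix and r < 1, Θ is the Neumann
series Σ_{n≥1} rⁿ Sⁿ, that is, the Green function of a random walk on the torus with steps of size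
W, killed at rate 1 - r = αη + O(η²) (`norm_msc_sq_bounds`). For small η the walk lives about 1/η
steps and diffuses over the distance W/√η, so Θ should depend on the step law only through its
variance.

This is made quantitative by comparison with a solvable walk rather than with a Gaussian. The
geometric walk of `exists_geometric_step` has the same variance parameter D and the symbol 1/(1 + (2
- 2 cos p) D W²). Its resolvent is again a periodised exponential (`four_geometric`). Choosing its
killing parameter ρ so that the decay rate is exactly that of θ makes this resolvent equal to θ up
to a factor 1 + O(η).

Two walks are compared term by term. Their symbols have a gap away from frequency zero and agree up
to fourth order at zero, so the n-step laws differ by O(W⁻¹ n^{-3/2})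
(`IsStep.abs_circ_pow_sub_le`). Each law has polynomial tails of every order on the scale √n W,
because the mean of a polynomial weight grows by a factor 1 + O(1/n) per step
(`IsStep.sum_weight_le`, `IsStep.circ_pow_le`). Interpolation gives a difference of order W⁻¹
n^{-5/4} with tails. This is summable in n, and the factor rⁿ turns the scale √n W into W/√η
(`IsStep.abs_resolvent_sub_le`).

Hence |Θ - θ| is at most C/W times a rapidly decaying function of √η |x - y|_N / W
(`IsBandDensity.exists_abs_Theta_sub_theta_le`). Explicit bounds on θ then give the size of the
maximum, and the upper bound for small η; for η bounded below, the tail bound on the Neumann series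
alone suffices. -/

/-! ### Representatives, periodic distance and sums over the torus. -/

theorem rep_add_mul (N : ℕ) (x : ℤ) : ∃ k : ℤ, rep N x = x + k * N := by
  refine ⟨-Int.bdiv x N, ?_⟩
  rw [rep, Int.bmod_eq_self_sub_bdiv_mul]; ring

theorem rep_of_mem {N : ℕ} {x : ℤ} (hx : x ∈ torus N) : rep N x = x := by
  rw [torus, Finset.mem_Ico] at hx
  exact Int.bmod_eq_of_le hx.1 hx.2

theorem periodic_rep {N : ℕ} {h : ℤ → ℝ} (hh : Function.Periodic h (N : ℤ)) (x : ℤ) :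
    h (rep N x) = h x := by
  obtain ⟨k, hk⟩ := rep_add_mul N x
  rw [hk]
  simpa using hh.int_mul k x

theorem two_abs_le_of_mem_torus {N : ℕ} {u : ℤ} (hu : u ∈ torus N) : 2 * |(u : ℝ)| ≤ N := by
  rw [mem_torus] at hu
  have : |(u : ℝ)| ≤ N / 2 := abs_le.2 ⟨by linarith [hu.1], hu.2.le⟩
  linarith

theorem perAbs_nonneg (N : ℕ) (x : ℤ) : 0 ≤ perAbs N x := abs_nonneg _

theorem perAbs_le_abs {N : ℕ} (hN : 0 < N) (x : ℤ) : perAbs N x ≤ |(x : ℝ)| := by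
  have h1 := two_abs_le_of_mem_torus (rep_mem_torus hN x)
  obtain ⟨k, hk⟩ := rep_add_mul N x
  rcases eq_or_ne k 0 with rfl | hk0
  · simp [perAbs, hk]
  · have h2 : (1 : ℝ) ≤ |(k : ℝ)| := by exact_mod_cast Int.one_le_abs hk0
    have h3 : (x : ℝ) = rep N x - k * N := by rw [hk]; push_cast; ring
    have h4 : |(k : ℝ) * N| ≤ |(x : ℝ)| + |((rep N x : ℤ) : ℝ)| := by
      have : (k : ℝ) * N = rep N x - x := by rw [h3]; ring
      rw [this]
      exact (abs_sub _ _).trans (by rw [add_comm])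
    rw [abs_mul, Nat.abs_cast] at h4
    have h5 : (N : ℝ) ≤ |(k : ℝ)| * N := le_mul_of_one_le_left (Nat.cast_nonneg _) h2
    unfold perAbs
    linarith

theorem perAbs_of_mem {N : ℕ} {u : ℤ} (hu : u ∈ torus N) : perAbs N u = |(u : ℝ)| := by
  rw [perAbs, rep_of_mem hu]

theorem perAbs_periodic (N : ℕ) : Function.Periodic (perAbs N) (N : ℤ) := fun x ↦ by
  simp [perAbs, rep]

theorem perAbs_add_le {N : ℕ} (hN : 0 < N) (x y : ℤ) :
    perAbs N (x + y) ≤ perAbs N x + perAbs N y := by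
  have : perAbs N (x + y) = perAbs N (rep N x + rep N y) := by simp [perAbs, rep]
  rw [this]
  refine (perAbs_le_abs hN _).trans ?_
  push_cast
  exact abs_add_le _ _

theorem perAbs_neg {N : ℕ} (hN : 0 < N) (x : ℤ) : perAbs N (-x) = perAbs N x := by
  have key : ∀ x, perAbs N (-x) ≤ perAbs N x := fun x ↦ by
    have : perAbs N (-x) = perAbs N (-rep N x) := by
      obtain ⟨k, hk⟩ := rep_add_mul N x
      rw [hk, neg_add, ← neg_mul]
      exact ((perAbs_periodic N).int_mul (-k) (-x)).symm.trans (by simp)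
    rw [this]
    refine (perAbs_le_abs hN _).trans ?_
    rw [Int.cast_neg, abs_neg]; rfl
  exact le_antisymm (key x) (by simpa using key (-x))

section Sums
variable {N : ℕ} {h : ℤ → ℝ}

theorem sum_torus_add (hN : 0 < N) (hh : Function.Periodic h (N : ℤ)) (c : ℤ) :
    ∑ u ∈ torus N, h (u + c) = ∑ u ∈ torus N, h u := by
  refine sum_nbij' (fun u ↦ rep N (u + c)) (fun u ↦ rep N (u - c)) (fun u _ ↦ rep_mem_torus hN _)
    (fun u _ ↦ rep_mem_torus hN _) (fun u hu ↦ ?_) (fun u hu ↦ ?_)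
    (fun u _ ↦ (periodic_rep hh _).symm)
  · have : rep N (rep N (u + c) - c) = rep N u := by simp [rep, Int.sub_eq_add_neg]
    rw [this, rep_of_mem hu]
  · have : rep N (rep N (u - c) + c) = rep N u := by simp [rep]
    rw [this, rep_of_mem hu]

theorem sum_torus_neg (hN : 0 < N) (hh : Function.Periodic h (N : ℤ)) :
    ∑ u ∈ torus N, h (-u) = ∑ u ∈ torus N, h u := by
  have key : ∀ u ∈ torus N, rep N (-rep N (-u)) = u := fun u hu ↦ by
    obtain ⟨k, hk⟩ := rep_add_mul N (-u)
    have h1 : -rep N (-u) = u + -k * N := by rw [hk]; ring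
    rw [h1]
    have : rep N (u + -k * N) = rep N u := by simp [rep]
    rw [this, rep_of_mem hu]
  exact sum_nbij' (fun u ↦ rep N (-u)) (fun u ↦ rep N (-u)) (fun u _ ↦ rep_mem_torus hN _)
    (fun u _ ↦ rep_mem_torus hN _) key key (fun u _ ↦ (periodic_rep hh _).symm)

theorem sum_torus_sub (hN : 0 < N) (hh : Function.Periodic h (N : ℤ)) (c : ℤ) :
    ∑ u ∈ torus N, h (c - u) = ∑ u ∈ torus N, h u := by
  have : Function.Periodic (fun u ↦ h (u + c)) (N : ℤ) := fun u ↦ by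
    change h (u + N + c) = h (u + c)
    rw [add_right_comm]; exact hh _
  rw [← sum_torus_add hN hh c, ← sum_torus_neg hN this]
  exact sum_congr rfl fun u _ ↦ by ring_nf

theorem card_torus (N : ℕ) : (torus N).card = N := by
  rw [torus, Int.card_Ico]; omega

end Sums

/-! ### Cosine transform and circulant matrices. -/

noncomputable section

/-- The frequency `2πj/N`. -/
def freq (N : ℕ) (j : ℤ) : ℝ := 2 * π * j / N

/-- The circulant matrix of a function on `ℤ`. -/
def circ (N : ℕ) (h : ℤ → ℝ) : Matrix (Torus N) (Torus N) ℝ :=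
  Matrix.of fun x y ↦ h (x.1 - y.1)

/-- The cosine transform of a function on the torus. -/
def symb (N : ℕ) (h : ℤ → ℝ) (j : ℤ) : ℝ := ∑ u ∈ torus N, h u * cos (freq N j * u)

/-- The circulant matrix with prescribed cosine transform. -/
def four (N : ℕ) (a : ℤ → ℝ) : Matrix (Torus N) (Torus N) ℝ :=
  Matrix.of fun x y ↦ (N : ℝ)⁻¹ * ∑ j ∈ torus N, a j * cos (freq N j * ((x.1 - y.1 : ℤ) : ℝ))

end

section Fourier
variable {N : ℕ} {h : ℤ → ℝ}

theorem freq_mul_add (hN : 0 < N) (j x : ℤ) :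
    freq N j * ((x + N : ℤ) : ℝ) = freq N j * x + j * (2 * π) := by
  have : (N : ℝ) ≠ 0 := by positivity
  unfold freq; push_cast; field_simp

theorem cos_freq_periodic (hN : 0 < N) (j : ℤ) :
    Function.Periodic (fun x : ℤ ↦ cos (freq N j * x)) (N : ℤ) := fun x ↦ by
  simp only [freq_mul_add hN, cos_add_int_mul_two_pi]

theorem sin_freq_periodic (hN : 0 < N) (j : ℤ) :
    Function.Periodic (fun x : ℤ ↦ sin (freq N j * x)) (N : ℤ) := fun x ↦ by
  simp only [freq_mul_add hN, sin_add_int_mul_two_pi]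

theorem abs_freq_le {j : ℤ} (hN : 0 < N) (hj : j ∈ torus N) : |freq N j| ≤ π := by
  have h1 := two_abs_le_of_mem_torus hj
  have hN' : (0 : ℝ) < N := by positivity
  rw [freq, abs_div, abs_mul, abs_of_pos two_pi_pos, Nat.abs_cast, div_le_iff₀ hN']
  nlinarith [pi_pos]

/-- Sums of an odd function vanish. -/
theorem sum_mul_sin (hN : 0 < N) (hh : Function.Periodic h (N : ℤ)) (he : ∀ x, h (-x) = h x)
    (j : ℤ) : ∑ u ∈ torus N, h u * sin (freq N j * u) = 0 := by
  have := sum_torus_neg hN (hh.mul (sin_freq_periodic hN j))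
  simp only [Pi.mul_apply, he, Int.cast_neg, mul_neg, sin_neg, sum_neg_distrib] at this
  linarith

/-- Evenness of `h` removes the sine part of the addition formula, so cosines alone diagonalise the
circulant matrix. -/
theorem sum_mul_cos_sub (hN : 0 < N) (hh : Function.Periodic h (N : ℤ)) (he : ∀ x, h (-x) = h x)
    (j x y : ℤ) : ∑ w ∈ torus N, h (x - w) * cos (freq N j * ((w - y : ℤ) : ℝ))
      = symb N h j * cos (freq N j * ((x - y : ℤ) : ℝ)) := by
  have hp : Function.Periodic (fun v : ℤ ↦ h v * cos (freq N j * ((x - y - v : ℤ) : ℝ))) (N : ℤ) :=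
    fun v ↦ by
      have h1 := cos_freq_periodic hN j (x - y - (v + N))
      have h2 : x - y - (v + N) + N = x - y - v := by ring
      rw [h2] at h1
      simp only [hh v, h1]
  calc _ = ∑ w ∈ torus N, (fun v : ℤ ↦ h v * cos (freq N j * ((x - y - v : ℤ) : ℝ))) (x - w) := by
        refine sum_congr rfl fun w _ ↦ ?_
        have : x - y - (x - w) = w - y := by ring
        simp only [this]
    _ = ∑ v ∈ torus N, (h v * cos (freq N j * v) * cos (freq N j * ((x - y : ℤ) : ℝ))
          + sin (freq N j * ((x - y : ℤ) : ℝ)) * (h v * sin (freq N j * v))) := by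
        rw [sum_torus_sub hN hp]
        refine sum_congr rfl fun v _ ↦ ?_
        rw [Int.cast_sub (x - y) v, mul_sub, cos_sub]; ring
    _ = _ := by
        rw [sum_add_distrib, ← sum_mul, ← mul_sum, sum_mul_sin hN hh he, mul_zero, add_zero, symb]

theorem circ_mul_four (hN : 0 < N) (hh : Function.Periodic h (N : ℤ)) (he : ∀ x, h (-x) = h x)
    (b : ℤ → ℝ) : circ N h * four N b = four N (fun j ↦ symb N h j * b j) := by
  ext x y
  simp only [Matrix.mul_apply, circ, four, Matrix.of_apply]
  rw [Finset.sum_coe_sort (torus N) (fun w ↦ h (x.1 - w) * ((N : ℝ)⁻¹ *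
    ∑ j ∈ torus N, b j * cos (freq N j * ((w - y.1 : ℤ) : ℝ))))]
  simp only [mul_sum]
  rw [sum_comm]
  refine sum_congr rfl fun j _ ↦ ?_
  rw [mul_right_comm (symb N h j), ← sum_mul_cos_sub hN hh he, sum_mul, mul_sum]
  exact sum_congr rfl fun w _ ↦ by ring

/-- Shifting j by +1 and by -1 leaves the sum unchanged, while the two shifted sums add up to 2
cos(2πx/N) times it. That factor is 2 only if N divides x. -/
theorem sum_cos_freq (hN : 0 < N) {x : ℤ} (hx : ¬ (N : ℤ) ∣ x) :
    ∑ j ∈ torus N, cos (freq N j * x) = 0 := by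
  have hN' : (N : ℝ) ≠ 0 := by positivity
  have hf : ∀ j : ℤ, freq N j * x = freq N x * j := fun j ↦ by unfold freq; ring
  simp only [hf]
  have h1 := sum_torus_add hN (cos_freq_periodic hN x) 1
  have h2 := sum_torus_add hN (cos_freq_periodic hN x) (-1)
  have h3 : (2 * cos (freq N x) - 2) * ∑ j ∈ torus N, cos (freq N x * j) = 0 := by
    have h4 : 2 * cos (freq N x) * ∑ j ∈ torus N, cos (freq N x * j)
        = ∑ j ∈ torus N, cos (freq N x * ((j + 1 : ℤ) : ℝ))
          + ∑ j ∈ torus N, cos (freq N x * ((j + -1 : ℤ) : ℝ)) := by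
      rw [mul_sum, ← sum_add_distrib]
      refine sum_congr rfl fun j _ ↦ ?_
      push_cast
      rw [mul_add, mul_add, cos_add, cos_add]; simp; ring
    linarith
  refine (mul_eq_zero.1 h3).resolve_left fun h4 ↦ hx ?_
  have h5 : cos (freq N x) = 1 := by linarith
  obtain ⟨k, hk⟩ := (cos_eq_one_iff _).1 h5
  refine ⟨k, ?_⟩
  unfold freq at hk
  field_simp at hk
  exact_mod_cast (by linarith : (x : ℝ) = N * k)

theorem four_one (hN : 0 < N) : four N (fun _ ↦ 1) = 1 := by
  have hN' : (N : ℝ) ≠ 0 := by positivity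
  ext x y
  simp only [four, Matrix.of_apply, one_mul]
  rcases eq_or_ne x y with rfl | hxy
  · simp [card_torus, hN']
  · rw [Matrix.one_apply_ne hxy, sum_cos_freq hN, mul_zero]
    intro hd
    refine hxy (Subtype.ext ?_)
    have hx := rep_of_mem x.2
    have hy := rep_of_mem y.2
    obtain ⟨k, hk⟩ := hd
    have : x.1 = y.1 + k * N := by linarith
    rw [← hx, ← hy, this]
    simp [rep]

theorem circ_eq_four (hN : 0 < N) (hh : Function.Periodic h (N : ℤ)) (he : ∀ x, h (-x) = h x) :
    circ N h = four N (symb N h) := by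
  have := circ_mul_four hN hh he (fun _ ↦ 1)
  rw [four_one hN, mul_one] at this
  simpa using this

theorem circ_pow (hN : 0 < N) (hh : Function.Periodic h (N : ℤ)) (he : ∀ x, h (-x) = h x)
    (n : ℕ) : circ N h ^ n = four N (fun j ↦ symb N h j ^ n) := by
  induction n with
  | zero => simp [four_one hN]
  | succ n ih => rw [pow_succ', ih, circ_mul_four hN hh he]; simp only [pow_succ']

theorem four_sub (a b : ℤ → ℝ) : four N a - four N b = four N (fun j ↦ a j - b j) := by
  ext x y
  simp [four, ← mul_sub, ← sum_sub_distrib, sub_mul]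

theorem smul_four (c : ℝ) (a : ℤ → ℝ) : c • four N a = four N (fun j ↦ c * a j) := by
  ext x y
  simp only [four, Matrix.smul_apply, Matrix.of_apply, smul_eq_mul, mul_sum]
  exact sum_congr rfl fun j _ ↦ by ring

theorem four_congr {a b : ℤ → ℝ} (hab : ∀ j ∈ torus N, a j = b j) : four N a = four N b := by
  ext x y
  simp only [four, Matrix.of_apply]
  congr 1
  exact sum_congr rfl fun j hj ↦ by rw [hab j hj]

theorem abs_four_le (hN : 0 < N) {a b : ℤ → ℝ} (hab : ∀ j ∈ torus N, |a j| ≤ b j) (x y : Torus N) :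
    |four N a x y| ≤ (N : ℝ)⁻¹ * ∑ j ∈ torus N, b j := by
  simp only [four, Matrix.of_apply]
  rw [abs_mul, abs_of_nonneg (by positivity)]
  refine mul_le_mul_of_nonneg_left ?_ (by positivity)
  refine (abs_sum_le_sum_abs _ _).trans (sum_le_sum fun j hj ↦ ?_)
  rw [abs_mul]
  exact (mul_le_of_le_one_right (abs_nonneg _) (abs_cos_le_one _)).trans (hab j hj)

theorem four_diag (a : ℤ → ℝ) (x : Torus N) : four N a x x = (N : ℝ)⁻¹ * ∑ j ∈ torus N, a j := by
  simp [four]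

theorem hasSum_four {a : ℕ → ℤ → ℝ} {b : ℤ → ℝ}
    (hab : ∀ j ∈ torus N, HasSum (fun n ↦ a n j) (b j)) (x y : Torus N) :
    HasSum (fun n ↦ four N (a n) x y) (four N b x y) := by
  simp only [four, Matrix.of_apply]
  exact (hasSum_sum fun j hj ↦ (hab j hj).mul_right _).mul_left _

/-- The resolvent of a circulant matrix. -/
theorem smul_circ_mul_inv (hN : 0 < N) (hh : Function.Periodic h (N : ℤ)) (he : ∀ x, h (-x) = h x)
    {r : ℝ} (hr : ∀ j ∈ torus N, r * symb N h j ≠ 1) :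
    (r • circ N h) * (1 - r • circ N h)⁻¹
      = four N (fun j ↦ r * symb N h j / (1 - r * symb N h j)) := by
  have h1 : (1 - r • circ N h) * four N (fun j ↦ (1 - r * symb N h j)⁻¹) = 1 := by
    rw [sub_mul, one_mul, smul_mul_assoc, circ_mul_four hN hh he, smul_four, four_sub,
      ← four_one hN]
    refine four_congr fun j hj ↦ ?_
    have : 1 - r * symb N h j ≠ 0 := sub_ne_zero.2 (hr j hj).symm
    field_simp
  rw [Matrix.inv_eq_right_inv h1, smul_mul_assoc, circ_mul_four hN hh he, smul_four]
  refine four_congr fun j _ ↦ ?_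
  rw [div_eq_mul_inv, mul_assoc]

/-- The resolvent as a Neumann series. -/
theorem hasSum_resolvent (hN : 0 < N) (hh : Function.Periodic h (N : ℤ)) (he : ∀ x, h (-x) = h x)
    {r : ℝ} (hr : ∀ j ∈ torus N, |r * symb N h j| < 1) (x y : Torus N) :
    HasSum (fun n : ℕ ↦ r ^ (n + 1) * (circ N h ^ (n + 1)) x y)
      (four N (fun j ↦ r * symb N h j / (1 - r * symb N h j)) x y) := by
  have h1 : ∀ n : ℕ, r ^ (n + 1) * (circ N h ^ (n + 1)) x y
      = four N (fun j ↦ r * symb N h j * (r * symb N h j) ^ n) x y := fun n ↦ by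
    have := congrFun (congrFun (smul_four (N := N) (r ^ (n + 1)) (fun j ↦ symb N h j ^ (n + 1))) x) y
    rw [Matrix.smul_apply, smul_eq_mul] at this
    rw [circ_pow hN hh he, this]
    congr 2
    funext j
    ring
  simp only [h1]
  refine hasSum_four (fun j hj ↦ ?_) x y
  rw [div_eq_mul_inv]
  exact (hasSum_geometric_of_abs_lt_one (hr j hj)).mul_left _

end Fourier

/-! ### Elementary sums of Cauchy type. -/

/-- Each term is dominated by a telescoping difference, since (1 + X - a)(1 + X) ≤ 2(1 + X²) for X =
a(k + 1). -/
theorem sum_range_inv_one_add_sq_le {a : ℝ} (ha : 0 < a) (m : ℕ) :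
    ∑ k ∈ range m, (1 + (a * (k + 1)) ^ 2)⁻¹ ≤ 2 / a := by
  have key : ∀ m : ℕ, ∑ k ∈ range m, (1 + (a * (k + 1)) ^ 2)⁻¹ ≤ 2 / a * (1 - (1 + a * m)⁻¹) := by
    intro m
    induction m with
    | zero => simp
    | succ m ih =>
      rw [sum_range_succ]
      have h1 : (0 : ℝ) < 1 + a * m := by positivity
      have h2 : (0 : ℝ) < 1 + a * (m + 1) := by positivity
      have h3 : (1 + (a * ((m : ℝ) + 1)) ^ 2)⁻¹
          ≤ 2 / a * ((1 + a * m)⁻¹ - (1 + a * (m + 1))⁻¹) := by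
        have : 2 / a * ((1 + a * m)⁻¹ - (1 + a * (m + 1))⁻¹)
            = ((1 + a * m) * (1 + a * (m + 1)) / 2)⁻¹ := by field_simp; ring
        rw [this]
        refine inv_anti₀ (by positivity) ?_
        nlinarith [sq_nonneg (1 - a * ((m : ℝ) + 1)), mul_pos ha h2]
      push_cast
      linarith
  refine (key m).trans (mul_le_of_le_one_right (by positivity) ?_)
  have : 0 ≤ (1 + a * (m : ℝ))⁻¹ := by positivity
  linarith

theorem sum_torus_erase_le {N : ℕ} {F : ℕ → ℝ} (hF : ∀ k, 0 ≤ F k) :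
    ∑ j ∈ (torus N).erase 0, F j.natAbs ≤ 2 * ∑ k ∈ range N, F (k + 1) := by
  have hsub : (torus N).erase 0 ⊆ (range N).image (fun k : ℕ ↦ (k : ℤ) + 1)
      ∪ (range N).image (fun k : ℕ ↦ -((k : ℤ) + 1)) := by
    intro j hj
    rw [mem_erase, torus, Finset.mem_Ico] at hj
    simp only [mem_union, mem_image, mem_range]
    rcases lt_or_gt_of_ne hj.1 with h | h
    · exact Or.inr ⟨(-j - 1).toNat, by omega, by omega⟩
    · exact Or.inl ⟨(j - 1).toNat, by omega, by omega⟩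
  have h1 : ∑ j ∈ (range N).image (fun k : ℕ ↦ (k : ℤ) + 1), F j.natAbs
      = ∑ k ∈ range N, F (k + 1) := by
    rw [sum_image (fun a _ b _ h ↦ by simpa using h)]
    rfl
  have h2 : ∑ j ∈ (range N).image (fun k : ℕ ↦ -((k : ℤ) + 1)), F j.natAbs
      = ∑ k ∈ range N, F (k + 1) := by
    rw [sum_image (fun a _ b _ h ↦ by simpa using h)]
    exact sum_congr rfl fun k _ ↦ by congr 1
  calc _ ≤ _ := sum_le_sum_of_subset_of_nonneg hsub fun _ _ _ ↦ hF _
    _ ≤ _ := by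
        rw [two_mul]
        nth_rewrite 1 [← h1]
        rw [← h2, ← sum_union_inter]
        exact le_add_of_nonneg_right (sum_nonneg fun _ _ ↦ hF _)

theorem sum_torus_erase_inv_le {N : ℕ} {a : ℝ} (ha : 0 < a) :
    ∑ j ∈ (torus N).erase 0, (1 + (a * j) ^ 2)⁻¹ ≤ 4 / a := by
  have h1 := sum_torus_erase_le (N := N) (F := fun k ↦ (1 + (a * k) ^ 2)⁻¹)
    (fun k ↦ by positivity)
  have h2 := sum_range_inv_one_add_sq_le ha N
  calc _ = ∑ j ∈ (torus N).erase 0, (1 + (a * (j.natAbs : ℕ)) ^ 2)⁻¹ := by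
        refine sum_congr rfl fun j _ ↦ ?_
        rw [Nat.cast_natAbs, mul_pow, mul_pow, Int.cast_abs, sq_abs]
    _ ≤ 2 * (2 / a) := by
        push_cast at h1
        linarith
    _ = 4 / a := by ring

theorem zero_mem_torus {N : ℕ} (hN : 0 < N) : (0 : ℤ) ∈ torus N := by
  rw [torus, Finset.mem_Ico]; omega

theorem sum_torus_inv_le {N W : ℕ} (hN : 0 < N) (hW : 0 < W) :
    ∑ u ∈ torus N, (1 + ((u : ℝ) / W) ^ 2)⁻¹ ≤ 5 * (W : ℝ) := by
  have hW' : (1 : ℝ) ≤ W := by exact_mod_cast hW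
  rw [← add_sum_erase _ _ (zero_mem_torus hN)]
  have := sum_torus_erase_inv_le (N := N) (a := (W : ℝ)⁻¹) (by positivity)
  rw [div_inv_eq_mul] at this
  have h0 : (1 + (((0 : ℤ) : ℝ) / W) ^ 2)⁻¹ = 1 := by simp
  simp only [div_eq_inv_mul _ (W : ℝ)] at h0 ⊢
  linarith

/-! ### Random walks on the torus and polynomial tails of their n-step laws. -/

/-- The step distribution of a symmetric walk on the torus, spread on the scale `W`. -/
structure IsStep (N W : ℕ) (B : ℕ → ℝ) (h : ℤ → ℝ) : Prop where
  periodic : Function.Periodic h (N : ℤ)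
  even : ∀ u, h (-u) = h u
  nonneg : ∀ u, 0 ≤ h u
  sum_eq_one : ∑ u ∈ torus N, h u = 1
  decay : ∀ K u, h u ≤ B K / W * ((1 + (perAbs N u / W) ^ 2) ^ K)⁻¹

/-- Averaging over ±v cancels the term linear in v. With s = 2xv/(1 + x²), which satisfies |s| ≤
|v|, one has 1 + (x ± v)² ≤ (1 + x²)(1 + v² ± s). For |v| ≤ 1 the average of the k-th powers is
controlled by cosh(ks) ≤ exp((ks)²/2), which is quadratic in v; for |v| ≥ 1 both brackets are at
most 3v². -/
theorem avg_weight_le {k : ℕ} (hk : 1 ≤ k) : ∃ C : ℝ, 0 ≤ C ∧ ∀ x v : ℝ,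
    (1 + (x + v) ^ 2) ^ k + (1 + (x - v) ^ 2) ^ k
      ≤ 2 * ((1 + x ^ 2) ^ k * (1 + C * (v ^ 2 + (v ^ 2) ^ k))) := by
  set c : ℝ := k + k ^ 2 with hc
  have hc0 : 0 ≤ c := by positivity
  refine ⟨c * exp c + 3 ^ k, by positivity, fun x v ↦ ?_⟩
  have hY : 0 < 1 + x ^ 2 := by positivity
  set s := 2 * x * v / (1 + x ^ 2) with hs
  have hs2 : s ^ 2 ≤ v ^ 2 := by
    rw [hs, div_pow, div_le_iff₀ (by positivity)]
    nlinarith [mul_nonneg (sq_nonneg v) (sq_nonneg (1 - x ^ 2))]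
  have e1 : 1 + (x + v) ^ 2 ≤ (1 + x ^ 2) * (1 + v ^ 2 + s) := by
    have : (1 + x ^ 2) * s = 2 * x * v := by rw [hs]; field_simp
    nlinarith [mul_nonneg (sq_nonneg x) (sq_nonneg v)]
  have e2 : 1 + (x - v) ^ 2 ≤ (1 + x ^ 2) * (1 + v ^ 2 - s) := by
    have : (1 + x ^ 2) * s = 2 * x * v := by rw [hs]; field_simp
    nlinarith [mul_nonneg (sq_nonneg x) (sq_nonneg v)]
  have p1 : 0 ≤ 1 + v ^ 2 + s :=
    nonneg_of_mul_nonneg_right ((by positivity : 0 ≤ 1 + (x + v) ^ 2).trans e1) hY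
  have p2 : 0 ≤ 1 + v ^ 2 - s :=
    nonneg_of_mul_nonneg_right ((by positivity : 0 ≤ 1 + (x - v) ^ 2).trans e2) hY
  have e3 := pow_le_pow_left₀ (by positivity) e1 k
  have e4 := pow_le_pow_left₀ (by positivity) e2 k
  rw [mul_pow] at e3 e4
  suffices h : (1 + v ^ 2 + s) ^ k + (1 + v ^ 2 - s) ^ k
      ≤ 2 * (1 + (c * exp c + 3 ^ k) * (v ^ 2 + (v ^ 2) ^ k)) by
    have := mul_le_mul_of_nonneg_left h (pow_pos hY k).le
    linarith
  have hv0 := sq_nonneg v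
  have hvk : 0 ≤ (v ^ 2) ^ k := by positivity
  have hec : 0 ≤ c * exp c := by positivity
  have h3k : (0 : ℝ) ≤ 3 ^ k := by positivity
  rcases le_total (v ^ 2) 1 with hv | hv
  · have q1 : (1 + v ^ 2 + s) ^ k ≤ exp (k * v ^ 2) * exp (k * s) := by
      rw [← exp_add, ← mul_add, exp_nat_mul]
      exact pow_le_pow_left₀ p1 (by linarith [add_one_le_exp (v ^ 2 + s)]) k
    have q2 : (1 + v ^ 2 - s) ^ k ≤ exp (k * v ^ 2) * exp (-(k * s)) := by
      rw [← exp_add, ← mul_neg, ← mul_add, exp_nat_mul]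
      exact pow_le_pow_left₀ p2 (by linarith [add_one_le_exp (v ^ 2 + -s)]) k
    have q3 := cosh_le_exp_half_sq (k * s)
    rw [cosh_eq] at q3
    have q4 : exp (k * v ^ 2) * exp ((k * s) ^ 2 / 2) ≤ exp (c * v ^ 2) := by
      rw [← exp_add]
      refine exp_le_exp.2 ?_
      rw [hc, mul_pow]
      nlinarith [mul_le_mul_of_nonneg_left hs2 (sq_nonneg (k : ℝ)),
        mul_nonneg (sq_nonneg (k : ℝ)) hv0]
    have q5 : exp (c * v ^ 2) ≤ 1 + c * exp c * v ^ 2 := by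
      have h1 : exp (c * v ^ 2) ≤ exp c := exp_le_exp.2 (mul_le_of_le_one_right hc0 hv)
      have h2 := add_one_le_exp (-(c * v ^ 2))
      have h3 : exp (c * v ^ 2) * exp (-(c * v ^ 2)) = 1 := by rw [← exp_add]; simp
      have h4 := mul_le_mul_of_nonneg_left h2 (exp_pos (c * v ^ 2)).le
      nlinarith [mul_le_mul_of_nonneg_left h1 (mul_nonneg hc0 hv0)]
    have q6 := mul_le_mul_of_nonneg_left q3 (exp_pos (k * v ^ 2)).le
    nlinarith [mul_nonneg hec hvk, mul_nonneg h3k hv0, mul_nonneg h3k hvk]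
  · have hsv : |s| ≤ v ^ 2 := by
      have := sq_le_sq.1 hs2
      nlinarith [sq_abs v, abs_nonneg v]
    have hs' := abs_le.1 hsv
    have r1 : (1 + v ^ 2 + s) ^ k ≤ 3 ^ k * (v ^ 2) ^ k := by
      rw [← mul_pow]; exact pow_le_pow_left₀ p1 (by linarith) k
    have r2 : (1 + v ^ 2 - s) ^ k ≤ 3 ^ k * (v ^ 2) ^ k := by
      rw [← mul_pow]; exact pow_le_pow_left₀ p2 (by linarith) k
    nlinarith [mul_nonneg hec hvk, mul_nonneg h3k hv0, mul_nonneg hec hv0]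

section Step
variable {N W : ℕ} {B : ℕ → ℝ} {h : ℤ → ℝ}

theorem IsStep.decay_const_nonneg (hh : IsStep N W B h) (hW : 0 < W) (K : ℕ) : 0 ≤ B K := by
  have h1 := (hh.nonneg 0).trans (hh.decay K 0)
  have hW' : (0 : ℝ) < W := by exact_mod_cast hW
  by_contra hB
  push Not at hB
  have : B K / W * ((1 + (perAbs N 0 / W) ^ 2) ^ K)⁻¹ < 0 :=
    mul_neg_of_neg_of_pos (div_neg_of_neg_of_pos hB hW') (by positivity)
  linarith

theorem IsStep.le_const (hh : IsStep N W B h) (u : ℤ) : h u ≤ B 0 / W := by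
  simpa using hh.decay 0 u

/-- Of the m + 1 decay factors, m absorb the moment and the last one makes the sum over the torus
O(W). -/
theorem IsStep.moment_le (hh : IsStep N W B h) (hN : 0 < N) (hW : 0 < W) (m : ℕ) :
    ∑ u ∈ torus N, h u * (((u : ℝ) / W) ^ 2) ^ m ≤ 5 * B (m + 1) := by
  have hW' : (0 : ℝ) < W := by exact_mod_cast hW
  have hB := hh.decay_const_nonneg hW (m + 1)
  calc _ ≤ ∑ u ∈ torus N, B (m + 1) / W * (1 + ((u : ℝ) / W) ^ 2)⁻¹ := by
        refine sum_le_sum fun u hu ↦ ?_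
        have h1 := hh.decay (m + 1) u
        rw [perAbs_of_mem hu, div_pow, sq_abs, ← div_pow] at h1
        refine (mul_le_mul_of_nonneg_right h1 (by positivity)).trans ?_
        rw [mul_assoc]
        refine mul_le_mul_of_nonneg_left ?_ (by positivity)
        rw [pow_succ, mul_inv, mul_right_comm]
        refine mul_le_of_le_one_left (by positivity) ?_
        rw [inv_mul_le_iff₀ (by positivity), mul_one]
        exact pow_le_pow_left₀ (by positivity) (by linarith) m
    _ ≤ B (m + 1) / W * (5 * W) := by
        rw [← mul_sum]
        exact mul_le_mul_of_nonneg_left (sum_torus_inv_le hN hW) (by positivity)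
    _ = 5 * B (m + 1) := by field_simp

theorem IsStep.circ_nonneg (hh : IsStep N W B h) (n : ℕ) (x y : Torus N) :
    0 ≤ (circ N h ^ n) x y := by
  induction n generalizing x y with
  | zero => rw [pow_zero, Matrix.one_apply]; split_ifs <;> norm_num
  | succ n ih =>
    rw [pow_succ, Matrix.mul_apply]
    exact sum_nonneg fun w _ ↦ mul_nonneg (ih x w) (hh.nonneg _)

theorem IsStep.row_sum (hh : IsStep N W B h) (hN : 0 < N) (n : ℕ) (x : Torus N) :
    ∑ y, (circ N h ^ n) x y = 1 := by
  induction n generalizing x with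
  | zero => simp [Matrix.one_apply]
  | succ n ih =>
    simp only [pow_succ', Matrix.mul_apply]
    rw [sum_comm]
    simp only [← mul_sum, ih, mul_one]
    simp only [circ, Matrix.of_apply]
    rw [Finset.sum_coe_sort (torus N) (fun w ↦ h (x.1 - w)), sum_torus_sub hN hh.periodic,
      hh.sum_eq_one]

theorem IsStep.circ_le (hh : IsStep N W B h) (hN : 0 < N) (n : ℕ) (x y : Torus N) :
    (circ N h ^ (n + 1)) x y ≤ B 0 / W := by
  rw [pow_succ, Matrix.mul_apply]
  calc _ ≤ ∑ w, (circ N h ^ n) x w * (B 0 / W) :=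
        sum_le_sum fun w _ ↦ mul_le_mul_of_nonneg_left (hh.le_const _) (hh.circ_nonneg n x w)
    _ = B 0 / W := by rw [← sum_mul, hh.row_sum hN, one_mul]

/-- The periodic polynomial weight on the diffusive scale `√n W`. -/
noncomputable def weight (N W k n : ℕ) (u : ℤ) : ℝ :=
  (1 + perAbs N u ^ 2 / (n * (W : ℝ) ^ 2)) ^ k

theorem weight_pos (N W k n : ℕ) (u : ℤ) : 0 < weight N W k n u := by
  unfold weight; positivity

theorem one_le_weight (N W k n : ℕ) (u : ℤ) : 1 ≤ weight N W k n u :=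
  one_le_pow₀ (le_add_of_nonneg_right (by positivity))

theorem weight_periodic (N W k n : ℕ) : Function.Periodic (weight N W k n) (N : ℤ) := fun u ↦ by
  simp only [weight, perAbs_periodic N u]

theorem weight_neg (hN : 0 < N) (k n : ℕ) (u : ℤ) : weight N W k n (-u) = weight N W k n u := by
  simp only [weight, perAbs_neg hN]

theorem weight_add_le (hN : 0 < N) (k n : ℕ) (u v : ℤ) :
    weight N W k n (u + v) ≤ 4 ^ k * (weight N W k n u + weight N W k n v) := by
  have key : ∀ a b d t : ℝ, 0 ≤ t → 0 ≤ d → d ≤ a + b → b ≤ a → 0 ≤ b →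
      (1 + d ^ 2 / t) ^ k ≤ 4 ^ k * (1 + a ^ 2 / t) ^ k := by
    intro a b d t ht hd h1 h2 h3
    rw [← mul_pow]
    refine pow_le_pow_left₀ (by positivity) ?_ k
    have : d ^ 2 / t ≤ 4 * a ^ 2 / t := by
      refine div_le_div_of_nonneg_right ?_ ht
      nlinarith
    rw [mul_div_assoc] at this
    linarith
  have h1 := perAbs_add_le hN u v
  have hu := perAbs_nonneg N u
  have hv := perAbs_nonneg N v
  have huv := perAbs_nonneg N (u + v)
  have pu := (weight_pos N W k n u).le
  have pv := (weight_pos N W k n v).le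
  rw [mul_add]
  rcases le_total (perAbs N v) (perAbs N u) with h2 | h2
  · exact (key _ _ _ _ (by positivity) huv h1 h2 hv).trans
      (le_add_of_nonneg_right (by positivity))
  · exact (key _ _ _ _ (by positivity) huv (by linarith) h2 hu).trans
      (le_add_of_nonneg_left (by positivity))

/-- A step has size W while the weight varies on the scale √n W, and the first-order change cancels
by symmetry. So a step increases the mean weight only by a relative amount O(1/n), which stays
bounded over n steps. -/
theorem IsStep.sum_weight_le (B : ℕ → ℝ) {k : ℕ} (hk : 1 ≤ k) : ∃ C : ℝ, 0 ≤ C ∧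
    ∀ (N W : ℕ) (h : ℤ → ℝ), 0 < N → 0 < W → IsStep N W B h → ∀ n : ℕ, 1 ≤ n → ∀ x : ℤ,
      ∑ u ∈ torus N, h u * weight N W k n (x - u) ≤ (1 + C / n) * weight N W k n x := by
  obtain ⟨C, hC0, hC⟩ := avg_weight_le hk
  refine ⟨C * (5 * |B 2| + 5 * |B (k + 1)|), by positivity, fun N W h hN hW hh n hn x ↦ ?_⟩
  have hW' : (0 : ℝ) < W := by exact_mod_cast hW
  have hn' : (1 : ℝ) ≤ n := by exact_mod_cast hn
  set t : ℝ := √(n * (W : ℝ) ^ 2) with ht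
  have ht0 : 0 < t := sqrt_pos.2 (by positivity)
  have ht2 : t ^ 2 = n * (W : ℝ) ^ 2 := sq_sqrt (by positivity)
  have hsym : ∑ u ∈ torus N, h u * weight N W k n (x - u)
      = ∑ u ∈ torus N, h u * weight N W k n (x + u) := by
    have hp : Function.Periodic (fun u ↦ h u * weight N W k n (x + u)) (N : ℤ) := fun u ↦ by
      simp only [hh.periodic u, ← add_assoc, weight_periodic N W k n (x + u)]
    rw [← sum_torus_neg hN hp]
    exact sum_congr rfl fun u _ ↦ by rw [hh.even, Int.sub_eq_add_neg]
  set X : ℝ := perAbs N x / t with hX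
  have hw : ∀ y : ℤ, weight N W k n y ≤ (1 + ((y : ℝ) / t) ^ 2) ^ k := fun y ↦ by
    rw [weight, div_pow, ht2, ← sq_abs (y : ℝ)]
    have := perAbs_le_abs hN y
    have := perAbs_nonneg N y
    gcongr
  have hwx : weight N W k n x = (1 + (((rep N x : ℤ) : ℝ) / t) ^ 2) ^ k := by
    rw [weight, div_pow, ht2, perAbs, sq_abs]
  have hrep : ∀ c : ℤ, weight N W k n (x + c) = weight N W k n (rep N x + c) := fun c ↦ by
    obtain ⟨m, hm⟩ := rep_add_mul N x
    rw [hm, add_right_comm]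
    exact ((weight_periodic N W k n).int_mul m (x + c)).symm
  set P := weight N W k n x
  have hP : 0 < P := weight_pos ..
  have hm1 := hh.moment_le hN hW 1
  have hmk := hh.moment_le hN hW k
  have key : 2 * ∑ u ∈ torus N, h u * weight N W k n (x - u)
      ≤ ∑ u ∈ torus N, 2 * (P * (h u + C / n *
        (h u * (((u : ℝ) / W) ^ 2) ^ 1 + h u * (((u : ℝ) / W) ^ 2) ^ k))) := by
    rw [two_mul]
    nth_rewrite 1 [hsym]
    rw [← sum_add_distrib]
    refine sum_le_sum fun u _ ↦ ?_
    rw [← mul_add, Int.sub_eq_add_neg, hrep, hrep]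
    have h1 := hw (rep N x + u)
    have h2 := hw (rep N x + -u)
    have h3 := hC (((rep N x : ℤ) : ℝ) / t) ((u : ℝ) / t)
    rw [← hwx, ← add_div, ← sub_div] at h3
    push_cast at h1 h2
    rw [← sub_eq_add_neg] at h2
    have h4 : ((u : ℝ) / t) ^ 2 = ((u : ℝ) / W) ^ 2 / n := by rw [div_pow, ht2]; field_simp
    -- The rescaling gives n⁻ᵏ, which is at most n⁻¹ because k ≥ 1.
    have h5 : (((u : ℝ) / t) ^ 2) ^ k ≤ (((u : ℝ) / W) ^ 2) ^ k / n := by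
      rw [h4, div_pow]
      refine div_le_div_of_nonneg_left (by positivity) (by positivity) ?_
      exact le_self_pow₀ hn' (by omega)
    have h6 : weight N W k n (rep N x + u) + weight N W k n (rep N x + -u)
        ≤ 2 * (P * (1 + C * (((u : ℝ) / W) ^ 2 / n + (((u : ℝ) / W) ^ 2) ^ k / n))) := by
      refine (add_le_add h1 h2).trans (h3.trans ?_)
      rw [← h4]
      gcongr
    refine (mul_le_mul_of_nonneg_left h6 (hh.nonneg u)).trans (le_of_eq ?_)
    ring
  rw [← mul_sum, ← mul_sum, sum_add_distrib, ← mul_sum, sum_add_distrib, hh.sum_eq_one] at key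
  have hfin : C / n * (∑ u ∈ torus N, h u * (((u : ℝ) / W) ^ 2) ^ 1
      + ∑ u ∈ torus N, h u * (((u : ℝ) / W) ^ 2) ^ k)
      ≤ C * (5 * |B 2| + 5 * |B (k + 1)|) / n := by
    rw [mul_div_right_comm]
    refine mul_le_mul_of_nonneg_left ?_ (by positivity)
    have := le_abs_self (B 2)
    have := le_abs_self (B (k + 1))
    norm_num at hm1 hmk ⊢
    linarith
  have := mul_le_mul_of_nonneg_left hfin hP.le
  linarith

/-- Polynomial tails of the `n`-step distribution, on the diffusive scale. -/
theorem IsStep.circ_pow_le (B : ℕ → ℝ) {k : ℕ} (hk : 1 ≤ k) : ∃ C : ℝ, 0 ≤ C ∧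
    ∀ (N W : ℕ) (h : ℤ → ℝ), 0 < N → 0 < W → IsStep N W B h → ∀ (n : ℕ) (x y : Torus N),
      (circ N h ^ (n + 1)) x y ≤ C / W * (weight N W k (n + 1) (x.1 - y.1))⁻¹ := by
  obtain ⟨C, hC0, hC⟩ := IsStep.sum_weight_le B hk
  refine ⟨4 ^ k * (|B 0| * exp C + |B k|), by positivity, fun N W h hN hW hh n x y ↦ ?_⟩
  have hW' : (0 : ℝ) < W := by exact_mod_cast hW
  have hn' : (0 : ℝ) < (n + 1 : ℕ) := by positivity
  set c : ℝ := 1 + C / (n + 1 : ℕ) with hc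
  have hc0 : 0 ≤ c := by positivity
  -- The weight keeps the final scale n + 1 while the number of steps a varies; at a = n the
  -- accumulated factor is at most e^C.
  have row : ∀ (a : ℕ) (x y : Torus N), ∑ w, (circ N h ^ a) x w * weight N W k (n + 1) (w.1 - y.1)
      ≤ c ^ a * weight N W k (n + 1) (x.1 - y.1) := by
    intro a
    induction a with
    | zero => intro x y; simp [Matrix.one_apply]
    | succ a ih =>
      intro x y
      simp only [pow_succ', Matrix.mul_apply, sum_mul]
      rw [sum_comm]
      calc _ = ∑ v, circ N h x v * ∑ w, (circ N h ^ a) v w * weight N W k (n + 1) (w.1 - y.1) := by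
            simp only [mul_sum, mul_assoc]
        _ ≤ ∑ v, circ N h x v * (c ^ a * weight N W k (n + 1) (v.1 - y.1)) :=
            sum_le_sum fun v _ ↦ mul_le_mul_of_nonneg_left (ih v y) (hh.nonneg _)
        _ = c ^ a * ∑ v : Torus N, h (x.1 - v.1) * weight N W k (n + 1) (v.1 - y.1) := by
            rw [mul_sum]
            exact sum_congr rfl fun v _ ↦ by simp only [circ, Matrix.of_apply]; ring
        _ ≤ c ^ a * (c * weight N W k (n + 1) (x.1 - y.1)) := by
            refine mul_le_mul_of_nonneg_left ?_ (by positivity)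
            have hp : Function.Periodic
                (fun u ↦ h u * weight N W k (n + 1) (x.1 - y.1 - u)) (N : ℤ) := fun u ↦ by
              have := weight_periodic N W k (n + 1) (x.1 - y.1 - (u + N))
              rw [sub_add_eq_sub_sub, sub_add_cancel] at this
              simp only [hh.periodic u, sub_add_eq_sub_sub, ← this]
            rw [Finset.sum_coe_sort (torus N)
              (fun v ↦ h (x.1 - v) * weight N W k (n + 1) (v - y.1))]
            refine le_trans (le_of_eq ?_) (hC N W h hN hW hh (n + 1) (by omega) (x.1 - y.1))
            rw [← sum_torus_sub hN hp x.1]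
            refine sum_congr rfl fun v _ ↦ ?_
            rw [show x.1 - y.1 - (x.1 - v) = v - y.1 by ring]
        _ = _ := by ring
  have hexp : c ^ n ≤ exp C := by
    have h1 : c ≤ exp (C / (n + 1 : ℕ)) := by linarith [add_one_le_exp (C / ((n + 1 : ℕ) : ℝ))]
    calc c ^ n ≤ exp (C / (n + 1 : ℕ)) ^ n := pow_le_pow_left₀ hc0 h1 n
      _ = exp (n * (C / (n + 1 : ℕ))) := (exp_nat_mul _ _).symm
      _ ≤ exp C := by
        refine exp_le_exp.2 ?_
        rw [mul_div_left_comm]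
        refine mul_le_of_le_one_right hC0 ((div_le_one hn').2 ?_)
        push_cast; linarith
  have hdec : ∀ u : ℤ, h u * weight N W k (n + 1) u ≤ |B k| / W := fun u ↦ by
    have h1 := hh.decay k u
    have h2 : weight N W k (n + 1) u ≤ (1 + (perAbs N u / W) ^ 2) ^ k := by
      unfold weight
      rw [div_pow]
      have : (W : ℝ) ^ 2 ≤ (n + 1 : ℕ) * (W : ℝ) ^ 2 :=
        le_mul_of_one_le_left (by positivity) (by push_cast; linarith [n.cast_nonneg (α := ℝ)])
      gcongr
    calc _ ≤ |B k| / W * ((1 + (perAbs N u / W) ^ 2) ^ k)⁻¹ * (1 + (perAbs N u / W) ^ 2) ^ k := by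
          refine mul_le_mul (h1.trans ?_) h2 (weight_pos ..).le (by positivity)
          gcongr; exact le_abs_self _
      _ = |B k| / W := by field_simp
  rw [← div_eq_mul_inv, le_div_iff₀ (weight_pos ..), pow_succ, Matrix.mul_apply, sum_mul]
  -- From the mean to a pointwise bound by splitting off the last step: the weight of x - y falls
  -- either on the first n steps, where the last step is bounded by `B 0 / W`, or on the last step,
  -- whose own decay absorbs it.
  calc _ ≤ ∑ w, ((4 ^ k * (|B 0| / W)) * ((circ N h ^ n) x w * weight N W k (n + 1) (w.1 - x.1))
          + 4 ^ k * (|B k| / W) * (circ N h ^ n) x w) := by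
        refine sum_le_sum fun w _ ↦ ?_
        have h1 := weight_add_le (W := W) hN k (n + 1) (x.1 - w.1) (w.1 - y.1)
        rw [sub_add_sub_cancel] at h1
        have h2 : weight N W k (n + 1) (x.1 - w.1) = weight N W k (n + 1) (w.1 - x.1) := by
          rw [← weight_neg hN, neg_sub]
        rw [h2] at h1
        have h3 := hh.circ_nonneg n x w
        have h4 : circ N h w y = h (w.1 - y.1) := rfl
        have h5 := hh.nonneg (w.1 - y.1)
        have h6 : h (w.1 - y.1) ≤ |B 0| / W :=
          (hh.le_const _).trans (by gcongr; exact le_abs_self _)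
        have h7 := hdec (w.1 - y.1)
        have h8 := (weight_pos N W k (n + 1) (w.1 - x.1)).le
        rw [h4]
        calc _ ≤ (circ N h ^ n) x w * h (w.1 - y.1) * (4 ^ k * (weight N W k (n + 1) (w.1 - x.1)
                + weight N W k (n + 1) (w.1 - y.1))) :=
              mul_le_mul_of_nonneg_left h1 (mul_nonneg h3 h5)
          _ = 4 ^ k * ((circ N h ^ n) x w * weight N W k (n + 1) (w.1 - x.1)) * h (w.1 - y.1)
              + 4 ^ k * (circ N h ^ n) x w
                * (h (w.1 - y.1) * weight N W k (n + 1) (w.1 - y.1)) := by ring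
          _ ≤ 4 ^ k * ((circ N h ^ n) x w * weight N W k (n + 1) (w.1 - x.1)) * (|B 0| / W)
              + 4 ^ k * (circ N h ^ n) x w * (|B k| / W) := by gcongr
          _ = _ := by ring
    _ ≤ (4 ^ k * (|B 0| / W)) * exp C + 4 ^ k * (|B k| / W) := by
        rw [sum_add_distrib, ← mul_sum, ← mul_sum, hh.row_sum hN, mul_one]
        have h1 := row n x x
        rw [sub_self] at h1
        have h2 : weight N W k (n + 1) 0 = 1 := by simp [weight, perAbs, rep]
        rw [h2, mul_one] at h1
        gcongr
        exact h1.trans hexp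
    _ = _ := by ring

end Step
-- Comparison of the n-step laws of two walks with equal variance.
theorem exists_one_add_pow_le_exp {c : ℝ} (hc : 0 < c) (k : ℕ) :
    ∃ C : ℝ, 0 < C ∧ ∀ x : ℝ, 0 ≤ x → (1 + x) ^ k ≤ C * exp (c * x) := by
  refine ⟨k.factorial / c ^ k * exp c, by positivity, fun x hx ↦ ?_⟩
  have h1 := pow_div_factorial_le_exp (c * (1 + x)) (by positivity) k
  rw [div_le_iff₀ (by positivity), mul_pow] at h1
  have h2 : exp (c * (1 + x)) = exp c * exp (c * x) := by rw [← exp_add]; ring_nf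
  rw [h2] at h1
  rw [div_mul_eq_mul_div, div_mul_eq_mul_div, le_div_iff₀ (by positivity)]
  linarith

/-- Here a, b are two symbols at rescaled frequency q. For |q| ≤ 1 the mean value bound m|a - b|
max(|a|, |b|)^(m-1) is at most C q⁴ m exp(-cmq²/2), using m - 1 ≥ m/2. For |q| ≥ 1 both powers are
exponentially small in m; two factors are kept as a² + b², so that summing over frequencies costs
O(N/W) by Parseval and not O(N). -/
theorem exists_abs_pow_sub_pow_le {c C₄ : ℝ} (hc : 0 < c) (hC₄ : 0 ≤ C₄) :
    ∃ C : ℝ, 0 < C ∧ ∀ (m : ℕ) (a b q : ℝ), 2 ≤ m → |a| ≤ exp (-(c * min 1 (q ^ 2))) →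
      |b| ≤ exp (-(c * min 1 (q ^ 2))) → |a - b| ≤ C₄ * q ^ 4 →
      |a ^ m - b ^ m| ≤ C * ((m * (1 + m * q ^ 2))⁻¹ + (m * √m)⁻¹ * (a ^ 2 + b ^ 2)) := by
  obtain ⟨C₁, hC₁0, hC₁⟩ := exists_one_add_pow_le_exp (half_pos hc) 3
  obtain ⟨C₂, hC₂0, hC₂⟩ := exists_one_add_pow_le_exp hc 2
  refine ⟨C₄ * C₁ + exp (2 * c) * C₂, by positivity, fun m a b q hm ha hb hab ↦ ?_⟩
  have hm' : (2 : ℝ) ≤ m := by exact_mod_cast hm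
  have hm0 : (0 : ℝ) < m := by linarith
  have hs0 : 0 < √(m : ℝ) := sqrt_pos.2 hm0
  rcases le_total (q ^ 2) 1 with hq | hq
  · rw [min_eq_right hq] at ha hb
    have h1 := abs_pow_sub_pow_le (a := a) (b := b) m
    have h2 : max |a| |b| ^ (m - 1) ≤ exp (-(c / 2 * (m * q ^ 2))) := by
      calc _ ≤ exp (-(c * q ^ 2)) ^ (m - 1) :=
            pow_le_pow_left₀ (le_max_of_le_left (abs_nonneg a)) (max_le ha hb) _
        _ = exp ((m - 1 : ℕ) * -(c * q ^ 2)) := (exp_nat_mul _ _).symm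
        _ ≤ _ := by
            refine exp_le_exp.2 ?_
            rw [Nat.cast_sub (by omega)]
            push_cast
            nlinarith [mul_nonneg hc.le (sq_nonneg q)]
    have h3 := hC₁ (m * q ^ 2) (by positivity)
    set x := (m : ℝ) * q ^ 2 with hx
    have hx0 : 0 ≤ x := by positivity
    have h4 : x ^ 2 * exp (-(c / 2 * x)) ≤ C₁ * (1 + x)⁻¹ := by
      rw [exp_neg, ← div_eq_mul_inv, ← div_eq_mul_inv, div_le_div_iff₀ (exp_pos _) (by positivity)]
      refine le_trans ?_ h3
      nlinarith [pow_nonneg hx0 2, pow_nonneg hx0 3]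
    calc _ ≤ _ := h1
      _ ≤ C₄ * q ^ 4 * m * exp (-(c / 2 * x)) := by gcongr
      _ = C₄ * (m : ℝ)⁻¹ * (x ^ 2 * exp (-(c / 2 * x))) := by rw [hx]; field_simp
      _ ≤ C₄ * (m : ℝ)⁻¹ * (C₁ * (1 + x)⁻¹) := by gcongr
      _ = C₄ * C₁ * (m * (1 + x))⁻¹ := by rw [mul_inv]; ring
      _ ≤ _ := by
        refine mul_le_mul (le_add_of_nonneg_right (by positivity))
          (le_add_of_nonneg_right (by positivity)) (by positivity) (by positivity)
  · rw [min_eq_left hq, mul_one] at ha hb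
    have h1 : exp (-c) ^ (m - 2) ≤ exp (2 * c) * C₂ * (m * √m)⁻¹ := by
      rw [← exp_nat_mul, Nat.cast_sub hm]
      have e1 : ((m : ℝ) - (2 : ℕ)) * -c = 2 * c + -(c * m) := by push_cast; ring
      rw [e1, exp_add, mul_assoc]
      refine mul_le_mul_of_nonneg_left ?_ (exp_pos _).le
      rw [exp_neg, ← div_eq_mul_inv, le_div_iff₀ (by positivity), inv_mul_le_iff₀ (exp_pos _),
        mul_comm (exp _)]
      refine le_trans ?_ (hC₂ m hm0.le)
      have : √(m : ℝ) ≤ m := by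
        rw [sqrt_le_left hm0.le]; nlinarith
      nlinarith
    have h2 : ∀ t : ℝ, |t| ≤ exp (-c) → |t ^ m| ≤ exp (-c) ^ (m - 2) * t ^ 2 := fun t ht ↦ by
      have : m = (m - 2) + 2 := by omega
      nth_rewrite 1 [this]
      rw [abs_pow, pow_add, sq_abs]
      exact mul_le_mul_of_nonneg_right (pow_le_pow_left₀ (abs_nonneg t) ht _) (sq_nonneg t)
    calc _ ≤ |a ^ m| + |b ^ m| := abs_sub _ _
      _ ≤ exp (-c) ^ (m - 2) * (a ^ 2 + b ^ 2) := by
          rw [mul_add]; exact add_le_add (h2 a ha) (h2 b hb)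
      _ ≤ exp (2 * c) * C₂ * (m * √m)⁻¹ * (a ^ 2 + b ^ 2) := by gcongr
      _ = exp (2 * c) * C₂ * ((m * √m)⁻¹ * (a ^ 2 + b ^ 2)) := by ring
      _ ≤ _ := by
        refine mul_le_mul (le_add_of_nonneg_left (by positivity))
          (le_add_of_nonneg_left (by positivity)) (by positivity) (by positivity)

/-- A bound on the symbol of a step distribution away from frequency zero. -/
def HasGap (N W : ℕ) (c : ℝ) (h : ℤ → ℝ) : Prop :=
  ∀ j ∈ torus N, |symb N h j| ≤ exp (-(c * min 1 ((freq N j * W) ^ 2)))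

theorem HasGap.abs_symb_le_one {N W : ℕ} {c : ℝ} {h : ℤ → ℝ} (hc : 0 ≤ c) (hg : HasGap N W c h)
    {j : ℤ} (hj : j ∈ torus N) : |symb N h j| ≤ 1 := by
  refine (hg j hj).trans (exp_le_one_iff.2 (neg_nonpos.2 (mul_nonneg hc ?_)))
  positivity

theorem HasGap.mono {N W : ℕ} {c c' : ℝ} {h : ℤ → ℝ} (hg : HasGap N W c h) (hc : c' ≤ c) :
    HasGap N W c' h := fun j hj ↦ (hg j hj).trans (exp_le_exp.2 (neg_le_neg
      (mul_le_mul_of_nonneg_right hc (by positivity))))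

/-- Two walks with the same variance have close `n`-step distributions. -/
theorem IsStep.abs_circ_pow_sub_le (B : ℕ → ℝ) {c C₄ : ℝ} (hc : 0 < c) (hC₄ : 0 ≤ C₄) :
    ∃ C : ℝ, 0 ≤ C ∧ ∀ (N W : ℕ) (h g : ℤ → ℝ), 0 < N → 0 < W →
      IsStep N W B h → IsStep N W B g → HasGap N W c h → HasGap N W c g →
      (∀ j ∈ torus N, |symb N h j - symb N g j| ≤ C₄ * (freq N j * W) ^ 4) →
      ∀ (n : ℕ) (x y : Torus N), |(circ N h ^ (n + 1)) x y - (circ N g ^ (n + 1)) x y|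
        ≤ C / W * (((n + 1 : ℕ) : ℝ) * √(n + 1 : ℕ))⁻¹ := by
  obtain ⟨C, hC0, hC⟩ := exists_abs_pow_sub_pow_le hc hC₄
  refine ⟨C * (1 + 2 * |B 0|) + |B 0|, by positivity, fun N W h g hN hW hh hg gh gg hd n x y ↦ ?_⟩
  have hW' : (0 : ℝ) < W := by exact_mod_cast hW
  have hN' : (0 : ℝ) < N := by exact_mod_cast hN
  have hB : B 0 / W ≤ |B 0| / W := by gcongr; exact le_abs_self _
  -- The frequency estimate needs at least two steps; one step is bounded by `B 0 / W` directly.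
  rcases Nat.eq_zero_or_pos n with rfl | hn
  · have h1 := hh.circ_le hN 0 x y
    have h2 := hg.circ_le hN 0 x y
    have h3 := hh.circ_nonneg (0 + 1) x y
    have h4 := hg.circ_nonneg (0 + 1) x y
    have h5 : |B 0| / W ≤ (C * (1 + 2 * |B 0|) + |B 0|) / W := by
      gcongr; exact le_add_of_nonneg_left (by positivity)
    simp only [zero_add, Nat.cast_one, sqrt_one, mul_one, inv_one] at *
    rw [abs_le]
    constructor <;> linarith
  set m := n + 1 with hm
  have hm2 : 2 ≤ m := by omega
  have hm0 : (0 : ℝ) < m := by positivity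
  have hs0 : 0 < √(m : ℝ) := sqrt_pos.2 hm0
  have h1 : (circ N h ^ m) x y - (circ N g ^ m) x y
      = four N (fun j ↦ symb N h j ^ m - symb N g j ^ m) x y := by
    rw [circ_pow hN hh.periodic hh.even, circ_pow hN hg.periodic hg.even, ← four_sub,
      Matrix.sub_apply]
  -- Frequency zero is treated apart: the symbols agree there, whereas the general bound would leave
  -- a term 1/(Nm), too large for m beyond (N/W)².
  have key : ∀ j ∈ torus N, |symb N h j ^ m - symb N g j ^ m|
      ≤ C * ((if j = 0 then 0 else ((m : ℝ) * (1 + m * (freq N j * W) ^ 2))⁻¹)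
        + (m * √m)⁻¹ * (symb N h j ^ 2 + symb N g j ^ 2)) := fun j hj ↦ by
    split_ifs with hj0
    · have h2 := hd j hj
      have h3 : freq N j = 0 := by simp [hj0, freq]
      rw [h3] at h2
      simp only [zero_mul, ne_eq, OfNat.ofNat_ne_zero, not_false_eq_true, zero_pow, mul_zero] at h2
      rw [sub_eq_zero.1 (abs_nonpos_iff.1 h2), sub_self, abs_zero]
      positivity
    · exact hC m _ _ _ hm2 (gh j hj) (gg j hj) (hd j hj)
  rw [h1]
  refine (abs_four_le hN key x y).trans ?_
  rw [← mul_sum, sum_add_distrib, ← mul_sum, sum_add_distrib]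
  -- Parseval: the mean of the squared symbol is the two-step return probability.
  have hsq : ∀ f : ℤ → ℝ, IsStep N W B f → (N : ℝ)⁻¹ * ∑ j ∈ torus N, symb N f j ^ 2 ≤ |B 0| / W :=
    fun f hf ↦ by
      have := hf.circ_le hN 1 x x
      rw [circ_pow hN hf.periodic hf.even, four_diag] at this
      exact this.trans hB
  have hfirst : (N : ℝ)⁻¹ * ∑ j ∈ torus N,
      (if j = 0 then 0 else ((m : ℝ) * (1 + m * (freq N j * W) ^ 2))⁻¹) ≤ 1 / W * (m * √m)⁻¹ := by
    rw [← sum_erase (torus N) (a := 0) (by simp)]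
    set a : ℝ := √m * (2 * π * W / N) with ha
    have ha0 : 0 < a := by have := pi_pos; positivity
    have h2 : ∑ j ∈ (torus N).erase 0,
        (if j = 0 then 0 else ((m : ℝ) * (1 + m * (freq N j * W) ^ 2))⁻¹)
        = (m : ℝ)⁻¹ * ∑ j ∈ (torus N).erase 0, (1 + (a * j) ^ 2)⁻¹ := by
      rw [mul_sum]
      refine sum_congr rfl fun j hj ↦ ?_
      rw [if_neg (ne_of_mem_erase hj), mul_inv]
      have : (a * j) ^ 2 = √(m : ℝ) ^ 2 * (freq N j * W) ^ 2 := by rw [ha, freq]; ring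
      rw [this, sq_sqrt hm0.le]
    rw [h2]
    calc _ ≤ (N : ℝ)⁻¹ * ((m : ℝ)⁻¹ * (4 / a)) := by
          gcongr; exact sum_torus_erase_inv_le ha0
      _ = 2 / π * (1 / W * (m * √m)⁻¹) := by
          rw [ha]; field_simp; norm_num
      _ ≤ 1 / W * (m * √m)⁻¹ := by
          refine mul_le_of_le_one_left (by positivity) ?_
          rw [div_le_one pi_pos]; exact two_le_pi
  have h2 := hsq h hh
  have h3 := hsq g hg
  calc _ = C * ((N : ℝ)⁻¹ * ∑ j ∈ torus N,
        (if j = 0 then 0 else ((m : ℝ) * (1 + m * (freq N j * W) ^ 2))⁻¹)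
        + (m * √m)⁻¹ * ((N : ℝ)⁻¹ * ∑ j ∈ torus N, symb N h j ^ 2
          + (N : ℝ)⁻¹ * ∑ j ∈ torus N, symb N g j ^ 2)) := by ring
    _ ≤ C * (1 / W * (m * √m)⁻¹ + (m * √m)⁻¹ * (|B 0| / W + |B 0| / W)) := by gcongr
    _ = C * (1 + 2 * |B 0|) / W * (m * √m)⁻¹ := by ring
    _ ≤ _ := by gcongr; exact le_add_of_nonneg_right (abs_nonneg _)

/-- With s = m^{1/4} the hypotheses bound X by c s⁻⁶ and by c V⁻⁶, hence by c s⁻⁵ V⁻¹. The exponent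
5/4 is still above 1, so a summable power of m and one factor V⁻¹ are obtained together. -/
theorem le_inv_mul_inv_of_le {m V X c : ℝ} (hm : 1 ≤ m) (hV : 1 ≤ V) (hc : 0 ≤ c)
    (h1 : X ≤ c * (m * √m)⁻¹) (h2 : X ≤ c * (V ^ 6)⁻¹) :
    X ≤ c * ((m ^ (5 / 4 : ℝ))⁻¹ * V⁻¹) := by
  have hm0 : 0 < m := by linarith
  set s := m ^ (1 / 4 : ℝ) with hs
  have hs0 : 0 < s := rpow_pos_of_pos hm0 _
  have e1 : m * √m = s ^ 6 := by
    rw [sqrt_eq_rpow, hs, ← rpow_mul_natCast hm0.le]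
    nth_rewrite 1 [← rpow_one m]
    rw [← rpow_add hm0]; norm_num
  have e2 : m ^ (5 / 4 : ℝ) = s ^ 5 := by
    rw [hs, ← rpow_mul_natCast hm0.le]; norm_num
  rw [e1] at h1
  rw [e2, ← mul_inv]
  rcases le_total V s with h | h
  · refine h1.trans (mul_le_mul_of_nonneg_left (inv_anti₀ (by positivity) ?_) hc)
    rw [pow_succ s 5]; gcongr
  · refine h2.trans (mul_le_mul_of_nonneg_left (inv_anti₀ (by positivity) ?_) hc)
    rw [pow_succ V 5]; gcongr

theorem weight_pow (N W k l n : ℕ) (u : ℤ) : weight N W k n u ^ l = weight N W (k * l) n u := by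
  simp only [weight, pow_mul]

theorem IsStep.abs_circ_pow_sub_le_weight (B : ℕ → ℝ) {c C₄ : ℝ} (hc : 0 < c) (hC₄ : 0 ≤ C₄)
    {k : ℕ} (hk : 1 ≤ k) :
    ∃ C : ℝ, 0 ≤ C ∧ ∀ (N W : ℕ) (h g : ℤ → ℝ), 0 < N → 0 < W →
      IsStep N W B h → IsStep N W B g → HasGap N W c h → HasGap N W c g →
      (∀ j ∈ torus N, |symb N h j - symb N g j| ≤ C₄ * (freq N j * W) ^ 4) →
      ∀ (n : ℕ) (x y : Torus N), |(circ N h ^ (n + 1)) x y - (circ N g ^ (n + 1)) x y|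
        ≤ C / W * ((((n + 1 : ℕ) : ℝ) ^ (5 / 4 : ℝ))⁻¹ * (weight N W k (n + 1) (x.1 - y.1))⁻¹) := by
  -- Tails of order 6k are needed, since the interpolation keeps only one factor of the weight out
  -- of six.
  obtain ⟨C₁, hC₁0, hC₁⟩ := IsStep.circ_pow_le B (k := k * 6) (by omega)
  obtain ⟨C₂, hC₂0, hC₂⟩ := IsStep.abs_circ_pow_sub_le B hc hC₄
  refine ⟨max C₁ C₂, le_max_of_le_left hC₁0, fun N W h g hN hW hh hg gh gg hd n x y ↦ ?_⟩
  have h1 := hC₁ N W h hN hW hh n x y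
  have h2 := hC₁ N W g hN hW hg n x y
  have h3 := hC₂ N W h g hN hW hh hg gh gg hd n x y
  have h4 := hh.circ_nonneg (n + 1) x y
  have h5 := hg.circ_nonneg (n + 1) x y
  rw [← weight_pow] at h1 h2
  have hV := one_le_weight N W k (n + 1) (x.1 - y.1)
  refine le_inv_mul_inv_of_le (by push_cast; linarith [n.cast_nonneg (α := ℝ)]) hV (by positivity)
    (h3.trans ?_) (le_trans (b := C₁ / W * (weight N W k (n + 1) (x.1 - y.1) ^ 6)⁻¹) ?_ ?_)
  · exact mul_le_mul_of_nonneg_right (div_le_div_of_nonneg_right (le_max_right _ _)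
      (Nat.cast_nonneg _)) (by positivity)
  · rw [abs_le]; constructor <;> linarith
  · exact mul_le_mul_of_nonneg_right (div_le_div_of_nonneg_right (le_max_left _ _)
      (Nat.cast_nonneg _)) (by positivity)

/-! ### Summation of the Neumann series. -/

/-- Replaces the diffusive scale √m W by W/√η, with m = n + 1: 1 + ηd²/W² ≤ (1 + ηm)(1 + d²/(mW²)),
and (1 + ηm)ᵏ is absorbed by half of the exponential. -/
theorem exists_exp_mul_inv_weight_le {c : ℝ} (hc : 0 < c) (k : ℕ) : ∃ C : ℝ, 0 < C ∧
    ∀ (N W : ℕ) (η : ℝ), 0 < η → ∀ (n : ℕ) (u : ℤ),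
      exp (-(c * (η * (n + 1 : ℕ)))) * (weight N W k (n + 1) u)⁻¹
        ≤ C * exp (-(c / 2 * (η * (n + 1 : ℕ)))) *
          ((1 + η * (perAbs N u / W) ^ 2) ^ k)⁻¹ := by
  obtain ⟨C, hC0, hC⟩ := exists_one_add_pow_le_exp (half_pos hc) k
  refine ⟨C, hC0, fun N W η hη n u ↦ ?_⟩
  set m : ℝ := ((n + 1 : ℕ) : ℝ) with hm
  have hm0 : 0 < m := by positivity
  have hw := weight_pos N W k (n + 1) u
  have h1 := hC (η * m) (by positivity)
  have h2 : (1 + η * (perAbs N u / W) ^ 2) ^ k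
      ≤ (1 + η * m) ^ k * weight N W k (n + 1) u := by
    rw [weight, ← mul_pow]
    refine pow_le_pow_left₀ (by positivity) ?_ k
    rw [← hm, ← div_div, div_right_comm, ← div_pow]
    have : η * (perAbs N u / W) ^ 2 = η * m * ((perAbs N u / W) ^ 2 / m) := by field_simp
    rw [this]
    have : 0 ≤ (perAbs N u / W) ^ 2 / m := by positivity
    nlinarith [mul_pos hη hm0]
  have h3 : exp (-(c * (η * m))) = exp (-(c / 2 * (η * m))) * exp (-(c / 2 * (η * m))) := by
    rw [← exp_add]; ring_nf
  have h4 : exp (c / 2 * (η * m)) * exp (-(c / 2 * (η * m))) = 1 := by rw [← exp_add]; simp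
  rw [← div_eq_mul_inv, ← div_eq_mul_inv, div_le_div_iff₀ hw (by positivity), h3]
  calc _ ≤ exp (-(c / 2 * (η * m))) * exp (-(c / 2 * (η * m))) *
        (C * exp (c / 2 * (η * m)) * weight N W k (n + 1) u) := by
        gcongr; exact h2.trans (by gcongr)
    _ = C * exp (-(c / 2 * (η * m))) * weight N W k (n + 1) u *
        (exp (c / 2 * (η * m)) * exp (-(c / 2 * (η * m)))) := by ring
    _ = _ := by rw [h4, mul_one]

theorem hasSum_exp_neg {b : ℝ} (hb : 0 < b) :
    ∃ s : ℝ, s ≤ b⁻¹ ∧ HasSum (fun n : ℕ ↦ exp (-(b * (n + 1 : ℕ)))) s := by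
  have h1 : exp (-b) < 1 := exp_lt_one_iff.2 (by linarith)
  refine ⟨exp (-b) * (1 - exp (-b))⁻¹, ?_, ?_⟩
  · have h2 := add_one_le_exp b
    have h3 : exp b * exp (-b) = 1 := by rw [← exp_add]; simp
    rw [← div_eq_mul_inv, div_le_iff₀ (by linarith), inv_mul_eq_div, le_div_iff₀ hb]
    nlinarith [exp_pos (-b)]
  · have h2 : (fun n : ℕ ↦ exp (-(b * (n + 1 : ℕ)))) = fun n ↦ exp (-b) * exp (-b) ^ n := by
      funext n
      rw [← exp_nat_mul, ← exp_add]
      push_cast; ring_nf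
    rw [h2]
    exact (hasSum_geometric_of_lt_one (exp_pos (-b)).le h1).mul_left (exp (-b))

theorem pow_le_exp_neg {r c η : ℝ} (hr : 0 ≤ r) (h : r ≤ 1 - c * η) (n : ℕ) :
    r ^ n ≤ exp (-(c * (η * n))) := by
  have : r ≤ exp (-(c * η)) := h.trans (by linarith [add_one_le_exp (-(c * η))])
  refine (pow_le_pow_left₀ hr this n).trans (le_of_eq ?_)
  rw [← exp_nat_mul]; ring_nf

theorem HasGap.abs_mul_symb_lt {N W : ℕ} {c c₁ η r : ℝ} {h : ℤ → ℝ} (hc : 0 ≤ c)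
    (hg : HasGap N W c h) (hr : 0 ≤ r) (hc₁ : 0 < c₁) (hη : 0 < η) (hr1 : r ≤ 1 - c₁ * η)
    {j : ℤ} (hj : j ∈ torus N) : |r * symb N h j| < 1 := by
  rw [abs_mul, abs_of_nonneg hr]
  have := mul_le_mul_of_nonneg_left (hg.abs_symb_le_one hc hj) hr
  have := mul_pos hc₁ hη
  linarith

/-- A bound on the resolvent of a step distribution. -/
theorem IsStep.abs_resolvent_le (B : ℕ → ℝ) {c c₁ : ℝ} (hc : 0 < c) (hc₁ : 0 < c₁) {k : ℕ}
    (hk : 1 ≤ k) : ∃ C : ℝ, 0 ≤ C ∧ ∀ (N W : ℕ) (h : ℤ → ℝ) (η r : ℝ), 0 < N → 0 < W →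
      IsStep N W B h → HasGap N W c h → 0 < η → 0 ≤ r → r ≤ 1 - c₁ * η → ∀ x y : Torus N,
      |four N (fun j ↦ r * symb N h j / (1 - r * symb N h j)) x y|
        ≤ C / η * (1 / W * ((1 + η * (perAbs N (x.1 - y.1) / W) ^ 2) ^ k)⁻¹) := by
  obtain ⟨C₁, hC₁0, hC₁⟩ := IsStep.circ_pow_le B hk
  obtain ⟨C₂, hC₂0, hC₂⟩ := exists_exp_mul_inv_weight_le hc₁ k
  refine ⟨C₁ * C₂ * (c₁ / 2)⁻¹, by positivity, fun N W h η r hN hW hh gh hη hr hr1 x y ↦ ?_⟩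
  have hW' : (0 : ℝ) < W := by exact_mod_cast hW
  have hs := hasSum_resolvent hN hh.periodic hh.even
    (fun j hj ↦ gh.abs_mul_symb_lt hc.le hr hc₁ hη hr1 hj) x y
  obtain ⟨s, hs1, hs2⟩ := hasSum_exp_neg (b := c₁ / 2 * η) (by positivity)
  set ω : ℝ := ((1 + η * (perAbs N (x.1 - y.1) / W) ^ 2) ^ k)⁻¹ with hω
  have hω0 : 0 ≤ ω := by positivity
  rw [← hs.tsum_eq, ← norm_eq_abs]
  refine (tsum_of_norm_bounded (hs2.mul_left (C₁ / W * C₂ * ω)) fun n ↦ ?_).trans ?_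
  · have hwp := weight_pos N W k (n + 1) (x.1 - y.1)
    rw [norm_of_nonneg (mul_nonneg (pow_nonneg hr _) (hh.circ_nonneg _ _ _))]
    calc _ ≤ exp (-(c₁ * (η * (n + 1 : ℕ)))) *
          (C₁ / W * (weight N W k (n + 1) (x.1 - y.1))⁻¹) :=
          mul_le_mul (pow_le_exp_neg hr hr1 _) (hC₁ N W h hN hW hh n x y)
            (hh.circ_nonneg _ _ _) (exp_pos _).le
      _ = C₁ / W * (exp (-(c₁ * (η * (n + 1 : ℕ)))) *
          (weight N W k (n + 1) (x.1 - y.1))⁻¹) := by ring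
      _ ≤ C₁ / W * (C₂ * exp (-(c₁ / 2 * (η * (n + 1 : ℕ)))) * ω) := by
          exact mul_le_mul_of_nonneg_left (hC₂ N W η hη n _) (by positivity)
      _ = _ := by ring_nf
  · calc _ ≤ C₁ / W * C₂ * ω * (c₁ / 2 * η)⁻¹ := by gcongr
      _ = _ := by rw [mul_inv]; ring

/-- Comparison of the resolvents of two walks with the same variance. -/
theorem IsStep.abs_resolvent_sub_le (B : ℕ → ℝ) {c C₄ c₁ C₅ : ℝ} (hc : 0 < c) (hC₄ : 0 ≤ C₄)
    (hc₁ : 0 < c₁) (hC₅ : 0 ≤ C₅) {k : ℕ} (hk : 1 ≤ k) :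
    ∃ C : ℝ, 0 ≤ C ∧ ∀ (N W : ℕ) (h g : ℤ → ℝ) (η r ρ : ℝ), 0 < N → 0 < W →
      IsStep N W B h → IsStep N W B g → HasGap N W c h → HasGap N W c g →
      (∀ j ∈ torus N, |symb N h j - symb N g j| ≤ C₄ * (freq N j * W) ^ 4) →
      0 < η → 0 ≤ r → 0 ≤ ρ → r ≤ 1 - c₁ * η → ρ ≤ 1 - c₁ * η → |r - ρ| ≤ C₅ * η ^ 2 →
      ∀ x y : Torus N, |four N (fun j ↦ r * symb N h j / (1 - r * symb N h j)) x y
          - four N (fun j ↦ ρ * symb N g j / (1 - ρ * symb N g j)) x y|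
        ≤ C * (1 / W * ((1 + η * (perAbs N (x.1 - y.1) / W) ^ 2) ^ k)⁻¹) := by
  obtain ⟨C₁, hC₁0, hC₁⟩ := IsStep.circ_pow_le B hk
  obtain ⟨C₂, hC₂0, hC₂⟩ := exists_exp_mul_inv_weight_le hc₁ k
  obtain ⟨C₃, hC₃0, hC₃⟩ := IsStep.abs_circ_pow_sub_le_weight B hc hC₄ hk
  obtain ⟨C₆, hC₆0, hC₆⟩ := exists_one_add_pow_le_exp (c := c₁ / 4) (by positivity) 1
  have hsum : Summable fun n : ℕ ↦ (((n + 1 : ℕ) : ℝ) ^ (5 / 4 : ℝ))⁻¹ :=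
    (summable_nat_add_iff 1).2 (summable_nat_rpow_inv.2 (by norm_num))
  set T := ∑' n : ℕ, (((n + 1 : ℕ) : ℝ) ^ (5 / 4 : ℝ))⁻¹ with hT
  have hT0 : 0 ≤ T := tsum_nonneg fun n ↦ by positivity
  refine ⟨C₃ * C₂ * T + C₅ * exp 1 * C₁ * C₂ * C₆ * (c₁ / 4)⁻¹, by positivity,
    fun N W h g η r ρ hN hW hh hg gh gg hd hη hr hρ hr1 hρ1 hrρ x y ↦ ?_⟩
  have hW' : (0 : ℝ) < W := by exact_mod_cast hW
  have hs := (hasSum_resolvent hN hh.periodic hh.even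
    (fun j hj ↦ gh.abs_mul_symb_lt hc.le hr hc₁ hη hr1 hj) x y).sub
    (hasSum_resolvent hN hg.periodic hg.even
    (fun j hj ↦ gg.abs_mul_symb_lt hc.le hρ hc₁ hη hρ1 hj) x y)
  obtain ⟨s, hs1, hs2⟩ := hasSum_exp_neg (b := c₁ / 4 * η) (by positivity)
  set ω : ℝ := ((1 + η * (perAbs N (x.1 - y.1) / W) ^ 2) ^ k)⁻¹ with hω
  have hω0 : 0 ≤ ω := by positivity
  rw [← hs.tsum_eq, ← norm_eq_abs]
  refine (tsum_of_norm_bounded ((hsum.hasSum.mul_left (C₃ / W * C₂ * ω)).add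
    (hs2.mul_left (C₅ * η * exp 1 * (C₁ / W) * C₂ * C₆ * ω))) fun n ↦ ?_).trans ?_
  · set m := n + 1 with hm
    have hm0 : (0 : ℝ) < m := by positivity
    have hw := hC₂ N W η hη n (x.1 - y.1)
    rw [← hm, ← hω] at hw
    have hwp := weight_pos N W k m (x.1 - y.1)
    have hG0 := hg.circ_nonneg m x y
    have hG := hC₁ N W g hN hW hg n x y
    have hPG := hC₃ N W h g hN hW hh hg gh gg hd n x y
    -- The difference of laws is summed through m^{-5/4}. The difference of killing factors is at
    -- most of order η²m exp(-c₁ηm), so its sum over m is O(1).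
    have hsplit : r ^ m * (circ N h ^ m) x y - ρ ^ m * (circ N g ^ m) x y
        = r ^ m * ((circ N h ^ m) x y - (circ N g ^ m) x y)
          + (r ^ m - ρ ^ m) * (circ N g ^ m) x y := by ring
    rw [hsplit]
    refine (norm_add_le _ _).trans (add_le_add ?_ ?_)
    · rw [norm_mul, norm_of_nonneg (pow_nonneg hr m), norm_eq_abs]
      calc _ ≤ exp (-(c₁ * (η * m))) * (C₃ / W * (((m : ℝ) ^ (5 / 4 : ℝ))⁻¹
            * (weight N W k m (x.1 - y.1))⁻¹)) :=
            mul_le_mul (pow_le_exp_neg hr hr1 m) hPG (abs_nonneg _) (exp_pos _).le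
        _ = C₃ / W * ((m : ℝ) ^ (5 / 4 : ℝ))⁻¹ * (exp (-(c₁ * (η * m)))
            * (weight N W k m (x.1 - y.1))⁻¹) := by ring
        _ ≤ C₃ / W * ((m : ℝ) ^ (5 / 4 : ℝ))⁻¹ * (C₂ * 1 * ω) := by
            refine mul_le_mul_of_nonneg_left (hw.trans ?_) (by positivity)
            gcongr
            exact exp_le_one_iff.2 (neg_nonpos.2 (by positivity))
        _ = _ := by ring
    · rw [norm_mul, norm_of_nonneg hG0, norm_eq_abs]
      have h1 : |r ^ m - ρ ^ m| ≤ C₅ * η ^ 2 * m * (exp 1 * exp (-(c₁ * (η * m)))) := by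
        refine (abs_pow_sub_pow_le (a := r) (b := ρ) m).trans ?_
        rw [abs_of_nonneg hr, abs_of_nonneg hρ, hm, Nat.add_sub_cancel, ← hm]
        have h2 := pow_le_exp_neg (le_max_of_le_left hr) (max_le hr1 hρ1) n
        -- The factor e pays for passing from n to m = n + 1, since 0 ≤ r ≤ 1 - c₁η forces c₁η ≤ 1.
        have h3 : exp (-(c₁ * (η * n))) ≤ exp 1 * exp (-(c₁ * (η * m))) := by
          rw [← exp_add]
          refine exp_le_exp.2 ?_
          rw [hm]; push_cast
          nlinarith
        have h4 := h2.trans h3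
        gcongr
      have h2 := hC₆ (η * m) (by positivity)
      rw [pow_one] at h2
      have h3 : exp (c₁ / 4 * (η * m)) * exp (-(c₁ / 2 * (η * m)))
          = exp (-(c₁ / 4 * η * m)) := by
        rw [← exp_add]; ring_nf
      calc _ ≤ C₅ * η ^ 2 * m * (exp 1 * exp (-(c₁ * (η * m)))) *
            (C₁ / W * (weight N W k m (x.1 - y.1))⁻¹) :=
            mul_le_mul h1 hG hG0 (by positivity)
        _ = C₅ * η * exp 1 * (C₁ / W) * (η * m) * (exp (-(c₁ * (η * m)))
            * (weight N W k m (x.1 - y.1))⁻¹) := by ring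
        _ ≤ C₅ * η * exp 1 * (C₁ / W) * (C₆ * exp (c₁ / 4 * (η * m)))
            * (C₂ * exp (-(c₁ / 2 * (η * m))) * ω) := by
            refine mul_le_mul (mul_le_mul_of_nonneg_left ?_ (by positivity)) hw (by positivity)
              (by positivity)
            linarith
        _ = C₅ * η * exp 1 * (C₁ / W) * C₂ * C₆ * ω *
            (exp (c₁ / 4 * (η * m)) * exp (-(c₁ / 2 * (η * m)))) := by ring
        _ = _ := by rw [h3]
  · calc _ ≤ C₃ / W * C₂ * ω * T + C₅ * η * exp 1 * (C₁ / W) * C₂ * C₆ * ω * (c₁ / 4 * η)⁻¹ := by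
          gcongr
      _ = _ := by rw [mul_inv]; field_simp

/-! ### The periodised exponential as a discrete Green function. -/

/-- The periodised two-sided exponential. -/
noncomputable def expSum (N : ℕ) (μ : ℝ) (x : ℤ) : ℝ :=
  ∑' k : ℤ, exp (-(μ * |(x : ℝ) + k * N|))

section ExpSum
variable {N : ℕ} {μ : ℝ}

theorem inv_one_sub_exp_neg_le {t : ℝ} (ht : 0 < t) : (1 - exp (-t))⁻¹ ≤ 1 + 1 / t := by
  have h1 : exp (-t) < 1 := exp_lt_one_iff.2 (by linarith)
  have h2 := add_one_le_exp t
  have h3 : exp t * exp (-t) = 1 := by rw [← exp_add]; simp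
  rw [inv_le_iff_one_le_mul₀ (by linarith), one_add_div ht.ne', div_mul_eq_mul_div, le_div_iff₀ ht]
  nlinarith [exp_pos (-t)]

theorem le_inv_one_sub_exp_neg {t : ℝ} (ht : 0 < t) :
    1 ≤ (1 - exp (-t))⁻¹ ∧ 1 / t ≤ (1 - exp (-t))⁻¹ := by
  have h1 : exp (-t) < 1 := exp_lt_one_iff.2 (by linarith)
  have h2 := add_one_le_exp (-t)
  have h3 := exp_pos (-t)
  constructor
  · rw [le_inv_comm₀ one_pos (by linarith)]; linarith
  · rw [one_div]; exact inv_anti₀ (by linarith) (by linarith)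

/-- Because 2|u| ≤ N on the torus, |u + kN| ≥ |u| + (|k| - 1)N. The copies are therefore dominated
by a geometric series carrying the full factor exp(-μ|u|). -/
theorem exp_term_le (hμ : 0 < μ) {u : ℤ} (hu : u ∈ torus N) (n : ℕ) {k : ℝ}
    (hk : |k| = n + 1) :
    exp (-(μ * |(u : ℝ) + k * N|)) ≤ exp (-(μ * |(u : ℝ)|)) * exp (-(μ * N)) ^ n := by
  rw [← exp_nat_mul, ← exp_add]
  refine exp_le_exp.2 ?_
  have h1 := two_abs_le_of_mem_torus hu
  have h2 : |k * N| ≤ |(u : ℝ) + k * N| + |(u : ℝ)| := by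
    have : k * N = (u + k * N) - u := by ring
    nth_rewrite 1 [this]
    exact abs_sub _ _
  rw [abs_mul, Nat.abs_cast, hk] at h2
  nlinarith

theorem expSum_aux (hN : 0 < N) (hμ : 0 < μ) {u : ℤ} (hu : u ∈ torus N) :
    Summable (fun k : ℤ ↦ exp (-(μ * |(u : ℝ) + k * N|))) ∧
    expSum N μ u ≤ exp (-(μ * |(u : ℝ)|)) * (1 + 2 * (1 - exp (-(μ * N)))⁻¹) := by
  have hN' : (0 : ℝ) < N := by exact_mod_cast hN
  have h1 : exp (-(μ * N)) < 1 := exp_lt_one_iff.2 (neg_lt_zero.2 (by positivity))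
  have hg := (hasSum_geometric_of_lt_one (exp_pos (-(μ * N))).le h1).mul_left
    (exp (-(μ * |(u : ℝ)|)))
  have b1 : ∀ n : ℕ, exp (-(μ * |(u : ℝ) + ((n + 1 : ℤ) : ℝ) * N|))
      ≤ exp (-(μ * |(u : ℝ)|)) * exp (-(μ * N)) ^ n := fun n ↦
    exp_term_le hμ hu n (by push_cast; rw [abs_of_nonneg (by positivity)])
  have b2 : ∀ n : ℕ, exp (-(μ * |(u : ℝ) + ((-(n + 1 : ℤ) : ℤ) : ℝ) * N|))
      ≤ exp (-(μ * |(u : ℝ)|)) * exp (-(μ * N)) ^ n := fun n ↦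
    exp_term_le hμ hu n (by push_cast; rw [abs_neg, abs_of_nonneg (by positivity)])
  have s1 := Summable.of_nonneg_of_le (fun n ↦ (exp_pos _).le) b1 hg.summable
  have s2 := Summable.of_nonneg_of_le (fun n ↦ (exp_pos _).le) b2 hg.summable
  refine ⟨Summable.of_add_one_of_neg_add_one
    (f := fun k : ℤ ↦ exp (-(μ * |(u : ℝ) + k * N|))) s1 s2, ?_⟩
  rw [expSum, tsum_of_add_one_of_neg_add_one
    (f := fun k : ℤ ↦ exp (-(μ * |(u : ℝ) + k * N|))) s1 s2]
  have t1 := s1.tsum_le_tsum b1 hg.summable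
  have t2 := s2.tsum_le_tsum b2 hg.summable
  rw [hg.tsum_eq] at t1 t2
  have h0 : exp (-(μ * |(u : ℝ) + ((0 : ℤ) : ℝ) * N|)) = exp (-(μ * |(u : ℝ)|)) := by simp
  refine (add_le_add (add_le_add t1 h0.le) t2).trans (le_of_eq ?_)
  ring

theorem expSum_term_shift (m x : ℤ) : (fun k : ℤ ↦ exp (-(μ * |((x + m * N : ℤ) : ℝ) + k * N|)))
    = (fun k : ℤ ↦ exp (-(μ * |(x : ℝ) + k * N|))) ∘ Equiv.addRight m := by
  funext k
  simp only [Function.comp, Equiv.coe_addRight]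
  push_cast
  ring_nf

theorem expSum_periodic (N : ℕ) (μ : ℝ) : Function.Periodic (expSum N μ) (N : ℤ) := fun x ↦ by
  have := expSum_term_shift (N := N) (μ := μ) 1 x
  rw [one_mul] at this
  unfold expSum
  rw [this]
  exact (Equiv.addRight (1 : ℤ)).tsum_eq (fun k : ℤ ↦ exp (-(μ * |(x : ℝ) + k * N|)))

theorem summable_expSum (hN : 0 < N) (hμ : 0 < μ) (x : ℤ) :
    Summable (fun k : ℤ ↦ exp (-(μ * |(x : ℝ) + k * N|))) := by
  obtain ⟨m, hm⟩ := rep_add_mul N x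
  have h1 := (expSum_aux hN hμ (rep_mem_torus hN x)).1
  rw [hm, expSum_term_shift] at h1
  exact (Equiv.summable_iff _).1 h1

theorem expSum_le (hN : 0 < N) (hμ : 0 < μ) (x : ℤ) :
    expSum N μ x ≤ exp (-(μ * perAbs N x)) * (3 + 2 / (μ * N)) := by
  have hN' : (0 : ℝ) < N := by exact_mod_cast hN
  have h1 := (expSum_aux hN hμ (rep_mem_torus hN x)).2
  rw [periodic_rep (expSum_periodic N μ)] at h1
  refine h1.trans (mul_le_mul_of_nonneg_left ?_ (exp_pos _).le)
  have := inv_one_sub_exp_neg_le (t := μ * N) (by positivity)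
  have e : 2 / (μ * N) = 2 * (1 / (μ * N)) := by ring
  rw [e]; linarith

theorem expSum_nonneg (x : ℤ) : 0 ≤ expSum N μ x := tsum_nonneg fun _ ↦ (exp_pos _).le

theorem expSum_neg (x : ℤ) : expSum N μ (-x) = expSum N μ x := by
  unfold expSum
  rw [← (Equiv.neg ℤ).tsum_eq (fun k : ℤ ↦ exp (-(μ * |(x : ℝ) + k * N|)))]
  refine tsum_congr fun k ↦ ?_
  rw [← abs_neg]
  simp only [Equiv.neg_apply]
  push_cast
  ring_nf

/-- The copies with k ≥ 0 alone sum to 1/(1 - exp(-μN)), which is at least 1 and at least 1/(μN),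
hence at least their average. -/
theorem le_expSum_zero (hN : 0 < N) (hμ : 0 < μ) : (1 + 1 / (μ * N)) / 2 ≤ expSum N μ 0 := by
  have hN' : (0 : ℝ) < N := by exact_mod_cast hN
  have h1 : exp (-(μ * N)) < 1 := exp_lt_one_iff.2 (neg_lt_zero.2 (by positivity))
  have h2 := le_inv_one_sub_exp_neg (t := μ * N) (by positivity)
  suffices h : (1 - exp (-(μ * N)))⁻¹ ≤ expSum N μ 0 by linarith [h2.1, h2.2]
  rw [← tsum_geometric_of_lt_one (exp_pos _).le h1, expSum]
  have hs := summable_expSum hN hμ 0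
  have e : ∀ n : ℕ, exp (-(μ * N)) ^ n = exp (-(μ * |((0 : ℤ) : ℝ) + ((n : ℤ) : ℝ) * N|)) :=
    fun n ↦ by
      rw [← exp_nat_mul]
      simp [abs_mul]
      ring
  refine Summable.tsum_le_tsum_of_inj (fun n : ℕ ↦ (n : ℤ)) Nat.cast_injective
    (fun _ _ ↦ (exp_pos _).le) (fun n ↦ (e n).le) ?_ hs
  exact summable_geometric_of_lt_one (exp_pos _).le h1

/-- Away from 0 the three points lie on one side and the exponential is an eigenfunction of the
second difference; the kink at 0 produces the defect 2 sinh μ. -/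
theorem exp_abs_second_difference (v : ℤ) :
    exp (-(μ * |(v : ℝ) + 1|)) + exp (-(μ * |(v : ℝ) - 1|))
      = 2 * cosh μ * exp (-(μ * |(v : ℝ)|)) - (if v = 0 then 2 * sinh μ else 0) := by
  rcases lt_trichotomy v 0 with h | h | h
  · have h1 : (v : ℝ) ≤ -1 := by exact_mod_cast (by omega : v ≤ -1)
    rw [if_neg h.ne, abs_of_nonpos (by linarith), abs_of_nonpos (by linarith),
      abs_of_nonpos (by linarith), cosh_eq, sub_zero, mul_div_cancel₀ _ (two_ne_zero' ℝ), add_mul,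
      ← exp_add, ← exp_add]
    ring_nf
  · subst h
    rw [if_pos rfl, cosh_eq, sinh_eq]
    simp
    ring
  · have h1 : (1 : ℝ) ≤ v := by exact_mod_cast (by omega : 1 ≤ v)
    rw [if_neg h.ne', abs_of_nonneg (by linarith), abs_of_nonneg (by linarith),
      abs_of_nonneg (by linarith), cosh_eq, sub_zero, mul_div_cancel₀ _ (two_ne_zero' ℝ), add_mul,
      ← exp_add, ← exp_add]
    ring_nf

theorem expSum_second_difference (hN : 0 < N) (hμ : 0 < μ) {u : ℤ} (hu : u ∈ torus N) :
    expSum N μ (u + 1) + expSum N μ (u - 1)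
      = 2 * cosh μ * expSum N μ u - (if u = 0 then 2 * sinh μ else 0) := by
  have h1 := summable_expSum hN hμ (u + 1)
  have h2 := summable_expSum hN hμ (u - 1)
  have h3 := summable_expSum hN hμ u
  have h4 : HasSum (fun k : ℤ ↦ if u + k * N = 0 then 2 * sinh μ else 0)
      (if u = 0 then 2 * sinh μ else 0) := by
    have h5 := hasSum_ite_eq (0 : ℤ) (if u = 0 then 2 * sinh μ else 0)
    have h6 : (fun k : ℤ ↦ if u + k * N = 0 then 2 * sinh μ else 0)
        = fun k ↦ if k = 0 then (if u = 0 then 2 * sinh μ else 0) else 0 := funext fun k ↦ ?_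
    · rw [h6]; exact h5
    by_cases hk : k = 0
    · simp [hk]
    · rw [if_neg hk, if_neg fun a ↦ ?_]
      have e1 := two_abs_le_of_mem_torus hu
      have e2 : (1 : ℝ) ≤ |(k : ℝ)| := by exact_mod_cast Int.one_le_abs hk
      have e3 : (u : ℝ) = -(k * N) := by
        have : u = -(k * N) := by linarith
        rw [this]; push_cast; ring
      rw [e3, abs_neg, abs_mul, Nat.abs_cast] at e1
      have : (0 : ℝ) < N := by exact_mod_cast hN
      nlinarith
  unfold expSum
  rw [← h1.tsum_add h2, ← tsum_mul_left, ← h4.tsum_eq, ← (h3.mul_left _).tsum_sub h4.summable]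
  refine tsum_congr fun k ↦ ?_
  have := exp_abs_second_difference (μ := μ) (u + k * N)
  push_cast at this ⊢
  rw [← this]
  ring_nf

/-- Shifting the summation variable moves the second difference onto the cosine, where it acts as
multiplication by 2 cos p; only the copy centred at 0 contributes a defect. -/
theorem symb_expSum (hN : 0 < N) (hμ : 0 < μ) (j : ℤ) :
    (cosh μ - cos (freq N j)) * symb N (expSum N μ) j = sinh μ := by
  have hp := expSum_periodic N μ
  have hc := cos_freq_periodic hN j
  have hc1 : Function.Periodic (fun x : ℤ ↦ cos (freq N j * ((x - 1 : ℤ) : ℝ))) (N : ℤ) :=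
    fun x ↦ by
      have := hc (x - 1)
      rw [sub_add_eq_add_sub] at this
      exact this
  have hc2 : Function.Periodic (fun x : ℤ ↦ cos (freq N j * ((x + 1 : ℤ) : ℝ))) (N : ℤ) :=
    fun x ↦ by
      have := hc (x + 1)
      rw [add_right_comm] at this
      exact this
  have s1 := sum_torus_add hN (hp.mul hc1) 1
  have s2 := sum_torus_add hN (hp.mul hc2) (-1)
  simp only [Pi.mul_apply, add_sub_cancel_right, neg_add_cancel_right] at s1 s2
  have s3 : ∑ u ∈ torus N, (expSum N μ (u + 1) + expSum N μ (u + -1)) * cos (freq N j * u)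
      = 2 * cos (freq N j) * symb N (expSum N μ) j := by
    simp only [add_mul]
    rw [sum_add_distrib, s1, s2, ← sum_add_distrib, symb, mul_sum]
    refine sum_congr rfl fun u _ ↦ ?_
    push_cast
    rw [mul_sub, mul_add, cos_sub, cos_add]; ring_nf
  have s4 : ∑ u ∈ torus N, (expSum N μ (u + 1) + expSum N μ (u + -1)) * cos (freq N j * u)
      = 2 * cosh μ * symb N (expSum N μ) j - 2 * sinh μ := by
    calc _ = ∑ u ∈ torus N, (2 * cosh μ * (expSum N μ u * cos (freq N j * u))
          - (if u = 0 then 2 * sinh μ else 0)) := by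
          refine sum_congr rfl fun u hu ↦ ?_
          rw [← Int.sub_eq_add_neg, expSum_second_difference hN hμ hu, sub_mul]
          split_ifs with h
          · subst h; simp
          · ring
      _ = _ := by
          rw [sum_sub_distrib, ← mul_sum, symb, sum_ite_eq' (torus N) 0, if_pos (zero_mem_torus hN)]
  linarith

end ExpSum

/-! ### The solvable geometric walk. -/

theorem abs_cos_sub_le (x : ℝ) : |cos x - (1 - x ^ 2 / 2)| ≤ x ^ 4 := by
  rw [abs_of_nonneg (by linarith [one_sub_sq_div_two_le_cos (x := x)])]
  rcases le_total |x| 1 with h | h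
  · have h1 := (abs_le.1 (cos_bound h)).2
    have h2 : |x| ^ 4 = x ^ 4 := by
      rw [show (4 : ℕ) = 2 * 2 by norm_num, pow_mul, sq_abs, ← pow_mul]
    rw [h2] at h1
    have : 0 ≤ x ^ 4 := by positivity
    linarith
  · have h1 : 1 ≤ x ^ 2 := by rw [← sq_abs]; nlinarith
    have := cos_le_one x
    nlinarith

/-- The geometric walk with prescribed variance. -/
theorem exists_geometric_step {d₀ d₁ : ℝ} (hd₀ : 0 < d₀) (hd₁ : 0 < d₁) :
    ∃ (B : ℕ → ℝ) (c C₄ : ℝ), 0 < c ∧ 0 ≤ C₄ ∧ ∀ (N W : ℕ) (D : ℝ), 0 < W → W ≤ N → d₀ ≤ D →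
      D ≤ d₁ → ∃ g : ℤ → ℝ, IsStep N W B g ∧ HasGap N W c g ∧
        (∀ j ∈ torus N, |symb N g j - (1 - D * (freq N j * W) ^ 2)| ≤ C₄ * (freq N j * W) ^ 4) ∧
        ∀ j, symb N g j = (1 + (2 - 2 * cos (freq N j)) * (D * (W : ℝ) ^ 2))⁻¹ := by
  set s₁ := 1 / (2 * √d₀) with hs₁
  set b : ℝ := 1 / √d₁ / (s₁ + √(1 + s₁ ^ 2)) with hb
  have hs₁0 : 0 < s₁ := by positivity
  have hb0 : 0 < b := by positivity
  choose A hA0 hA using fun K : ℕ ↦ exists_one_add_pow_le_exp hb0 (2 * K)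
  -- From 1 - cos p ≥ 2p²/π² on |p| ≤ π.
  set c₂ : ℝ := 4 * d₀ / π ^ 2 with hc₂
  have hc₂0 : 0 < c₂ := by have := pi_pos; positivity
  refine ⟨fun K ↦ 1 / (2 * d₀ * b) * ((3 + 2 / b) * A K), c₂ / (1 + c₂), d₁ ^ 2 + 2 * d₁,
    by positivity, by positivity, fun N W D hW hWN hD0 hD1 ↦ ?_⟩
  have hW' : (1 : ℝ) ≤ W := by exact_mod_cast hW
  have hWN' : (W : ℝ) ≤ N := by exact_mod_cast hWN
  have hW0 : (0 : ℝ) < W := by linarith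
  have hN : 0 < N := by omega
  have hN0 : (0 : ℝ) < N := by linarith
  have hD : 0 < D := hd₀.trans_le hD0
  have hsD : 0 < √D := sqrt_pos.2 hD
  -- The rate μ must satisfy 2 cosh μ - 2 = 1/(DW²), equivalently sinh(μ/2) = s, so that the symbol
  -- is 1 - D(pW)² up to fourth order.
  set s : ℝ := 1 / (2 * (√D * W)) with hs
  have hs0 : 0 < s := by positivity
  have hs2 : 2 * s ^ 2 = 1 / (2 * (D * (W : ℝ) ^ 2)) := by
    rw [hs, div_pow, mul_pow, mul_pow, sq_sqrt hD.le]; ring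
  set μ := 2 * arsinh s with hμ
  have hss₁ : s ≤ s₁ := by
    rw [hs, hs₁]
    refine one_div_le_one_div_of_le (by positivity) ?_
    have h1 : √d₀ ≤ √D := sqrt_le_sqrt hD0
    have h2 : √D ≤ √D * W := le_mul_of_one_le_right hsD.le hW'
    linarith
  -- Uses sinh a ≤ a eᵃ at a = arsinh s, together with the uniform bound on e^{arsinh s} given by s
  -- ≤ s₁.
  have hμb : b / W ≤ μ := by
    have h1 : 0 < arsinh s := arsinh_pos_iff.2 hs0
    have h2 := sinh_arsinh s
    rw [sinh_eq] at h2
    have h3 := add_one_le_exp (-(2 * arsinh s))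
    have h4 : exp (arsinh s) * exp (-(2 * arsinh s)) = exp (-arsinh s) := by
      rw [← exp_add]; ring_nf
    have h5 := mul_le_mul_of_nonneg_left h3 (exp_pos (arsinh s)).le
    have h6 : s ≤ arsinh s * exp (arsinh s) := by linarith
    have h7 : exp (arsinh s) ≤ s₁ + √(1 + s₁ ^ 2) := by
      rw [exp_arsinh]; gcongr
    have h8 : 1 / √d₁ ≤ 2 * s * W := by
      have : 2 * s * W = 1 / √D := by rw [hs]; field_simp
      rw [this]
      exact one_div_le_one_div_of_le hsD (sqrt_le_sqrt hD1)
    rw [hb, div_div, div_le_iff₀ (by positivity), hμ]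
    have h9 := mul_le_mul_of_nonneg_left h7 h1.le
    calc _ ≤ 2 * s * W := h8
      _ ≤ 2 * (arsinh s * (s₁ + √(1 + s₁ ^ 2))) * W := by gcongr; exact h6.trans h9
      _ = _ := by ring
  have hμ0 : 0 < μ := lt_of_lt_of_le (by positivity) hμb
  have hcosh : cosh μ - 1 = 1 / (2 * (D * (W : ℝ) ^ 2)) := by
    rw [hμ, cosh_two_mul, cosh_sq', sinh_arsinh, ← hs2]; ring
  have hsinh : 0 < sinh μ := sinh_pos_iff.2 hμ0
  -- This factor gives the walk total mass one, by `symb_expSum` at frequency zero.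
  set t : ℝ := (cosh μ - 1) / sinh μ with ht
  have ht0 : 0 < t := by rw [ht, hcosh]; positivity
  have hsymb : ∀ j, symb N (fun u ↦ t * expSum N μ u) j
      = (1 + (2 - 2 * cos (freq N j)) * (D * (W : ℝ) ^ 2))⁻¹ := fun j ↦ by
    have h1 := symb_expSum hN hμ0 j
    have h2 : symb N (fun u ↦ t * expSum N μ u) j = t * symb N (expSum N μ) j := by
      simp only [symb, mul_sum, mul_assoc]
    have h3 : 0 < cosh μ - cos (freq N j) := by
      have : 0 < cosh μ - 1 := by rw [hcosh]; positivity
      linarith [cos_le_one (freq N j)]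
    have h4 : symb N (expSum N μ) j = sinh μ / (cosh μ - cos (freq N j)) := by
      rw [eq_div_iff h3.ne', mul_comm]; exact h1
    have h5 : cosh μ - cos (freq N j)
        = 1 / (2 * (D * (W : ℝ) ^ 2)) * (1 + (2 - 2 * cos (freq N j)) * (D * (W : ℝ) ^ 2)) := by
      have : cosh μ = 1 + 1 / (2 * (D * (W : ℝ) ^ 2)) := by linarith
      rw [this]; field_simp; ring
    rw [h2, h4, ht, h5, hcosh, inv_eq_one_div]
    have h6 : 0 < 1 + (2 - 2 * cos (freq N j)) * (D * (W : ℝ) ^ 2) := by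
      have : 0 ≤ 2 - 2 * cos (freq N j) := by linarith [cos_le_one (freq N j)]
      positivity
    field_simp
  have hy : ∀ j, 0 ≤ (2 - 2 * cos (freq N j)) * (D * (W : ℝ) ^ 2) := fun j ↦ by
    have : 0 ≤ 2 - 2 * cos (freq N j) := by linarith [cos_le_one (freq N j)]
    positivity
  refine ⟨fun u ↦ t * expSum N μ u, ⟨fun u ↦ ?_, fun u ↦ ?_, fun u ↦ ?_, ?_, fun K u ↦ ?_⟩,
    fun j hj ↦ ?_, fun j hj ↦ ?_, hsymb⟩
  · simp only [expSum_periodic N μ u]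
  · simp only [expSum_neg]
  · exact mul_nonneg ht0.le (expSum_nonneg u)
  · have := hsymb 0
    simpa [symb, freq] using this
  · have ht1 : t ≤ 1 / (2 * d₀ * b) / W := by
      rw [ht, hcosh, div_div, div_div]
      refine one_div_le_one_div_of_le (by positivity) ?_
      have h1 : b / W ≤ sinh μ := hμb.trans (self_le_sinh_iff.2 hμ0.le)
      calc 2 * d₀ * b * W = 2 * (d₀ * (W : ℝ) ^ 2) * (b / W) := by field_simp
        _ ≤ _ := by gcongr
    have h2 := expSum_le hN hμ0 u
    have hd := perAbs_nonneg N u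
    have h3 : exp (-(μ * perAbs N u)) ≤ A K * ((1 + (perAbs N u / W) ^ 2) ^ K)⁻¹ := by
      have h4 := hA K (perAbs N u / W) (by positivity)
      have h5 : (1 + (perAbs N u / W) ^ 2) ^ K ≤ (1 + perAbs N u / W) ^ (2 * K) := by
        rw [pow_mul]
        refine pow_le_pow_left₀ (by positivity) ?_ K
        have : 0 ≤ perAbs N u / W := by positivity
        nlinarith
      have h6 : exp (-(μ * perAbs N u)) ≤ exp (-(b * (perAbs N u / W))) := by
        refine exp_le_exp.2 (neg_le_neg ?_)
        rw [mul_div_left_comm, mul_comm]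
        exact mul_le_mul_of_nonneg_right hμb hd
      refine h6.trans ?_
      rw [exp_neg, ← div_eq_mul_inv, inv_eq_one_div, div_le_div_iff₀ (exp_pos _) (by positivity),
        one_mul]
      exact h5.trans h4
    have h7 : 2 / (μ * N) ≤ 2 / b := by
      refine div_le_div_of_nonneg_left (by norm_num) hb0 ?_
      calc b = b / W * W := by field_simp
        _ ≤ μ * N := by gcongr
    calc t * expSum N μ u ≤ 1 / (2 * d₀ * b) / W * ((A K * ((1 + (perAbs N u / W) ^ 2) ^ K)⁻¹)
          * (3 + 2 / b)) := by
          refine mul_le_mul ht1 (h2.trans ?_) (expSum_nonneg u) (by positivity)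
          have := hA0 K
          gcongr
      _ = _ := by ring
  · rw [hsymb, abs_of_nonneg (inv_nonneg.2 (by linarith [hy j]))]
    set q := freq N j * W with hq
    have h1 : c₂ * min 1 (q ^ 2) ≤ (2 - 2 * cos (freq N j)) * (D * (W : ℝ) ^ 2) := by
      have h2 := cos_le_one_sub_mul_cos_sq (abs_freq_le hN hj)
      calc _ ≤ c₂ * q ^ 2 := by gcongr; exact min_le_right _ _
        _ = 2 * (2 / π ^ 2 * freq N j ^ 2) * (d₀ * (W : ℝ) ^ 2) := by rw [hc₂, hq]; ring
        _ ≤ _ := by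
          refine mul_le_mul (by linarith) (by gcongr) (by positivity) ?_
          linarith [cos_le_one (freq N j)]
    set τ := c₂ * min 1 (q ^ 2) with hτ
    have hτ0 : 0 ≤ τ := by positivity
    have hτ1 : τ ≤ c₂ := mul_le_of_le_one_right hc₂0.le (min_le_left _ _)
    calc _ ≤ (1 + τ)⁻¹ := inv_anti₀ (by linarith) (by linarith)
      _ ≤ 1 - τ / (1 + c₂) := by
          rw [inv_le_iff_one_le_mul₀ (by linarith)]
          have : τ / (1 + c₂) * (1 + c₂) = τ := by field_simp
          have h3 : 0 ≤ τ / (1 + c₂) := by positivity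
          nlinarith
      _ ≤ exp (-(τ / (1 + c₂))) := by linarith [add_one_le_exp (-(τ / (1 + c₂)))]
      _ = _ := by rw [hτ]; ring_nf
  · rw [hsymb]
    set p := freq N j with hp
    set y := (2 - 2 * cos p) * (D * (W : ℝ) ^ 2) with hyd
    have hy0 : 0 ≤ y := hy j
    have h1 : |(1 + y)⁻¹ - (1 - y)| ≤ y ^ 2 := by
      have : (1 + y)⁻¹ - (1 - y) = y ^ 2 / (1 + y) := by field_simp; ring
      rw [this, abs_of_nonneg (by positivity)]
      exact div_le_self (by positivity) (by linarith)
    have h2 : y ≤ D * (p * W) ^ 2 := by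
      have := one_sub_sq_div_two_le_cos (x := p)
      calc y ≤ p ^ 2 * (D * (W : ℝ) ^ 2) := by rw [hyd]; gcongr; linarith
        _ = _ := by ring
    have h3 : |y - D * (p * W) ^ 2| ≤ 2 * D * (p * W) ^ 4 := by
      have e : y - D * (p * W) ^ 2 = -(2 * (D * (W : ℝ) ^ 2) * (cos p - (1 - p ^ 2 / 2))) := by
        rw [hyd]; ring
      rw [e, abs_neg, abs_mul, abs_of_nonneg (by positivity)]
      have hp4 : 0 ≤ p ^ 4 := by positivity
      calc _ ≤ 2 * (D * (W : ℝ) ^ 2) * p ^ 4 := by gcongr; exact abs_cos_sub_le p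
        _ ≤ 2 * (D * (W : ℝ) ^ 4) * p ^ 4 := by
            have := pow_le_pow_right₀ hW' (by norm_num : 2 ≤ 4)
            gcongr
        _ = _ := by ring
    have h4 : y ^ 2 ≤ D ^ 2 * (p * W) ^ 4 := by
      calc y ^ 2 ≤ (D * (p * W) ^ 2) ^ 2 := by gcongr
        _ = _ := by ring
    have h5 : (1 + y)⁻¹ - (1 - D * (p * W) ^ 2)
        = ((1 + y)⁻¹ - (1 - y)) - (y - D * (p * W) ^ 2) := by ring
    have hq4 : 0 ≤ (p * W) ^ 4 := by positivity
    rw [h5]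
    calc _ ≤ _ := abs_sub _ _
      _ ≤ D ^ 2 * (p * W) ^ 4 + 2 * D * (p * W) ^ 4 := add_le_add (h1.trans h4) h3
      _ ≤ d₁ ^ 2 * (p * W) ^ 4 + 2 * d₁ * (p * W) ^ 4 := by gcongr
      _ = _ := by ring

/-- The resolvent of the geometric walk is again a periodised exponential. -/
theorem four_geometric {N : ℕ} {A ρ lam : ℝ} {ψ : ℤ → ℝ} (hN : 0 < N) (hA : 0 < A) (hlam : 0 < lam)
    (hψ : ∀ j, ψ j = (1 + (2 - 2 * cos (freq N j)) * A)⁻¹)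
    (hρ : 1 - ρ = (2 * cosh lam - 2) * A) (x y : Torus N) :
    four N (fun j ↦ ρ * ψ j / (1 - ρ * ψ j)) x y
      = ρ / (2 * A * sinh lam) * expSum N lam (x.1 - y.1) := by
  have hsinh : 0 < sinh lam := sinh_pos_iff.2 hlam
  have h1 := circ_eq_four hN (expSum_periodic N lam) (fun x ↦ expSum_neg x)
  have h2 : expSum N lam (x.1 - y.1) = circ N (expSum N lam) x y := rfl
  have h3 := congrFun (congrFun (smul_four (N := N) (ρ / (2 * A * sinh lam))
    (symb N (expSum N lam))) x) y
  rw [Matrix.smul_apply, smul_eq_mul] at h3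
  rw [h2, h1, h3]
  congr 2
  funext j
  have h4 : 0 < cosh lam - cos (freq N j) := by
    have : 1 < cosh lam := one_lt_cosh.2 hlam.ne'
    linarith [cos_le_one (freq N j)]
  have h5 : symb N (expSum N lam) j = sinh lam / (cosh lam - cos (freq N j)) := by
    rw [eq_div_iff h4.ne', mul_comm]; exact symb_expSum hN hlam j
  have h6 : 0 < 1 + (2 - 2 * cos (freq N j)) * A := by
    have : 0 ≤ 2 - 2 * cos (freq N j) := by linarith [cos_le_one (freq N j)]
    positivity
  -- By `hρ`, 1 + (2 - 2 cos p)A - ρ collapses to 2A(cosh λ - cos p), the denominator in the symbol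
  -- of `expSum`.
  have h7 : 1 - ρ * ψ j = 2 * A * (cosh lam - cos (freq N j)) * ψ j := by
    rw [hψ, ← div_eq_mul_inv, ← div_eq_mul_inv, eq_div_iff h6.ne', sub_mul,
      div_mul_cancel₀ _ h6.ne']
    linarith
  have h8 : 0 < ψ j := by rw [hψ]; positivity
  rw [h5, h7]
  field_simp

/-! ### Spectral gap from a block of consecutive sites. -/

/-- The squared modulus of the exponential sum is Σ cos(p(j - k)), at most n² - (2/π²)p² Σ(j - k)²
with Σ(j - k)² = n²(n² - 1)/6. The condition n ≥ 2 gives (n² - 1)/3 ≥ n²/4, which produces the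
constant 8π² after taking the root. -/
theorem abs_sum_cos_le_of_small {n : ℕ} (hn : 2 ≤ n) {p : ℝ} (hp : |p| * n ≤ π) (a : ℝ) :
    |∑ k ∈ range n, cos (p * (a + k))| ≤ n - p ^ 2 * n ^ 3 / (8 * π ^ 2) := by
  have hn' : (2 : ℝ) ≤ n := by exact_mod_cast hn
  have hπ := pi_pos
  have hsum1 : ∀ n : ℕ, ∑ k ∈ range n, (k : ℝ) = n * (n - 1) / 2 := fun n ↦ by
    induction n with
    | zero => simp
    | succ n ih => rw [sum_range_succ, ih]; push_cast; ring
  have hsum2 : ∀ n : ℕ, ∑ k ∈ range n, (k : ℝ) ^ 2 = n * (n - 1) * (2 * n - 1) / 6 := fun n ↦ by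
    induction n with
    | zero => simp
    | succ n ih => rw [sum_range_succ, ih]; push_cast; ring
  have hdouble : ∑ j ∈ range n, ∑ k ∈ range n, ((j : ℝ) - k) ^ 2
      = (n : ℝ) ^ 2 * (n ^ 2 - 1) / 6 := by
    calc _ = ∑ j ∈ range n, ((n : ℝ) * (j : ℝ) ^ 2 - 2 * (j * (n * (n - 1) / 2))
          + n * (n - 1) * (2 * n - 1) / 6) := by
          refine sum_congr rfl fun j _ ↦ ?_
          rw [← hsum1, ← hsum2, mul_sum, mul_sum]
          have : (n : ℝ) * (j : ℝ) ^ 2 = ∑ k ∈ range n, (j : ℝ) ^ 2 := by simp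
          rw [this, ← sum_sub_distrib, ← sum_add_distrib]
          exact sum_congr rfl fun k _ ↦ by ring
      _ = _ := by
          rw [sum_add_distrib, sum_sub_distrib, ← mul_sum, ← mul_sum, ← sum_mul, hsum1, hsum2]
          simp
          ring
  have hsq : (∑ k ∈ range n, cos (p * (a + k))) ^ 2
      ≤ n ^ 2 - 2 / π ^ 2 * p ^ 2 * ((n : ℝ) ^ 2 * (n ^ 2 - 1) / 6) := by
    calc _ ≤ (∑ k ∈ range n, cos (p * (a + k))) ^ 2 + (∑ k ∈ range n, sin (p * (a + k))) ^ 2 :=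
          le_add_of_nonneg_right (sq_nonneg _)
      _ = ∑ j ∈ range n, ∑ k ∈ range n, cos (p * (j - k)) := by
          rw [sq, sq, sum_mul_sum, sum_mul_sum, ← sum_add_distrib]
          refine sum_congr rfl fun j _ ↦ ?_
          rw [← sum_add_distrib]
          refine sum_congr rfl fun k _ ↦ ?_
          rw [← cos_sub]; ring_nf
      _ ≤ ∑ j ∈ range n, ∑ k ∈ range n, (1 - 2 / π ^ 2 * p ^ 2 * ((j : ℝ) - k) ^ 2) := by
          refine sum_le_sum fun j hj ↦ sum_le_sum fun k hk ↦ ?_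
          have h1 : |p * ((j : ℝ) - k)| ≤ π := by
            rw [abs_mul]
            refine le_trans (mul_le_mul_of_nonneg_left ?_ (abs_nonneg p)) hp
            have : (j : ℝ) ≤ n := by exact_mod_cast (mem_range.1 hj).le
            have : (k : ℝ) ≤ n := by exact_mod_cast (mem_range.1 hk).le
            have : (0 : ℝ) ≤ j := by positivity
            have : (0 : ℝ) ≤ k := by positivity
            rw [abs_le]; constructor <;> linarith
          have h2 := cos_le_one_sub_mul_cos_sq h1
          rw [mul_pow] at h2
          linarith
      _ = _ := by
          simp only [sum_sub_distrib, ← mul_sum]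
          rw [hdouble]
          simp
          ring
  set δ := p ^ 2 * n ^ 3 / (8 * π ^ 2) with hδ
  have hδ1 : 2 * n * δ = p ^ 2 * n ^ 4 / (4 * π ^ 2) := by rw [hδ]; field_simp; ring
  have hδn : δ ≤ n := by
    have h1 : (p * n) ^ 2 ≤ π ^ 2 := by
      rw [← sq_abs (p * n), abs_mul, Nat.abs_cast]
      exact pow_le_pow_left₀ (by positivity) hp 2
    rw [hδ, div_le_iff₀ (by positivity)]
    nlinarith
  refine abs_le_of_sq_le_sq ?_ (by linarith)
  have h2 : p ^ 2 * n ^ 4 / (4 * π ^ 2) ≤ 2 / π ^ 2 * p ^ 2 * ((n : ℝ) ^ 2 * (n ^ 2 - 1) / 6) := by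
    have e : 2 / π ^ 2 * p ^ 2 * ((n : ℝ) ^ 2 * (n ^ 2 - 1) / 6) - p ^ 2 * n ^ 4 / (4 * π ^ 2)
        = p ^ 2 * n ^ 2 / π ^ 2 * ((n ^ 2 - 4) / 12) := by field_simp; ring
    have : 0 ≤ p ^ 2 * n ^ 2 / π ^ 2 * (((n : ℝ) ^ 2 - 4) / 12) := by
      refine mul_nonneg (by positivity) ?_
      nlinarith
    linarith
  nlinarith [sq_nonneg δ]

/-- Multiplication by 2 sin(p/2) telescopes the sum, and |sin(p/2)| ≥ |p|/π. -/
theorem abs_sum_cos_le {p : ℝ} (hp0 : p ≠ 0) (hp : |p| ≤ π) (n : ℕ) (a : ℝ) :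
    |∑ k ∈ range n, cos (p * (a + k))| ≤ π / |p| := by
  have hπ := pi_pos
  have tel : ∀ n : ℕ, 2 * sin (p / 2) * ∑ k ∈ range n, cos (p * (a + k))
      = sin (p * (a + n) - p / 2) - sin (p * a - p / 2) := fun n ↦ by
    induction n with
    | zero => simp
    | succ n ih =>
      rw [sum_range_succ, mul_add, ih]
      have : p * (a + (n + 1 : ℕ)) - p / 2 = p * (a + n) + p / 2 := by push_cast; ring
      rw [this, sin_add, sin_sub]; ring
  have h1 : |2 * sin (p / 2) * ∑ k ∈ range n, cos (p * (a + k))| ≤ 2 := by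
    rw [tel]
    refine (abs_sub _ _).trans ?_
    linarith [abs_sin_le_one (p * (a + n) - p / 2), abs_sin_le_one (p * a - p / 2)]
  have h2 := mul_abs_le_abs_sin (x := p / 2) (by rw [abs_div, abs_two]; linarith)
  rw [abs_div, abs_two] at h2
  rw [abs_mul, abs_mul, abs_two] at h1
  have hp1 : 0 < |p| := abs_pos.2 hp0
  set X := |∑ k ∈ range n, cos (p * (a + k))|
  have hX : 0 ≤ X := abs_nonneg _
  have h3 : 2 / π * (|p| / 2) = |p| / π := by field_simp
  rw [h3] at h2
  rw [le_div_iff₀ hp1]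
  have h4 : 2 * (|p| / π) * X ≤ 2 := le_trans (by gcongr) h1
  have h5 : |p| / π * X ≤ 1 := by linarith
  rw [div_mul_eq_mul_div, div_le_one hπ] at h5
  linarith

/-- Subtracting σ on the block leaves a nonnegative remainder of mass 1 - σn, whose transform is
bounded trivially; cancellation is needed only for the uniform part. -/
theorem abs_sum_mul_cos_le_of_block {N : ℕ} {h : ℤ → ℝ} (h0 : ∀ u, 0 ≤ h u)
    (h1 : ∑ u ∈ torus N, h u = 1) {σ : ℝ} (hσ : 0 ≤ σ) (u₀ : ℤ) (n : ℕ)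
    (hI : ∀ k < n, u₀ + k ∈ torus N ∧ σ ≤ h (u₀ + k)) (p : ℝ) :
    |∑ u ∈ torus N, h u * cos (p * u)|
      ≤ 1 - σ * (n - |∑ k ∈ range n, cos (p * (u₀ + k))|) := by
  set I := (range n).image (fun k : ℕ ↦ u₀ + (k : ℤ)) with hIdef
  have hIsub : I ⊆ torus N := by
    intro u hu
    obtain ⟨k, hk, rfl⟩ := mem_image.1 hu
    exact (hI k (mem_range.1 hk)).1
  have hsumI : ∀ F : ℤ → ℝ, ∑ u ∈ torus N, (if u ∈ I then σ else 0) * F u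
      = σ * ∑ k ∈ range n, F (u₀ + k) := fun F ↦ by
    simp only [ite_mul, zero_mul]
    rw [← sum_filter, filter_mem_eq_inter, inter_eq_right.2 hIsub, ← mul_sum, hIdef,
      sum_image (fun a _ b _ hab ↦ by simpa using hab)]
  have hnn : ∀ u, 0 ≤ h u - (if u ∈ I then σ else 0) := fun u ↦ by
    split_ifs with hu
    · obtain ⟨k, hk, rfl⟩ := mem_image.1 hu
      linarith [(hI k (mem_range.1 hk)).2]
    · simpa using h0 u
  have e1 : ∑ u ∈ torus N, h u * cos (p * u)
      = ∑ u ∈ torus N, (h u - (if u ∈ I then σ else 0)) * cos (p * u)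
        + σ * ∑ k ∈ range n, cos (p * (u₀ + k)) := by
    have := hsumI (fun u ↦ cos (p * u))
    push_cast at this
    rw [← this, ← sum_add_distrib]
    exact sum_congr rfl fun u _ ↦ by ring
  have e2 : ∑ u ∈ torus N, (h u - (if u ∈ I then σ else 0)) = 1 - σ * n := by
    have := hsumI (fun _ ↦ 1)
    simp only [mul_one, sum_const, card_range, nsmul_eq_mul] at this
    rw [sum_sub_distrib, h1, this]
  rw [e1]
  refine (abs_add_le _ _).trans ?_
  rw [abs_mul, abs_of_nonneg hσ]
  have e3 : |∑ u ∈ torus N, (h u - (if u ∈ I then σ else 0)) * cos (p * u)| ≤ 1 - σ * n := by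
    rw [← e2]
    refine (abs_sum_le_sum_abs _ _).trans (sum_le_sum fun u _ ↦ ?_)
    rw [abs_mul, abs_of_nonneg (hnn u)]
    exact mul_le_of_le_one_right (hnn u) (abs_cos_le_one _)
  linarith

theorem IsStep.hasGap_of_block {N W : ℕ} {B : ℕ → ℝ} {h : ℤ → ℝ} (hh : IsStep N W B h)
    (hN : 0 < N) (hW : 0 < W) {σ₀ l₀ : ℝ} (hσ₀ : 0 < σ₀) (hl₀ : 0 < l₀) {u₀ : ℤ} {L : ℕ}
    (hL2 : 2 ≤ L) (hL : l₀ * W ≤ L)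
    (hI : ∀ k < 2 * L, u₀ + (k : ℕ) ∈ torus N ∧ σ₀ / W ≤ h (u₀ + k)) :
    HasGap N W (min (σ₀ * l₀) (σ₀ * l₀ ^ 3 / (8 * π ^ 2))) h := by
  intro j hj
  have hW' : (0 : ℝ) < W := by exact_mod_cast hW
  have hπ := pi_pos
  set p := freq N j with hp
  have hpπ : |p| ≤ π := abs_freq_le hN hj
  set c := min (σ₀ * l₀) (σ₀ * l₀ ^ 3 / (8 * π ^ 2)) with hc
  have hc0 : 0 ≤ c := by positivity
  suffices hs : |symb N h j| ≤ 1 - c * min 1 ((p * W) ^ 2) from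
    hs.trans (by linarith [add_one_le_exp (-(c * min 1 ((p * W) ^ 2)))])
  have hσ : 0 ≤ σ₀ / W := by positivity
  -- At low frequency L sites show the quadratic loss. At higher frequency all 2L sites are used:
  -- their cosine sum is at most π/|p| ≤ L, so a loss of at least L remains.
  rcases le_or_gt (|p| * L) π with hcase | hcase
  · have h1 := abs_sum_mul_cos_le_of_block hh.nonneg hh.sum_eq_one hσ u₀ L
      (fun k hk ↦ hI k (by omega)) p
    have h2 := abs_sum_cos_le_of_small hL2 hcase (u₀ : ℝ)
    have h3 : c * min 1 ((p * W) ^ 2) ≤ σ₀ / W * (p ^ 2 * L ^ 3 / (8 * π ^ 2)) := by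
      calc _ ≤ σ₀ * l₀ ^ 3 / (8 * π ^ 2) * (p * W) ^ 2 :=
            mul_le_mul (min_le_right _ _) (min_le_right _ _) (by positivity) (by positivity)
        _ = σ₀ / W * (p ^ 2 * (l₀ * W) ^ 3 / (8 * π ^ 2)) := by field_simp
        _ ≤ _ := by gcongr
    have h4 : σ₀ / W * (p ^ 2 * L ^ 3 / (8 * π ^ 2))
        ≤ σ₀ / W * (L - |∑ k ∈ range L, cos (p * (u₀ + k))|) :=
      mul_le_mul_of_nonneg_left (by linarith) hσ
    unfold symb
    linarith
  · have hp0 : p ≠ 0 := by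
      rintro h0
      rw [h0, abs_zero, zero_mul] at hcase
      linarith
    have h1 := abs_sum_mul_cos_le_of_block hh.nonneg hh.sum_eq_one hσ u₀ (2 * L) hI p
    have h2 := abs_sum_cos_le hp0 hpπ (2 * L) (u₀ : ℝ)
    have h3 : π / |p| ≤ L := by
      rw [div_le_iff₀ (abs_pos.2 hp0)]; linarith
    have h4 : c * min 1 ((p * W) ^ 2) ≤ σ₀ / W * L := by
      calc _ ≤ σ₀ * l₀ * 1 :=
            mul_le_mul (min_le_left _ _) (min_le_left _ _) (by positivity) (by positivity)
        _ = σ₀ / W * (l₀ * W) := by field_simp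
        _ ≤ _ := by gcongr
    have h5 : σ₀ / W * L
        ≤ σ₀ / W * ((2 * L : ℕ) - |∑ k ∈ range (2 * L), cos (p * (u₀ + k))|) := by
      refine mul_le_mul_of_nonneg_left ?_ hσ
      push_cast
      linarith
    unfold symb
    linarith

/-! ### The band matrix as a step distribution with uniform constants. -/

section Density
variable {f : ℝ → ℝ}

theorem IsBandDensity.le_decay (hf : IsBandDensity f) (K : ℕ) :
    ∃ C : ℝ, 0 < C ∧ ∀ x, f x ≤ C * ((1 + x ^ 2) ^ K)⁻¹ := by
  obtain ⟨C, hC⟩ := hf.decay (2 * K)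
  refine ⟨max C 1, by positivity, fun x ↦ ?_⟩
  have h1 := (le_abs_self _).trans (hC x)
  have h2 : bracket x ^ (-((2 * K : ℕ) : ℤ)) = ((1 + x ^ 2) ^ K)⁻¹ := by
    rw [zpow_neg, zpow_natCast, bracket, pow_mul, sq_sqrt (by positivity)]
  rw [h2] at h1
  exact h1.trans (by gcongr; exact le_max_left _ _)

/-- By continuity some window [-R₁, R₁] has mass c' < c₀, so it lies inside every window of mass at
least c₀. As c' > 0 and f is even, f is positive somewhere in (0, R₁). The interval avoids 0 so that
it also bounds the variance from below. -/
theorem IsBandDensity.exists_interval (hf : IsBandDensity f) {c₀ : ℝ} (hc₀ : 0 < c₀) :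
    ∃ a b β : ℝ, 0 < a ∧ a < b ∧ 0 < β ∧ (∀ t, a ≤ t → t ≤ b → β ≤ f t) ∧
      ∀ R : ℝ, 0 ≤ R → c₀ ≤ ∫ t in (-R)..R, f t → b < R := by
  have hcont : Continuous f := hf.smooth.continuous
  have hint : MeasureTheory.Integrable f := by
    by_contra h
    have := hf.integral_eq_one
    rw [MeasureTheory.integral_undef h] at this
    norm_num at this
  have hii : ∀ a b, IntervalIntegrable f MeasureTheory.volume a b :=
    fun a b ↦ hcont.intervalIntegrable a b
  set F : ℝ → ℝ := fun R ↦ ∫ t in (-R)..R, f t with hF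
  have hFcont : Continuous F := by
    have h1 := intervalIntegral.continuous_primitive hii 0
    have h2 : F = fun R ↦ (∫ t in (0 : ℝ)..R, f t) - ∫ t in (0 : ℝ)..(-R), f t := by
      funext R
      rw [intervalIntegral.integral_interval_sub_left (hii _ _) (hii _ _)]
    rw [h2]
    exact h1.sub (h1.comp continuous_neg)
  have hFlim : Filter.Tendsto F Filter.atTop (nhds 1) := by
    rw [← hf.integral_eq_one]
    exact MeasureTheory.intervalIntegral_tendsto_integral hint Filter.tendsto_neg_atTop_atBot
      Filter.tendsto_id
  set c' := min c₀ 1 / 2 with hc'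
  have hc'0 : 0 < c' := by positivity
  have hc'1 : c' < 1 := by have := min_le_right c₀ 1; linarith
  have hc'c : c' < c₀ := by have := min_le_left c₀ 1; linarith
  obtain ⟨R', hR'0, hR'⟩ := ((Filter.eventually_ge_atTop (0 : ℝ)).and
    (hFlim.eventually (lt_mem_nhds hc'1))).exists
  have hF0 : F 0 = 0 := by simp [hF]
  obtain ⟨R₁, hR₁, hFR₁⟩ := intermediate_value_Icc hR'0 hFcont.continuousOn
    (show c' ∈ Set.Icc (F 0) (F R') from ⟨by rw [hF0]; exact hc'0.le, hR'.le⟩)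
  have hmono : ∀ R, 0 ≤ R → c₀ ≤ ∫ t in (-R)..R, f t → R₁ < R := fun R hR0 hR ↦ by
    by_contra hle
    push Not at hle
    have := intervalIntegral.integral_mono_interval (f := f) (μ := MeasureTheory.volume)
      (a := -R) (b := R) (c := -R₁) (d := R₁) (by linarith) (by linarith) hle
      (Filter.Eventually.of_forall hf.nonneg) (hii _ _)
    have h2 : ∫ t in (-R₁)..R₁, f t = c' := hFR₁
    linarith
  have hex : ∃ t, 0 < t ∧ t < R₁ ∧ 0 < f t := by
    by_contra hno
    push Not at hno
    have hz : ∀ t, 0 < t → t < R₁ → f t = 0 := fun t h1 h2 ↦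
      le_antisymm (hno t h1 h2) (hf.nonneg t)
    have h0 : F R₁ = 0 := by
      refine intervalIntegral.integral_zero_ae ?_
      have hct : ({0, R₁} : Set ℝ).Countable := (Set.finite_singleton R₁).insert 0 |>.countable
      filter_upwards [hct.ae_notMem MeasureTheory.volume] with x hx hxI
      rw [Set.uIoc_of_le (by linarith [hR₁.1])] at hxI
      simp only [Set.mem_insert_iff, Set.mem_singleton_iff, not_or] at hx
      have hxR : x < R₁ := lt_of_le_of_ne hxI.2 hx.2
      rcases lt_or_gt_of_ne hx.1 with h | h
      · rw [← hf.symm]; exact hz _ (by linarith) (by linarith [hxI.1])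
      · exact hz x h hxR
    linarith
  obtain ⟨t, ht0, htR, hft⟩ := hex
  obtain ⟨ε, hε, hball⟩ := Metric.continuous_iff.1 hcont t (f t / 2) (by linarith)
  set ε' := min ε (min t (R₁ - t)) / 2 with hε'
  have hm : 0 < min ε (min t (R₁ - t)) := lt_min hε (lt_min ht0 (by linarith))
  have e1 : min ε (min t (R₁ - t)) ≤ ε := min_le_left _ _
  have e2 : min ε (min t (R₁ - t)) ≤ t := (min_le_right _ _).trans (min_le_left _ _)
  have e3 : min ε (min t (R₁ - t)) ≤ R₁ - t := (min_le_right _ _).trans (min_le_right _ _)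
  refine ⟨t - ε', t + ε', f t / 2, by linarith, by linarith, by linarith, fun x h1 h2 ↦ ?_,
    fun R hR0 hR ↦ ?_⟩
  · have h3 := hball x (by rw [dist_eq, abs_lt]; constructor <;> linarith)
    rw [dist_eq, abs_lt] at h3
    linarith
  · linarith [hmono R hR0 hR]

/-- The first row of `S`, as a periodic function. -/
noncomputable def bandStep (f : ℝ → ℝ) (N W : ℕ) (u : ℤ) : ℝ :=
  (normZ f N W)⁻¹ * f (((rep N u : ℤ) : ℝ) / (W : ℝ))

theorem S_eq_circ (f : ℝ → ℝ) (N W : ℕ) : S f N W = circ N (bandStep f N W) := rfl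

/-- Uniform properties of the step distribution of the band matrix. -/
theorem IsBandDensity.exists_step (hf : IsBandDensity f) {c₀ : ℝ} (hc₀ : 0 < c₀) :
    ∃ (B : ℕ → ℝ) (c C₄ d₀ d₁ W₀ : ℝ), 0 < c ∧ 0 ≤ C₄ ∧ 0 < d₀ ∧ 0 < d₁ ∧ ∀ N W : ℕ, 0 < W →
      W₀ ≤ W → W ≤ N →
      c₀ ≤ ∫ t in (-((N : ℝ) / (2 * (W : ℝ))))..((N : ℝ) / (2 * (W : ℝ))), f t →
      IsStep N W B (bandStep f N W) ∧ HasGap N W c (bandStep f N W) ∧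
        d₀ ≤ diffD f N W ∧ diffD f N W ≤ d₁ ∧ ∀ j ∈ torus N,
          |symb N (bandStep f N W) j - (1 - diffD f N W * (freq N j * W) ^ 2)|
            ≤ C₄ * (freq N j * W) ^ 4 := by
  obtain ⟨a, b, β, ha, hab, hβ, hfβ, hR⟩ := hf.exists_interval hc₀
  choose A hA0 hA using hf.le_decay
  set l₀ := (b - a) / 8 with hl₀
  have hl₀0 : 0 < l₀ := by rw [hl₀]; linarith
  set B : ℕ → ℝ := fun K ↦ (2 * β * l₀)⁻¹ * A K with hB
  set σ₀ := β / (5 * A 1) with hσ₀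
  have hA1 := hA0 1
  have hσ₀0 : 0 < σ₀ := by positivity
  have hB3 : 0 < B 3 := by have := hA0 3; rw [hB]; positivity
  have hB2 : 0 < B 2 := by have := hA0 2; rw [hB]; positivity
  have hπ := pi_pos
  -- The sites u with a ≤ u/W ≤ b contain a block of 2L points on which f ≥ β. This bounds Z from
  -- below, hence `B`; `A 1` bounds Z from above, hence σ₀. The block gives the gap and d₀; moments
  -- of order 2 and 4 give `5 * B 2` and `5 * B 3`. The threshold 16/(b - a) ensures L ≥ 2 and L ≥
  -- l₀W despite rounding.
  refine ⟨B, min (σ₀ * l₀) (σ₀ * l₀ ^ 3 / (8 * π ^ 2)), 5 * B 3, a ^ 2 * σ₀ * l₀, 5 * B 2,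
    16 / (b - a), by positivity, by positivity, by positivity, by positivity,
    fun N W hW hW₀ hWN hmass ↦ ?_⟩
  have hW' : (0 : ℝ) < W := by exact_mod_cast hW
  have hN : 0 < N := by omega
  have hN' : (0 : ℝ) < N := by exact_mod_cast hN
  have hba : 0 < b - a := by linarith
  have hbR := hR _ (by positivity) hmass
  rw [lt_div_iff₀ (by positivity)] at hbR
  rw [div_le_iff₀ hba] at hW₀
  set u₀ : ℤ := ⌈a * W⌉ with hu₀
  set L : ℕ := ⌊(b - a) * W / 4⌋₊ with hL
  have hLle : (L : ℝ) ≤ (b - a) * W / 4 := Nat.floor_le (by positivity)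
  have hLgt : (b - a) * W / 4 < L + 1 := Nat.lt_floor_add_one _
  have hL2 : 2 ≤ L := by
    have : (2 : ℝ) ≤ L := by linarith
    exact_mod_cast this
  have hlL : l₀ * W ≤ L := by rw [hl₀]; linarith
  have hblock : ∀ k < 2 * L, a * W ≤ ((u₀ + (k : ℕ) : ℤ) : ℝ) ∧
      ((u₀ + (k : ℕ) : ℤ) : ℝ) ≤ b * W := fun k hk ↦ by
    have h1 : a * W ≤ u₀ := Int.le_ceil _
    have h2 : (u₀ : ℝ) < a * W + 1 := Int.ceil_lt_add_one _
    have h3 : (k : ℝ) + 1 ≤ 2 * L := by exact_mod_cast hk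
    have h4 : (0 : ℝ) ≤ k := by positivity
    push_cast
    constructor <;> linarith
  have hmem : ∀ k < 2 * L, u₀ + (k : ℕ) ∈ torus N := fun k hk ↦ by
    obtain ⟨h1, h2⟩ := hblock k hk
    rw [mem_torus]
    have : 0 < a * W := by positivity
    constructor <;> linarith
  have hfblock : ∀ k < 2 * L, β ≤ f (((u₀ + (k : ℕ) : ℤ) : ℝ) / W) := fun k hk ↦ by
    obtain ⟨h1, h2⟩ := hblock k hk
    exact hfβ _ (by rwa [le_div_iff₀ hW']) (by rwa [div_le_iff₀ hW'])
  set I := (range (2 * L)).image (fun k : ℕ ↦ u₀ + (k : ℤ)) with hI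
  have hIsub : I ⊆ torus N := by
    intro u hu
    obtain ⟨k, hk, rfl⟩ := mem_image.1 hu
    exact hmem k (mem_range.1 hk)
  have hcardI : ((I.card : ℕ) : ℝ) = 2 * L := by
    rw [hI, card_image_of_injective _ (fun a b hab ↦ by simpa using hab), card_range]
    push_cast; ring
  have hsumI : ∀ (F : ℤ → ℝ) (v : ℝ), (∀ u, 0 ≤ F u) → (∀ k < 2 * L, v ≤ F (u₀ + (k : ℕ))) →
      2 * L * v ≤ ∑ u ∈ torus N, F u := fun F v hF hv ↦ by
    rw [← hcardI, ← nsmul_eq_mul]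
    refine (card_nsmul_le_sum I F v fun u hu ↦ ?_).trans
      (sum_le_sum_of_subset_of_nonneg hIsub fun u _ _ ↦ hF u)
    obtain ⟨k, hk, rfl⟩ := mem_image.1 hu
    exact hv k (mem_range.1 hk)
  have hZ1 : 2 * β * l₀ * W ≤ normZ f N W := by
    refine le_trans ?_ (hsumI (fun u ↦ f ((u : ℝ) / W)) β (fun u ↦ hf.nonneg _) hfblock)
    nlinarith
  have hZ2 : normZ f N W ≤ 5 * A 1 * W := by
    calc _ ≤ ∑ u ∈ torus N, A 1 * (1 + ((u : ℝ) / W) ^ 2)⁻¹ :=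
          sum_le_sum fun u _ ↦ by simpa using hA 1 ((u : ℝ) / W)
      _ ≤ A 1 * (5 * W) := by
          rw [← mul_sum]
          exact mul_le_mul_of_nonneg_left (sum_torus_inv_le hN hW) hA1.le
      _ = _ := by ring
  have hZ0 : 0 < normZ f N W := lt_of_lt_of_le (by positivity) hZ1
  have hval : ∀ u ∈ torus N, bandStep f N W u = (normZ f N W)⁻¹ * f ((u : ℝ) / W) := fun u hu ↦ by
    rw [bandStep, rep_of_mem hu]
  have hstep : IsStep N W B (bandStep f N W) := by
    have hfa : ∀ x : ℝ, f |x| = f x := fun x ↦ by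
      rcases abs_choice x with h | h <;> rw [h]
      exact hf.symm x
    have habs : ∀ u, bandStep f N W u = (normZ f N W)⁻¹ * f (perAbs N u / W) := fun u ↦ by
      rw [bandStep, ← hfa, abs_div, Nat.abs_cast]; rfl
    refine ⟨fun u ↦ ?_, fun u ↦ ?_, fun u ↦ ?_, ?_, fun K u ↦ ?_⟩
    · simp only [habs, perAbs_periodic N u]
    · simp only [habs, perAbs_neg hN]
    · exact mul_nonneg (inv_nonneg.2 hZ0.le) (hf.nonneg _)
    · rw [sum_congr rfl hval, ← mul_sum]
      exact inv_mul_cancel₀ hZ0.ne'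
    · rw [habs]
      calc _ ≤ (2 * β * l₀ * W)⁻¹ * (A K * ((1 + (perAbs N u / W) ^ 2) ^ K)⁻¹) :=
            mul_le_mul (inv_anti₀ (by positivity) hZ1) (hA K _) (hf.nonneg _) (by positivity)
        _ = _ := by rw [hB, mul_inv]; ring
  have hblockS : ∀ k < 2 * L, σ₀ / W ≤ bandStep f N W (u₀ + (k : ℕ)) := fun k hk ↦ by
    rw [hval _ (hmem k hk)]
    calc σ₀ / W = (5 * A 1 * W)⁻¹ * β := by rw [hσ₀]; field_simp
      _ ≤ _ := mul_le_mul (inv_anti₀ hZ0 hZ2) (hfblock k hk) hβ.le (inv_nonneg.2 hZ0.le)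
  have hD : diffD f N W
      = (1 / 2) * ∑ u ∈ torus N, bandStep f N W u * (((u : ℝ) / W) ^ 2) ^ 1 := by
    rw [diffD]
    congr 1
    refine sum_congr rfl fun u _ ↦ ?_
    rw [sub_zero, bandStep]; ring
  refine ⟨hstep, hstep.hasGap_of_block hN hW hσ₀0 hl₀0 hL2 hlL
    fun k hk ↦ ⟨hmem k hk, hblockS k hk⟩, ?_, ?_, fun j _ ↦ ?_⟩
  · have h1 := hsumI (fun u ↦ bandStep f N W u * (((u : ℝ) / W) ^ 2) ^ 1) (σ₀ / W * a ^ 2)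
      (fun u ↦ mul_nonneg (hstep.nonneg u) (by positivity)) fun k hk ↦ by
        refine mul_le_mul (hblockS k hk) ?_ (by positivity) (hstep.nonneg _)
        rw [pow_one]
        refine pow_le_pow_left₀ ha.le ?_ 2
        rw [le_div_iff₀ hW']
        exact (hblock k hk).1
    rw [hD]
    have h2 : a ^ 2 * σ₀ * l₀ ≤ σ₀ / W * a ^ 2 * L := by
      calc _ = σ₀ / W * a ^ 2 * (l₀ * W) := by field_simp
        _ ≤ _ := by gcongr
    linarith
  · have := hstep.moment_le hN hW 1
    rw [hD]
    norm_num at this ⊢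
    linarith
  · set p := freq N j with hp
    have h1 := hstep.moment_le hN hW 2
    -- The moments of order 0 and 2 are exactly 1 and 2DW², so only the fourth-order remainder of
    -- the cosine is left.
    have e : symb N (bandStep f N W) j - (1 - diffD f N W * (p * W) ^ 2)
        = ∑ u ∈ torus N, bandStep f N W u * (cos (p * u) - (1 - (p * u) ^ 2 / 2)) := by
      have e1 : ∑ u ∈ torus N, bandStep f N W u * (cos (p * u) - (1 - (p * u) ^ 2 / 2))
          = ∑ u ∈ torus N, bandStep f N W u * cos (p * u) - ∑ u ∈ torus N, bandStep f N W u
            + (∑ u ∈ torus N, bandStep f N W u * (((u : ℝ) / W) ^ 2) ^ 1)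
              * ((p * W) ^ 2 / 2) := by
        rw [sum_mul, ← sum_sub_distrib, ← sum_add_distrib]
        refine sum_congr rfl fun u _ ↦ ?_
        field_simp
        ring
      rw [e1, hD, hstep.sum_eq_one, symb]
      ring
    rw [e]
    calc _ ≤ ∑ u ∈ torus N, (bandStep f N W u * (((u : ℝ) / W) ^ 2) ^ 2) * (p * W) ^ 4 := by
          refine (abs_sum_le_sum_abs _ _).trans (sum_le_sum fun u _ ↦ ?_)
          rw [abs_mul, abs_of_nonneg (hstep.nonneg u)]
          refine (mul_le_mul_of_nonneg_left (abs_cos_sub_le _) (hstep.nonneg u)).trans (le_of_eq ?_)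
          field_simp
      _ ≤ _ := by
          rw [← sum_mul]
          exact mul_le_mul_of_nonneg_right h1 (by positivity)

end Density
end BandProfile

/-! ### The Stieltjes transform of the semicircle law. -/

namespace BandProfile
open Finset

/-- The two roots of w² + zw + 1 have product 1. If both had modulus 1 they would be conjugate, and
their sum -z would be real. -/
theorem exists_norm_lt_one_add_inv {z : ℂ} (hz : z.im ≠ 0) :
    ∃ w : ℂ, ‖w‖ < 1 ∧ w ≠ 0 ∧ w + w⁻¹ = -z := by
  obtain ⟨s, hs⟩ := IsAlgClosed.exists_pow_nat_eq (z ^ 2 - 4) (n := 2) (by norm_num)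
  set w₁ : ℂ := (-z + s) / 2 with hw₁
  set w₂ : ℂ := (-z - s) / 2 with hw₂
  have hprod : w₁ * w₂ = 1 := by
    have : w₁ * w₂ = (z ^ 2 - s ^ 2) / 4 := by rw [hw₁, hw₂]; ring
    rw [this, hs]; ring
  have hsum : w₁ + w₂ = -z := by rw [hw₁, hw₂]; ring
  have h1 : w₁ ≠ 0 := left_ne_zero_of_mul_eq_one hprod
  have h2 : w₂ ≠ 0 := right_ne_zero_of_mul_eq_one hprod
  have hn : ‖w₁‖ * ‖w₂‖ = 1 := by rw [← norm_mul, hprod, norm_one]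
  have hinv : w₁⁻¹ = w₂ := inv_eq_of_mul_eq_one_right hprod
  have hinv' : w₂⁻¹ = w₁ := inv_eq_of_mul_eq_one_left hprod
  rcases lt_trichotomy ‖w₁‖ 1 with h | h | h
  · exact ⟨w₁, h, h1, by rw [hinv, hsum]⟩
  · exfalso
    have hc : w₁⁻¹ = (starRingEnd ℂ) w₁ := Complex.inv_eq_conj h
    rw [← hinv, hc, Complex.add_conj] at hsum
    have := congrArg Complex.im hsum
    simp at this
    exact hz this
  · refine ⟨w₂, ?_, h2, by rw [hinv', add_comm, hsum]⟩
    have := norm_pos_iff.2 h2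
    nlinarith

/-- The generating function of the Chebyshev polynomials of the second kind, as a combination of two
geometric series in exp(±it). -/
theorem hasSum_sin_generating {w : ℂ} (hw : ‖w‖ < 1) (t : ℂ) (ht : t.im = 0) :
    1 + 2 * w * Complex.cos t + w ^ 2 ≠ 0 ∧
    HasSum (fun n : ℕ ↦ (-w) ^ n * Complex.sin ((n + 1) * t))
      (Complex.sin t / (1 + 2 * w * Complex.cos t + w ^ 2)) := by
  set e := Complex.exp (t * Complex.I) with he
  set e' := Complex.exp (-t * Complex.I) with he'
  have hee : e * e' = 1 := by rw [he, he', ← Complex.exp_add]; simp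
  have hne : ‖e‖ = 1 := by rw [he, Complex.norm_exp]; simp [ht]
  have hne' : ‖e'‖ = 1 := by rw [he', Complex.norm_exp]; simp [ht]
  have hcos : 2 * Complex.cos t = e + e' := by rw [Complex.two_cos]
  have hsin : Complex.sin t = (e' - e) * Complex.I / 2 := rfl
  have hg1 : ‖-w * e‖ < 1 := by rw [norm_mul, hne, norm_neg, mul_one]; exact hw
  have hg2 : ‖-w * e'‖ < 1 := by rw [norm_mul, hne', norm_neg, mul_one]; exact hw
  have hd1 : 1 - -w * e ≠ 0 := fun h ↦ by
    rw [← sub_eq_zero.1 h, norm_one] at hg1; exact lt_irrefl _ hg1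
  have hd2 : 1 - -w * e' ≠ 0 := fun h ↦ by
    rw [← sub_eq_zero.1 h, norm_one] at hg2; exact lt_irrefl _ hg2
  have hfac : 1 + 2 * w * Complex.cos t + w ^ 2 = (1 - -w * e) * (1 - -w * e') := by
    have : 2 * w * Complex.cos t = w * (2 * Complex.cos t) := by ring
    rw [this, hcos]
    linear_combination (-w ^ 2) * hee
  refine ⟨by rw [hfac]; exact mul_ne_zero hd1 hd2, ?_⟩
  have h1 := (hasSum_geometric_of_norm_lt_one hg1).mul_left (-(e * Complex.I / 2))
  have h2 := (hasSum_geometric_of_norm_lt_one hg2).mul_left (e' * Complex.I / 2)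
  have h3 := h2.add h1
  have hval : e' * Complex.I / 2 * (1 - -w * e')⁻¹ + -(e * Complex.I / 2) * (1 - -w * e)⁻¹
      = Complex.sin t / (1 + 2 * w * Complex.cos t + w ^ 2) := by
    rw [hfac, hsin, ← div_eq_mul_inv, ← div_eq_mul_inv, div_add_div _ _ hd2 hd1,
      div_eq_div_iff (mul_ne_zero hd2 hd1) (mul_ne_zero hd1 hd2)]
    ring
  rw [hval] at h3
  have hterm : (fun n : ℕ ↦ (-w) ^ n * Complex.sin ((n + 1) * t))
      = fun n : ℕ ↦ e' * Complex.I / 2 * (-w * e') ^ n + -(e * Complex.I / 2) * (-w * e) ^ n := by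
    funext n
    have a1 : Complex.exp ((n + 1) * t * Complex.I) = e ^ (n + 1) := by
      rw [he, ← Complex.exp_nat_mul]; push_cast; ring_nf
    have a2 : Complex.exp (-((n + 1) * t) * Complex.I) = e' ^ (n + 1) := by
      rw [he', ← Complex.exp_nat_mul]; push_cast; ring_nf
    have a3 : Complex.sin ((n + 1) * t) = (e' ^ (n + 1) - e ^ (n + 1)) * Complex.I / 2 := by
      rw [← a1, ← a2]; rfl
    rw [a3, mul_pow, mul_pow]
    ring
  rw [hterm]
  exact h3

theorem integral_cos_nat_mul {k : ℕ} (hk : k ≠ 0) :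
    ∫ t in (0 : ℝ)..Real.pi, Real.cos (k * t) = 0 := by
  have hk' : (k : ℝ) ≠ 0 := by exact_mod_cast hk
  rw [intervalIntegral.integral_comp_mul_left _ hk', integral_cos]
  simp

theorem integral_sin_mul_sin_succ (n : ℕ) :
    ∫ t in (0 : ℝ)..Real.pi, Real.sin t * Real.sin ((n + 1) * t)
      = if n = 0 then Real.pi / 2 else 0 := by
  have h1 : ∀ t : ℝ, Real.sin t * Real.sin ((n + 1) * t)
      = 2⁻¹ * (Real.cos (n * t) - Real.cos ((n + 2 : ℕ) * t)) := fun t ↦ by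
    have a1 : (n : ℝ) * t = (n + 1) * t - t := by ring
    have a2 : ((n + 2 : ℕ) : ℝ) * t = (n + 1) * t + t := by push_cast; ring
    rw [a1, a2, Real.cos_sub, Real.cos_add]; ring
  simp only [h1]
  have hi : ∀ k : ℕ, IntervalIntegrable (fun t ↦ Real.cos (k * t)) MeasureTheory.volume 0 Real.pi :=
    fun k ↦ (by fun_prop : Continuous fun t : ℝ ↦ Real.cos (k * t)).intervalIntegrable _ _
  rw [intervalIntegral.integral_const_mul, intervalIntegral.integral_sub (hi n) (hi (n + 2)),
    integral_cos_nat_mul (by omega : n + 2 ≠ 0)]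
  split_ifs with hn
  · subst hn; simp; ring
  · rw [integral_cos_nat_mul hn]; simp

/-- Integrate the generating series term by term; orthogonality of the sines keeps only n = 0. -/
theorem integral_sin_sq_div {w : ℂ} (hw : ‖w‖ < 1) :
    ∫ t in (0 : ℝ)..Real.pi, (Real.sin t : ℂ) *
      (Complex.sin t / (1 + 2 * w * Complex.cos t + w ^ 2)) = (Real.pi / 2 : ℂ) := by
  have key := intervalIntegral.hasSum_integral_of_dominated_convergence
    (μ := MeasureTheory.volume) (a := 0) (b := Real.pi)
    (F := fun (n : ℕ) (t : ℝ) ↦ (Real.sin t : ℂ) * ((-w) ^ n * Complex.sin ((n + 1) * t)))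
    (f := fun t : ℝ ↦ (Real.sin t : ℂ) * (Complex.sin t / (1 + 2 * w * Complex.cos t + w ^ 2)))
    (fun n _ ↦ ‖w‖ ^ n) (fun n ↦ (by fun_prop :
      Continuous fun t : ℝ ↦ (Real.sin t : ℂ) * ((-w) ^ n * Complex.sin ((n + 1) * t))
      ).aestronglyMeasurable) (fun n ↦ Filter.Eventually.of_forall fun t _ ↦ ?_)
    (Filter.Eventually.of_forall fun t _ ↦ summable_geometric_of_lt_one (norm_nonneg w) hw)
    intervalIntegrable_const
    (Filter.Eventually.of_forall fun t _ ↦ (hasSum_sin_generating hw t (by simp)).2.mul_left _)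
  · have hF : ∀ n : ℕ, ∫ t in (0 : ℝ)..Real.pi,
        (Real.sin t : ℂ) * ((-w) ^ n * Complex.sin ((n + 1) * t))
        = if n = 0 then (Real.pi / 2 : ℂ) else 0 := fun n ↦ by
      have e : ∀ t : ℝ, (Real.sin t : ℂ) * ((-w) ^ n * Complex.sin ((n + 1) * t))
          = (-w) ^ n * ((Real.sin t * Real.sin ((n + 1) * t) : ℝ) : ℂ) := fun t ↦ by
        push_cast; ring
      simp only [e]
      rw [intervalIntegral.integral_const_mul, intervalIntegral.integral_ofReal,
        integral_sin_mul_sin_succ]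
      split_ifs with hn
      · subst hn; simp
      · simp
    simp only [hF] at key
    exact key.unique (hasSum_ite_eq 0 _)
  · have e : Complex.sin (((n : ℂ) + 1) * t) = ((Real.sin ((n + 1) * t) : ℝ) : ℂ) := by push_cast; rfl
    rw [e, norm_mul, norm_mul, norm_pow, norm_neg, Complex.norm_real, Complex.norm_real]
    have h1 := Real.abs_sin_le_one t
    have h2 := Real.abs_sin_le_one ((n + 1) * t)
    rw [← Real.norm_eq_abs] at h1 h2
    have h3 : 0 ≤ ‖w‖ ^ n := by positivity
    calc _ ≤ 1 * (‖w‖ ^ n * 1) := by gcongr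
      _ = _ := by ring

/-- The Stieltjes transform of the semicircle law is the small root of `w + w⁻¹ + z = 0`. -/
theorem msc_eq {z w : ℂ} (hz : z.im ≠ 0) (hw : ‖w‖ < 1) (hw0 : w ≠ 0) (hzw : w + w⁻¹ = -z) :
    msc z = w := by
  have hne : ∀ x : ℝ, (x : ℂ) - z ≠ 0 := fun x h ↦ hz (by
    have := congrArg Complex.im h
    simpa using this)
  have hcont : Continuous fun ξ : ℝ ↦ ((Real.sqrt (4 - ξ ^ 2) : ℝ) : ℂ) / ((ξ : ℂ) - z) := by
    refine Continuous.div ?_ (by fun_prop) hne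
    exact Complex.continuous_ofReal.comp (by fun_prop)
  have hsub := intervalIntegral.integral_deriv_smul_comp (a := 0) (b := Real.pi)
    (f := fun t ↦ 2 * Real.cos t) (f' := fun t ↦ 2 * -Real.sin t)
    (g := fun ξ : ℝ ↦ ((Real.sqrt (4 - ξ ^ 2) : ℝ) : ℂ) / ((ξ : ℂ) - z))
    (fun t _ ↦ (Real.hasDerivAt_cos t).const_mul 2) (by fun_prop) hcont
  simp only [Real.cos_zero, Real.cos_pi, mul_one, mul_neg] at hsub
  have hI : ∫ t in (0 : ℝ)..Real.pi, (-(2 * Real.sin t)) •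
      ((fun ξ : ℝ ↦ ((Real.sqrt (4 - ξ ^ 2) : ℝ) : ℂ) / ((ξ : ℂ) - z)) ∘
        fun t ↦ 2 * Real.cos t) t = -(4 * w) * (Real.pi / 2) := by
    rw [← integral_sin_sq_div hw, ← intervalIntegral.integral_const_mul]
    refine intervalIntegral.integral_congr fun t ht ↦ ?_
    rw [Set.uIcc_of_le Real.pi_pos.le] at ht
    have hs : Real.sqrt (4 - (2 * Real.cos t) ^ 2) = 2 * Real.sin t := by
      have : 4 - (2 * Real.cos t) ^ 2 = (2 * Real.sin t) ^ 2 := by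
        have := Real.sin_sq_add_cos_sq t
        linear_combination (-4) * this
      rw [this, Real.sqrt_sq (mul_nonneg (by norm_num) (Real.sin_nonneg_of_mem_Icc ht))]
    have hd := (hasSum_sin_generating hw (t : ℂ) (by simp)).1
    -- The substitution ξ = 2 cos t with z = -(w + w⁻¹) turns the resolvent kernel into w over the
    -- Chebyshev denominator.
    have hd2 : ((2 * Real.cos t : ℝ) : ℂ) - z = (1 + 2 * w * Complex.cos t + w ^ 2) / w := by
      have : z = -(w + w⁻¹) := by rw [hzw, neg_neg]
      rw [this]
      push_cast
      field_simp
      ring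
    simp only [Function.comp, hs, hd2, Complex.real_smul]
    push_cast
    field_simp
    ring
  rw [hI] at hsub
  have hflip : ∫ ξ in (-2 : ℝ)..2, ((Real.sqrt (4 - ξ ^ 2) : ℝ) : ℂ) / ((ξ : ℂ) - z)
      = 4 * w * (Real.pi / 2) := by
    rw [intervalIntegral.integral_symm, ← hsub]; ring
  have hπ : (Real.pi : ℂ) ≠ 0 := by exact_mod_cast Real.pi_ne_zero
  rw [msc, hflip]
  field_simp
  ring

/-- With r = |w|², the equation w + w⁻¹ = -z reads (1 + r) Re w = -rE and (1 - r) Im w = rη.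
Inserting these in r = (Re w)² + (Im w)² eliminates w. -/
theorem norm_msc_eq {z : ℂ} (hz : 0 < z.im) :
    0 < ‖msc z‖ ^ 2 ∧ ‖msc z‖ ^ 2 < 1 ∧
    z.re ^ 2 * ‖msc z‖ ^ 2 * (1 - ‖msc z‖ ^ 2) ^ 2 + z.im ^ 2 * ‖msc z‖ ^ 2 * (1 + ‖msc z‖ ^ 2) ^ 2
      = (1 - ‖msc z‖ ^ 2) ^ 2 * (1 + ‖msc z‖ ^ 2) ^ 2 := by
  obtain ⟨w, hw, hw0, hzw⟩ := exists_norm_lt_one_add_inv hz.ne'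
  rw [msc_eq hz.ne' hw hw0 hzw]
  have hn : 0 < ‖w‖ := norm_pos_iff.2 hw0
  refine ⟨by positivity, pow_lt_one₀ hn.le hw (by norm_num), ?_⟩
  have hr : ‖w‖ ^ 2 = w.re ^ 2 + w.im ^ 2 := by
    rw [← Complex.normSq_eq_norm_sq, Complex.normSq_apply]; ring
  have hr' : Complex.normSq w = ‖w‖ ^ 2 := Complex.normSq_eq_norm_sq w
  set r := ‖w‖ ^ 2 with hrd
  have hr0 : 0 < r := by positivity
  have h1 := congrArg Complex.re hzw
  have h2 := congrArg Complex.im hzw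
  simp only [Complex.add_re, Complex.add_im, Complex.neg_re, Complex.neg_im, Complex.inv_re,
    Complex.inv_im, hr'] at h1 h2
  have e1 : w.re * (1 + r) = -z.re * r := by
    rw [← h1]; field_simp; ring
  have e2 : w.im * (1 - r) = z.im * r := by
    have : z.im = -(w.im + -w.im / r) := by rw [h2, neg_neg]
    rw [this]; field_simp; ring
  have e3 : r * (r * (1 - r) ^ 2 * z.re ^ 2 + r * (1 + r) ^ 2 * z.im ^ 2)
      = r * ((1 - r) ^ 2 * (1 + r) ^ 2) := by
    calc _ = (1 - r) ^ 2 * (-z.re * r) ^ 2 + (1 + r) ^ 2 * (z.im * r) ^ 2 := by ring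
      _ = (1 - r) ^ 2 * (1 + r) ^ 2 * (w.re ^ 2 + w.im ^ 2) := by rw [← e1, ← e2]; ring
      _ = _ := by rw [← hr]; ring
  have := mul_left_cancel₀ hr0.ne' e3
  linarith

theorem alpha_bounds {κ : ℝ} (hκ : 0 < κ) {z : ℂ} (h1 : -2 + κ ≤ z.re) (h2 : z.re ≤ 2 - κ) :
    1 ≤ alpha z ∧ alpha z ≤ 2 / √(2 * κ) ∧ alpha z ^ 2 * (4 - z.re ^ 2) = 4 ∧
      2 * κ ≤ 4 - z.re ^ 2 := by
  have he : 2 * κ ≤ 4 - z.re ^ 2 := by nlinarith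
  have he0 : 0 < 4 - z.re ^ 2 := by linarith
  have hs := Real.sqrt_pos.2 he0
  refine ⟨?_, ?_, ?_, he⟩
  · rw [alpha, one_le_div hs, Real.sqrt_le_left (by norm_num)]
    nlinarith [sq_nonneg z.re]
  · rw [alpha]
    exact div_le_div_of_nonneg_left (by norm_num) (Real.sqrt_pos.2 (by positivity))
      (Real.sqrt_le_sqrt he)
  · rw [alpha, div_pow, Real.sq_sqrt he0.le]
    field_simp
    norm_num

/-- In terms of q = (1 - r)²/r, for which (q + 4)r = (1 + r)², the relation becomes q(q + e) = η²(q
+ 4) with e = 4 - E². To leading order q = 4η²/e = a²η². -/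
theorem quotient_bounds {r η a e : ℝ} (hr0 : 0 < r) (hr1 : r < 1) (he0 : 0 < e)
    (he4 : e ≤ 4) (ha3 : a ^ 2 * e = 4) {q : ℝ} (hq : q = (1 - r) ^ 2 / r)
    (hrel : (4 - e) * r * (1 - r) ^ 2 + η ^ 2 * r * (1 + r) ^ 2 = (1 - r) ^ 2 * (1 + r) ^ 2) :
    q * r = (1 - r) ^ 2 ∧ 0 < q ∧ η ^ 2 ≤ q ∧ q ≤ a ^ 2 * η ^ 2 ∧
      a ^ 2 * η ^ 2 - q ≤ a ^ 4 / e * η ^ 4 := by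
  have hqr : q * r = (1 - r) ^ 2 := by rw [hq]; field_simp
  have hq0 : 0 < q := by
    have : 0 < 1 - r := by linarith
    rw [hq]; positivity
  have hq4 : (q + 4) * r = (1 + r) ^ 2 := by rw [add_mul, hqr]; ring
  have hqe : q * (q + e) = η ^ 2 * (q + 4) := by
    have : r ^ 2 * (q * (q + e)) = r ^ 2 * (η ^ 2 * (q + 4)) := by
      have e1 : r ^ 2 * (q * (q + e)) = (q * r) * ((q + 4) * r) - (4 - e) * r * (q * r) := by ring
      have e2 : r ^ 2 * (η ^ 2 * (q + 4)) = η ^ 2 * r * ((q + 4) * r) := by ring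
      rw [e1, e2, hqr, hq4]
      linarith
    exact mul_left_cancel₀ (by positivity) this
  have hqη : η ^ 2 ≤ q := by
    by_contra hlt
    push Not at hlt
    nlinarith [sq_nonneg η]
  have hqa : q ≤ a ^ 2 * η ^ 2 := by
    have : q * e ≤ a ^ 2 * η ^ 2 * e := by
      have : a ^ 2 * η ^ 2 * e = 4 * η ^ 2 := by rw [← ha3]; ring
      nlinarith
    exact le_of_mul_le_mul_right this he0
  have haq : a ^ 2 * η ^ 2 - q ≤ a ^ 4 / e * η ^ 4 := by
    have h3 : (a ^ 2 * η ^ 2 - q) * e = q * (q - η ^ 2) := by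
      have : a ^ 2 * η ^ 2 * e = 4 * η ^ 2 := by rw [← ha3]; ring
      linarith
    have h4 : q * (q - η ^ 2) ≤ (a ^ 2 * η ^ 2) ^ 2 := by nlinarith [sq_nonneg η]
    have h5 : a ^ 4 / e * η ^ 4 = (a ^ 2 * η ^ 2) ^ 2 / e := by ring
    rw [h5, le_div_iff₀ he0]
    linarith
  exact ⟨hqr, hq0, hqη, hqa, haq⟩

theorem norm_msc_sq_bounds {κ : ℝ} (hκ : 0 < κ) : ∃ c C : ℝ, 0 < c ∧ 0 < C ∧ ∀ z : ℂ,
    -2 + κ ≤ z.re → z.re ≤ 2 - κ → 0 < z.im → z.im ≤ 10 →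
      c ≤ ‖msc z‖ ^ 2 ∧ ‖msc z‖ ^ 2 ≤ 1 - c * z.im ∧
        |‖msc z‖ ^ 2 - (1 - alpha z * z.im)| ≤ C * z.im ^ 2 := by
  set a₁ := 2 / √(2 * κ) with ha₁
  have ha₁0 : 0 < a₁ := by positivity
  set Q := a₁ ^ 2 * 100 with hQ
  have hQ0 : 0 < Q := by positivity
  -- Q bounds q for η ≤ 10, and (1 - r)² = qr ≤ Qr gives r ≥ 1/(Q + 2). The same constant serves for
  -- the gap because 1 - r ≥ rη.
  refine ⟨(Q + 2)⁻¹, a₁ ^ 4 / (2 * κ) * 10 + a₁ ^ 2, by positivity, by positivity,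
    fun z h1 h2 hη hη10 ↦ ?_⟩
  obtain ⟨hr0, hr1, hrel⟩ := norm_msc_eq hη
  obtain ⟨ha1, ha2, ha3, he⟩ := alpha_bounds hκ h1 h2
  set r := ‖msc z‖ ^ 2 with hr
  set η := z.im with hηd
  set a := alpha z with ha
  set e := 4 - z.re ^ 2 with hed
  have he0 : 0 < e := by linarith
  have hE : z.re ^ 2 = 4 - e := by rw [hed]; ring
  rw [hE] at hrel
  have ha0 : 0 < a := by linarith
  have he4 : e ≤ 4 := by rw [hed]; nlinarith [sq_nonneg z.re]
  set q := (1 - r) ^ 2 / r with hq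
  obtain ⟨hqr, hq0, hqη, hqa, haq⟩ := quotient_bounds hr0 hr1 he0 he4 ha3 hq hrel
  have hqQ : q ≤ Q := by
    refine hqa.trans ?_
    have h3 : η ^ 2 ≤ 100 := by nlinarith
    have h4 : a ^ 2 ≤ a₁ ^ 2 := pow_le_pow_left₀ ha0.le ha2 2
    rw [hQ]
    exact mul_le_mul h4 h3 (by positivity) (by positivity)
  have hrc : (Q + 2)⁻¹ ≤ r := by
    rw [inv_le_iff_one_le_mul₀ (by positivity)]
    nlinarith [mul_le_mul_of_nonneg_right hqQ hr0.le]
  set y := 1 - r with hy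
  have hy0 : 0 < y := by linarith
  have hry : r = 1 - y := by rw [hy]; ring
  have hyη : r * η ≤ y := by
    refine (pow_le_pow_iff_left₀ (by positivity) hy0.le two_ne_zero).1 ?_
    calc (r * η) ^ 2 = r * (η ^ 2 * r) := by ring
      _ ≤ 1 * (q * r) := by gcongr
      _ = y ^ 2 := by rw [one_mul, hqr]
  -- Since (1 - r)² = s²r, the quantity 1 - r lies between sr and s, while s equals aη up to O(η³).
  set s := √q with hs
  have hs2 : s ^ 2 = q := Real.sq_sqrt hq0.le
  have hs0 : 0 < s := Real.sqrt_pos.2 hq0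
  have hsη : η ≤ s := Real.le_sqrt_of_sq_le hqη
  have hsa : s ≤ a * η := Real.sqrt_le_iff.2 ⟨by positivity, by rw [mul_pow]; exact hqa⟩
  have hya : y ≤ a * η := by
    refine le_trans ((pow_le_pow_iff_left₀ hy0.le hs0.le two_ne_zero).1 ?_) hsa
    rw [hs2, ← hqr]
    exact mul_le_of_le_one_right hq0.le hr1.le
  have hys : s * r ≤ y := by
    refine (pow_le_pow_iff_left₀ (by positivity) hy0.le two_ne_zero).1 ?_
    rw [mul_pow, hs2, ← hqr]
    exact mul_le_mul_of_nonneg_left (by nlinarith) hq0.le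
  have has : a * η - s ≤ a ^ 4 / e * η ^ 3 := by
    have h3 : (a * η - s) * η ≤ a ^ 4 / e * η ^ 3 * η := by
      calc (a * η - s) * η ≤ (a * η - s) * (a * η + s) :=
            mul_le_mul_of_nonneg_left (by linarith) (by linarith)
        _ = a ^ 2 * η ^ 2 - q := by rw [← hs2]; ring
        _ ≤ a ^ 4 / e * η ^ 4 := haq
        _ = _ := by ring
    exact le_of_mul_le_mul_right h3 hη
  refine ⟨hrc, ?_, ?_⟩
  · have := mul_le_mul_of_nonneg_right hrc hη.le
    linarith
  · have hlow : a * η - a ^ 4 / e * η ^ 3 - a ^ 2 * η ^ 2 ≤ y := by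
      have h3 : s * y ≤ (a * η) * (a * η) := mul_le_mul hsa hya hy0.le (by positivity)
      have h4 : s * r = s - s * y := by rw [hry]; ring
      have h5 : a * η * (a * η) = a ^ 2 * η ^ 2 := by ring
      linarith
    have h4 : a ^ 4 / e * η ^ 3 ≤ a₁ ^ 4 / (2 * κ) * 10 * η ^ 2 := by
      calc _ = a ^ 4 / e * η * η ^ 2 := by ring
        _ ≤ _ := by gcongr
    have h5 : a ^ 2 * η ^ 2 ≤ a₁ ^ 2 * η ^ 2 := by gcongr
    have h6 : r - (1 - a * η) = a * η - y := by rw [hy]; ring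
    rw [h6, abs_of_nonneg (by linarith), add_mul]
    linarith

end BandProfile

/-! ### Comparison of Θ with θ and bounds on θ. -/

namespace BandProfile
open Finset Real

theorem IsStep.mono {N W : ℕ} {B B' : ℕ → ℝ} {h : ℤ → ℝ} (hh : IsStep N W B h)
    (hB : ∀ K, B K ≤ B' K) : IsStep N W B' h :=
  ⟨hh.periodic, hh.even, hh.nonneg, hh.sum_eq_one, fun K u ↦ (hh.decay K u).trans (by
    have := hB K; gcongr)⟩

theorem cosh_sub_bounds {x : ℝ} (hx0 : 0 ≤ x) (hx : x ≤ 1) :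
    x ^ 2 ≤ 2 * cosh x - 2 ∧ 2 * cosh x - 2 ≤ x ^ 2 + x ^ 4 := by
  constructor
  · have h1 : cosh x = 1 + 2 * sinh (x / 2) ^ 2 := by
      have : x = 2 * (x / 2) := by ring
      nth_rewrite 1 [this]
      rw [cosh_two_mul, cosh_sq']; ring
    have h2 : x / 2 ≤ sinh (x / 2) := self_le_sinh_iff.2 (by linarith)
    have h3 := pow_le_pow_left₀ (by linarith) h2 2
    rw [h1]; linarith
  · have h1 := cosh_le_exp_half_sq x
    have hx2 : x ^ 2 ≤ 1 := pow_le_one₀ hx0 hx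
    have h2 := (abs_le.1 (abs_exp_sub_one_sub_id_le (x := x ^ 2 / 2) (by
      rw [abs_of_nonneg (by positivity)]; linarith))).2
    have h3 : 0 ≤ x ^ 4 := by positivity
    have h4 : (x ^ 2 / 2) ^ 2 = x ^ 4 / 4 := by ring
    linarith

theorem sinh_sub_bounds {x : ℝ} (hx0 : 0 ≤ x) (hx : x ≤ 1) : x ≤ sinh x ∧ sinh x ≤ x + x ^ 3 := by
  refine ⟨self_le_sinh_iff.2 hx0, ?_⟩
  have h1 := (abs_le.1 (Real.exp_bound (x := x) (by rwa [abs_of_nonneg hx0])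
    (n := 3) (by norm_num))).2
  have h2 := (abs_le.1 (Real.exp_bound (x := -x) (by rwa [abs_neg, abs_of_nonneg hx0])
    (n := 3) (by norm_num))).1
  rw [abs_of_nonneg hx0] at h1
  rw [abs_neg, abs_of_nonneg hx0] at h2
  norm_num [sum_range_succ, Nat.factorial] at h1 h2
  have h3 : 0 ≤ x ^ 3 := by positivity
  rw [sinh_eq]
  linarith

/-- Admissible sizes and spectral parameters, with `W` above a threshold. -/
structure Regular (f : ℝ → ℝ) (κ c₀ W₀ : ℝ) (N W : ℕ) (z : ℂ) : Prop where
  pos : 0 < W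
  threshold : W₀ ≤ W
  le : W ≤ N
  mass : c₀ ≤ ∫ t in (-((N : ℝ) / (2 * (W : ℝ))))..((N : ℝ) / (2 * (W : ℝ))), f t
  lower : -2 + κ ≤ z.re
  upper : z.re ≤ 2 - κ
  im_pos : 0 < z.im
  im_le : z.im ≤ 10

theorem Regular.mono {f : ℝ → ℝ} {κ c₀ W₀ W₁ : ℝ} {N W : ℕ} {z : ℂ} (h : Regular f κ c₀ W₁ N W z)
    (hW : W₀ ≤ W₁) : Regular f κ c₀ W₀ N W z :=
  { h with threshold := hW.trans h.threshold }

/-- The inverse length scale of the profile. -/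
noncomputable def rate (f : ℝ → ℝ) (N W : ℕ) (z : ℂ) : ℝ :=
  √(alpha z * z.im) / ((W : ℝ) * √(diffD f N W))

theorem theta_eq (f : ℝ → ℝ) (N W : ℕ) (z : ℂ) (x : ℤ) :
    theta f N W z x = ‖msc z‖ ^ 2 / (2 * (W : ℝ) * √(diffD f N W * alpha z * z.im))
      * expSum N (rate f N W z) x := rfl

theorem Theta_eq_four {f : ℝ → ℝ} {N W : ℕ} {z : ℂ} {B : ℕ → ℝ} {c : ℝ} (hN : 0 < N) (hc : 0 ≤ c)
    (hh : IsStep N W B (bandStep f N W)) (hg : HasGap N W c (bandStep f N W))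
    (hr : ‖msc z‖ ^ 2 < 1) :
    Theta f N W z = four N (fun j ↦ ‖msc z‖ ^ 2 * symb N (bandStep f N W) j
      / (1 - ‖msc z‖ ^ 2 * symb N (bandStep f N W) j)) := by
  rw [Theta, S_eq_circ]
  refine smul_circ_mul_inv hN hh.periodic hh.even fun j hj h ↦ ?_
  have h1 := hg.abs_symb_le_one hc hj
  have h2 := mul_le_mul_of_nonneg_left (le_of_abs_le h1) (sq_nonneg ‖msc z‖)
  linarith

section Main
variable {f : ℝ → ℝ}

theorem IsBandDensity.exists_diffD_bounds (hf : IsBandDensity f) {κ c₀ : ℝ} (hc₀ : 0 < c₀) :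
    ∃ d₀ d₁ W₀ : ℝ, 0 < d₀ ∧ 0 < d₁ ∧ ∀ N W z, Regular f κ c₀ W₀ N W z →
      d₀ ≤ diffD f N W ∧ diffD f N W ≤ d₁ := by
  obtain ⟨B, c, C₄, d₀, d₁, W₀, -, -, hd₀, hd₁, h⟩ := hf.exists_step hc₀
  refine ⟨d₀, d₁, W₀, hd₀, hd₁, fun N W z hz ↦ ?_⟩
  have := h N W hz.pos hz.threshold hz.le hz.mass
  exact ⟨this.2.2.1, this.2.2.2.1⟩

/-- Guarantees that η ≥ M^{-1+γ} forces η > 0 on the spectral domain. -/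
theorem IsBandDensity.exists_M_pos (hf : IsBandDensity f) {c₀ : ℝ} (hc₀ : 0 < c₀) :
    ∃ W₀ : ℝ, ∀ N W : ℕ, 0 < W → W₀ ≤ W → W ≤ N →
      c₀ ≤ ∫ t in (-((N : ℝ) / (2 * (W : ℝ))))..((N : ℝ) / (2 * (W : ℝ))), f t →
      0 < M f N W := by
  obtain ⟨B, c, C₄, d₀, d₁, W₀, -, -, -, -, h⟩ := hf.exists_step hc₀
  refine ⟨W₀, fun N W hW hW₀ hWN hm ↦ ?_⟩
  have hN : 0 < N := by omega
  have hs := (h N W hW hW₀ hWN hm).1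
  rw [M, S_eq_circ]
  refine one_div_pos.2 ?_
  have h1 := hs.row_sum hN 1 ⟨0, zero_mem_torus hN⟩
  rw [pow_one] at h1
  obtain ⟨y, hy⟩ : ∃ y, 0 < circ N (bandStep f N W) ⟨0, zero_mem_torus hN⟩ y := by
    by_contra! h2
    have := sum_nonpos (s := univ) fun y _ ↦ h2 y
    linarith
  exact hy.trans_le (le_ciSup (f := fun p : Torus N × Torus N ↦ circ N (bandStep f N W) p.1 p.2)
    (Set.finite_range _).bddAbove (⟨0, zero_mem_torus hN⟩, y))

/-- The bound on the profile at spectral parameters away from the real axis. -/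
theorem IsBandDensity.exists_Theta_le (hf : IsBandDensity f) {κ c₀ : ℝ} (hκ : 0 < κ)
    (hc₀ : 0 < c₀) : ∃ W₀ : ℝ, ∀ k : ℕ, 1 ≤ k → ∃ C : ℝ, 0 ≤ C ∧
      ∀ N W z, Regular f κ c₀ W₀ N W z → ∀ x y : Torus N, Theta f N W z x y
        ≤ C / z.im * (1 / W * ((1 + z.im * (perAbs N (x.1 - y.1) / W) ^ 2) ^ k)⁻¹) := by
  obtain ⟨B, c, C₄, d₀, d₁, W₀, hc, hC₄, hd₀, hd₁, h⟩ := hf.exists_step hc₀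
  obtain ⟨cm, Cm, hcm, hCm, hm⟩ := norm_msc_sq_bounds hκ
  refine ⟨W₀, fun k hk ↦ ?_⟩
  obtain ⟨C, hC0, hC⟩ := IsStep.abs_resolvent_le B hc hcm hk
  refine ⟨C, hC0, fun N W z hz x y ↦ ?_⟩
  obtain ⟨hs, hg, -⟩ := h N W hz.pos hz.threshold hz.le hz.mass
  have hN : 0 < N := hz.pos.trans_le hz.le
  obtain ⟨-, h2, -⟩ := hm z hz.lower hz.upper hz.im_pos hz.im_le
  rw [Theta_eq_four hN hc.le hs hg (norm_msc_eq hz.im_pos).2.1]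
  exact (le_abs_self _).trans (hC N W _ z.im _ hN hz.pos hs hg hz.im_pos (sq_nonneg _) h2 x y)

/-- With A = DW² and λ the rate, λ²A = αη and the prefactor of θ is r/(2Aλ), to be compared with
ρ/(2A sinh λ) in `four_geometric`. -/
theorem rate_facts {d₀ : ℝ} (hd₀ : 0 < d₀) {N W : ℕ} {z : ℂ} (hW : 0 < W)
    (hD : d₀ ≤ diffD f N W) (ha : 1 ≤ alpha z) (hη : 0 < z.im) :
    0 < rate f N W z ∧ rate f N W z ^ 2 * (diffD f N W * (W : ℝ) ^ 2) = alpha z * z.im ∧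
      (W : ℝ) * √(diffD f N W * alpha z * z.im) = rate f N W z * (diffD f N W * (W : ℝ) ^ 2) := by
  have hW' : (0 : ℝ) < W := by exact_mod_cast hW
  have hD0 : 0 < diffD f N W := hd₀.trans_le hD
  have ha0 : 0 < alpha z := by linarith
  have hs := sqrt_pos.2 hD0
  refine ⟨?_, ?_, ?_⟩
  · unfold rate; positivity
  · rw [rate, div_pow, mul_pow, sq_sqrt (by positivity), sq_sqrt hD0.le]
    field_simp
  · rw [rate, mul_assoc (diffD f N W), sqrt_mul hD0.le]
    nth_rewrite 3 [← mul_self_sqrt hD0.le]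
    field_simp

theorem abs_one_sub_mul_sinh_div_le {lam r ρ δ : ℝ} (hlam : 0 < lam) (hlam1 : lam ≤ 1)
    (hρ : 1 / 2 ≤ ρ) (hr0 : 0 ≤ r) (hr1 : r ≤ 1) (h : |r - ρ| ≤ δ) :
    |1 - r * sinh lam / (ρ * lam)| ≤ 2 * (δ + lam ^ 2) := by
  obtain ⟨hsinh1, hsinh2⟩ := sinh_sub_bounds hlam.le hlam1
  have hρpos : 0 < ρ := by linarith
  have e1 : 1 - r * sinh lam / (ρ * lam) = ((ρ - r) - r * (sinh lam / lam - 1)) / ρ := by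
    field_simp
    ring
  have h3 : |sinh lam / lam - 1| ≤ lam ^ 2 := by
    have e2 : sinh lam / lam - 1 = (sinh lam - lam) / lam := by field_simp
    rw [e2, abs_of_nonneg (div_nonneg (by linarith) hlam.le), div_le_iff₀ hlam]
    linarith [(by ring : lam ^ 2 * lam = lam ^ 3)]
  have h4 : |ρ - r - r * (sinh lam / lam - 1)| ≤ δ + lam ^ 2 := by
    refine (abs_sub _ _).trans (add_le_add ?_ ?_)
    · rw [abs_sub_comm]; exact h
    · rw [abs_mul, abs_of_nonneg hr0]
      exact (mul_le_of_le_one_left (abs_nonneg _) hr1).trans h3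
  have h6 : 0 ≤ δ + lam ^ 2 := (abs_nonneg _).trans h4
  rw [e1, abs_div, abs_of_pos hρpos, div_le_iff₀ hρpos]
  nlinarith

/-- A relative error O(η) in the prefactor is harmless, as the resolvent G is only of size 1/η
relative to ω. -/
theorem abs_sub_mul_le_of_le {T G q F K₁ K₂ η ω : ℝ} (hη : 0 < η) (hF : 0 ≤ F)
    (h1 : |T - G| ≤ K₁ * ω) (h2 : |G| ≤ K₂ / η * ω) (h3 : |1 - q| ≤ F * η) :
    |T - q * G| ≤ (K₁ + F * K₂) * ω := by
  calc |T - q * G| = |(T - G) + (1 - q) * G| := by ring_nf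
    _ ≤ K₁ * ω + F * η * (K₂ / η * ω) := by
        refine (abs_add_le _ _).trans (add_le_add h1 ?_)
        rw [abs_mul]
        exact mul_le_mul h3 h2 (abs_nonneg _) (by positivity)
    _ = _ := by field_simp

theorem theta_eq_mul {lam ρ A r s W : ℝ} (E : ℝ) (hlam : 0 < lam) (hρ : 0 < ρ) (hA : 0 < A)
    (h : W * s = lam * A) :
    r / (2 * W * s) * E = r * sinh lam / (ρ * lam) * (ρ / (2 * A * sinh lam) * E) := by
  have := sinh_pos_iff.2 hlam
  rw [mul_assoc 2, h]
  field_simp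

theorem IsBandDensity.exists_abs_Theta_sub_theta_le (hf : IsBandDensity f) {κ c₀ : ℝ} (hκ : 0 < κ)
    (hc₀ : 0 < c₀) : ∃ η₀ W₀ : ℝ, 0 < η₀ ∧ η₀ ≤ 1 ∧ ∀ k : ℕ, 1 ≤ k → ∃ C : ℝ, 0 ≤ C ∧
      ∀ N W z, Regular f κ c₀ W₀ N W z → z.im ≤ η₀ → ∀ x y : Torus N,
        |Theta f N W z x y - theta f N W z (x.1 - y.1)|
          ≤ C * (1 / W * ((1 + z.im * (perAbs N (x.1 - y.1) / W) ^ 2) ^ k)⁻¹) := by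
  obtain ⟨B₁, c₁, C₁, d₀, d₁, W₀, hc₁, hC₁, hd₀, hd₁, h₁⟩ := hf.exists_step hc₀
  obtain ⟨B₂, c₂, C₂, hc₂, hC₂, h₂⟩ := exists_geometric_step hd₀ hd₁
  obtain ⟨cm, Cm, hcm, hCm, hm⟩ := norm_msc_sq_bounds hκ
  set a₁ := 2 / √(2 * κ) with ha₁
  have ha₁0 : 0 < a₁ := by positivity
  set B : ℕ → ℝ := fun K ↦ max (B₁ K) (B₂ K) with hB
  set c := min c₁ c₂ with hc
  have hc0 : 0 < c := lt_min hc₁ hc₂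
  set cr := min cm 1 with hcr
  have hcr0 : 0 < cr := lt_min hcm one_pos
  set Cρ := a₁ ^ 2 / d₀ with hCρ
  have hCρ0 : 0 < Cρ := by positivity
  -- Small enough for ρ ≥ 1/2 and λ ≤ 1, where the Taylor bounds for cosh and sinh apply.
  set η₀ := min 1 (min (1 / (2 * (a₁ + Cρ))) (d₀ / a₁)) with hη₀
  refine ⟨η₀, W₀, by positivity, min_le_left _ _, fun k hk ↦ ?_⟩
  obtain ⟨K₁, hK₁0, hK₁⟩ := IsStep.abs_resolvent_sub_le B hc0 (add_nonneg hC₁ hC₂) hcr0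
    (add_nonneg hCm.le hCρ0.le) hk
  obtain ⟨K₂, hK₂0, hK₂⟩ := IsStep.abs_resolvent_le B hc0 hcr0 hk
  refine ⟨K₁ + 2 * (Cm + Cρ + a₁ / d₀) * K₂, by positivity, fun N W z hz hηη₀ x y ↦ ?_⟩
  have hN : 0 < N := hz.pos.trans_le hz.le
  have hη := hz.im_pos
  obtain ⟨hs, gs, hD0, hD1, hφ⟩ := h₁ N W hz.pos hz.threshold hz.le hz.mass
  obtain ⟨g, hg, gg, hψ, hψ'⟩ := h₂ N W (diffD f N W) hz.pos hz.le hD0 hD1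
  obtain ⟨hr0, hr1, hrα⟩ := hm z hz.lower hz.upper hη hz.im_le
  obtain ⟨ha, ha', -, -⟩ := alpha_bounds hκ hz.lower hz.upper
  obtain ⟨hlam, hlam2, hlamW⟩ := rate_facts (f := f) hd₀ hz.pos hD0 ha hη
  have hW' : (1 : ℝ) ≤ W := by exact_mod_cast hz.pos
  set η := z.im with hηd
  set r := ‖msc z‖ ^ 2 with hr
  set lam := rate f N W z with hlamd
  set A := diffD f N W * (W : ℝ) ^ 2 with hA
  have hDpos : 0 < diffD f N W := hd₀.trans_le hD0
  have hA0 : d₀ ≤ A := by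
    have : (1 : ℝ) ≤ (W : ℝ) ^ 2 := one_le_pow₀ hW'
    rw [hA]
    nlinarith
  have hApos : 0 < A := hd₀.trans_le hA0
  have hη1 : η ≤ 1 := hηη₀.trans (min_le_left _ _)
  have hη2 : (a₁ + Cρ) * η ≤ 1 / 2 := by
    have h3 : η ≤ 1 / (2 * (a₁ + Cρ)) :=
      hηη₀.trans ((min_le_right _ _).trans (min_le_left _ _))
    rw [le_div_iff₀ (by positivity)] at h3
    linarith
  have hη3 : a₁ * η ≤ d₀ := by
    have h3 : η ≤ d₀ / a₁ := hηη₀.trans ((min_le_right _ _).trans (min_le_right _ _))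
    rw [le_div_iff₀ ha₁0] at h3
    linarith
  have hαη : alpha z * η ≤ a₁ * η := mul_le_mul_of_nonneg_right ha' hη.le
  have hlamη : lam ^ 2 ≤ a₁ / d₀ * η := by
    have : lam ^ 2 * d₀ ≤ a₁ * η := by
      refine le_trans (mul_le_mul_of_nonneg_left hA0 (sq_nonneg lam)) ?_
      rw [hlam2]; exact hαη
    rw [div_mul_eq_mul_div, le_div_iff₀ hd₀]; exact this
  have hlam1 : lam ≤ 1 := by
    have : lam ^ 2 ≤ 1 := hlamη.trans (by rw [div_mul_eq_mul_div, div_le_one hd₀]; exact hη3)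
    exact (pow_le_one_iff_of_nonneg hlam.le two_ne_zero).1 this
  obtain ⟨hcosh1, hcosh2⟩ := cosh_sub_bounds hlam.le hlam1
  -- The killing parameter for which the geometric walk has a resolvent decaying at exactly the rate
  -- λ of θ. It satisfies ρ = 1 - αη + O(η²), as does r.
  set ρ := 1 - (2 * cosh lam - 2) * A with hρ
  have hρ1 : alpha z * η ≤ 1 - ρ := by
    have := mul_le_mul_of_nonneg_right hcosh1 hApos.le
    rw [hlam2] at this
    rw [hρ]; linarith
  have hρ2 : 1 - ρ ≤ alpha z * η + Cρ * η ^ 2 := by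
    have h3 := mul_le_mul_of_nonneg_right hcosh2 hApos.le
    have h4 : lam ^ 4 * A ≤ Cρ * η ^ 2 := by
      have e1 : lam ^ 4 * A = lam ^ 2 * (lam ^ 2 * A) := by ring
      rw [e1, hlam2]
      calc _ ≤ (a₁ / d₀ * η) * (a₁ * η) :=
            mul_le_mul hlamη hαη (mul_nonneg (by linarith) hη.le) (by positivity)
        _ = _ := by rw [hCρ]; ring
    rw [add_mul, hlam2] at h3
    rw [hρ]; linarith
  have hηsq : η ^ 2 ≤ η := by nlinarith
  have hρhalf : 1 / 2 ≤ ρ := by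
    have := mul_le_mul_of_nonneg_left hηsq hCρ0.le
    linarith
  have hrρ : |r - ρ| ≤ (Cm + Cρ) * η ^ 2 := by
    rw [abs_le] at hrα ⊢
    constructor <;> linarith
  have hrlt := (norm_msc_eq hη).2.1
  have hs' := hs.mono (fun K ↦ le_max_left (B₁ K) (B₂ K))
  have hg' := hg.mono (fun K ↦ le_max_right (B₁ K) (B₂ K))
  have gs' := gs.mono (min_le_left c₁ c₂)
  have gg' := gg.mono (min_le_right c₁ c₂)
  have hdiff : ∀ j ∈ torus N, |symb N (bandStep f N W) j - symb N g j|
      ≤ (C₁ + C₂) * (freq N j * W) ^ 4 := fun j hj ↦ by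
    have h3 := hφ j hj
    have h4 := hψ j hj
    rw [abs_sub_comm] at h4
    refine (abs_sub_le _ (1 - diffD f N W * (freq N j * W) ^ 2) _).trans ?_
    linarith
  have hr1' : r ≤ 1 - cr * η := by
    have := mul_le_mul_of_nonneg_right (min_le_left cm 1) hη.le
    linarith
  have hρ1' : ρ ≤ 1 - cr * η := by
    have h3 := mul_le_mul_of_nonneg_right (min_le_right cm 1) hη.le
    have h4 := mul_le_mul_of_nonneg_right ha hη.le
    linarith
  have hρ0 : 0 ≤ ρ := by linarith
  have hfirst := hK₁ N W _ g η r ρ hN hz.pos hs' hg' gs' gg' hdiff hη (sq_nonneg _) hρ0 hr1' hρ1'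
    hrρ x y
  have hsecond := hK₂ N W g η ρ hN hz.pos hg' gg' hη hρ0 hρ1' x y
  rw [Theta_eq_four hN hc₁.le hs gs hrlt, theta_eq]
  have hΓ := four_geometric hN hApos hlam hψ' (by rw [hρ]; ring : 1 - ρ = (2 * cosh lam - 2) * A) x y
  rw [theta_eq_mul _ hlam (by linarith : 0 < ρ) hApos hlamW, ← hΓ]
  refine abs_sub_mul_le_of_le hη (by positivity) hfirst hsecond
    ((abs_one_sub_mul_sinh_div_le hlam hlam1 hρhalf (sq_nonneg _) hrlt.le hrρ).trans ?_)
  have h5 := mul_le_mul_of_nonneg_left hηsq (add_nonneg hCm.le hCρ0.le)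
  linarith

/-- In `expSum_le` the constant 3 gives the exponential term, while 2/(λN) becomes 1/(Nη) through
λ²DW² = αη and α ≥ 1. -/
theorem theta_le {κ d₀ : ℝ} (hκ : 0 < κ) (hd₀ : 0 < d₀) {N W : ℕ} {z : ℂ} (hW : 0 < W) (hN : 0 < N)
    (hD : d₀ ≤ diffD f N W) (h1 : -2 + κ ≤ z.re) (h2 : z.re ≤ 2 - κ) (hη : 0 < z.im) (x : ℤ) :
    theta f N W z x ≤ 2 / √d₀ * (1 / (W * √z.im) * exp (-(rate f N W z * perAbs N x)))
      + 1 / (N * z.im) := by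
  obtain ⟨ha, -, -, -⟩ := alpha_bounds hκ h1 h2
  obtain ⟨hlam, hlam2, hlamW⟩ := rate_facts (f := f) hd₀ hW hD ha hη
  have hr := (norm_msc_eq hη).2.1.le
  have hW' : (0 : ℝ) < W := by exact_mod_cast hW
  have hN' : (0 : ℝ) < N := by exact_mod_cast hN
  have hD0 : 0 < diffD f N W := hd₀.trans_le hD
  have hE := expSum_le hN hlam x
  have hd : 0 ≤ rate f N W z * perAbs N x := mul_nonneg hlam.le (perAbs_nonneg N x)
  set η := z.im
  set lam := rate f N W z
  set e := exp (-(lam * perAbs N x))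
  have he1 : e ≤ 1 := exp_le_one_iff.2 (by linarith)
  have he0 : 0 < e := exp_pos _
  have hsη := sqrt_pos.2 hη
  have hpre : 1 / (2 * (W : ℝ) * √(diffD f N W * alpha z * η)) ≤ 1 / 2 * (1 / √d₀ * (1 / (W * √η))) := by
    have h3 : √d₀ * √η ≤ √(diffD f N W * alpha z * η) := by
      rw [← sqrt_mul hd₀.le]
      refine sqrt_le_sqrt (mul_le_mul_of_nonneg_right ?_ hη.le)
      nlinarith
    calc _ ≤ 1 / (2 * (W : ℝ) * (√d₀ * √η)) := by gcongr
      _ = _ := by field_simp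
  have hsec : 1 / (2 * (W : ℝ) * √(diffD f N W * alpha z * η)) * (2 / (lam * N)) ≤ 1 / (N * η) := by
    rw [mul_assoc 2 (W : ℝ), hlamW]
    have e1 : 1 / (2 * (lam * (diffD f N W * (W : ℝ) ^ 2))) * (2 / (lam * N))
        = 1 / (N * (lam ^ 2 * (diffD f N W * (W : ℝ) ^ 2))) := by field_simp
    rw [e1, hlam2]
    gcongr
    nlinarith
  rw [theta_eq]
  set P := 1 / (2 * (W : ℝ) * √(diffD f N W * alpha z * η))
  have hP : 0 ≤ P := by positivity
  calc _ ≤ P * (e * (3 + 2 / (lam * N))) := by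
        refine mul_le_mul ?_ hE (expSum_nonneg x) hP
        exact div_le_div_of_nonneg_right hr (by positivity)
    _ = 3 * (P * e) + e * (P * (2 / (lam * N))) := by ring
    _ ≤ 3 * ((1 / 2 * (1 / √d₀ * (1 / (W * √η)))) * e) + 1 * (1 / (N * η)) := by gcongr
    _ ≤ _ := by
        have : 0 ≤ 1 / √d₀ * (1 / (W * √η)) * e := by positivity
        have e2 : 2 / √d₀ * (1 / (W * √η) * e) = 2 * (1 / √d₀ * (1 / (W * √η)) * e) := by ring
        rw [e2]
        linarith

theorem le_theta_zero {κ d₀ d₁ c : ℝ} (hκ : 0 < κ) (hd₀ : 0 < d₀) {N W : ℕ} {z : ℂ} (hW : 0 < W)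
    (hN : 0 < N) (hD : d₀ ≤ diffD f N W) (hD1 : diffD f N W ≤ d₁) (h1 : -2 + κ ≤ z.re)
    (h2 : z.re ≤ 2 - κ) (hη : 0 < z.im) (hc : 0 < c) (hr : c ≤ ‖msc z‖ ^ 2) :
    c / 4 * (1 / √(d₁ * (2 / √(2 * κ)))) * (1 / (W * √z.im))
      + c / 4 * (1 / (2 / √(2 * κ))) * (1 / (N * z.im)) ≤ theta f N W z 0 := by
  obtain ⟨ha, ha', -, -⟩ := alpha_bounds hκ h1 h2
  obtain ⟨hlam, hlam2, hlamW⟩ := rate_facts (f := f) hd₀ hW hD ha hη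
  have hW' : (0 : ℝ) < W := by exact_mod_cast hW
  have hN' : (0 : ℝ) < N := by exact_mod_cast hN
  have hD0 : 0 < diffD f N W := hd₀.trans_le hD
  have hE := le_expSum_zero hN hlam
  set η := z.im
  set lam := rate f N W z
  set a₁ := 2 / √(2 * κ)
  have ha₁0 : 0 < a₁ := by positivity
  have ha0 : 0 < alpha z := by linarith
  have hd₁ : 0 < d₁ := hD0.trans_le hD1
  have hsη := sqrt_pos.2 hη
  have hpre : 1 / √(d₁ * a₁) * (1 / (W * √η)) ≤ 1 / ((W : ℝ) * √(diffD f N W * alpha z * η)) := by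
    have h3 : √(diffD f N W * alpha z * η) ≤ √(d₁ * a₁) * √η := by
      rw [← sqrt_mul (by positivity)]
      gcongr
    calc _ = 1 / ((W : ℝ) * (√(d₁ * a₁) * √η)) := by field_simp
      _ ≤ _ := by gcongr
  have hsec : 1 / a₁ * (1 / (N * η))
      ≤ 1 / ((W : ℝ) * √(diffD f N W * alpha z * η)) * (1 / (lam * N)) := by
    rw [hlamW]
    have e1 : 1 / (lam * (diffD f N W * (W : ℝ) ^ 2)) * (1 / (lam * N))
        = 1 / (N * (lam ^ 2 * (diffD f N W * (W : ℝ) ^ 2))) := by field_simp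
    rw [e1, hlam2]
    calc _ = 1 / (N * (a₁ * η)) := by field_simp
      _ ≤ _ := by gcongr
  rw [theta_eq]
  set P := 1 / ((W : ℝ) * √(diffD f N W * alpha z * η)) with hPd
  have hP : 0 ≤ P := by positivity
  have hP2 : c / 2 * P ≤ ‖msc z‖ ^ 2 / (2 * (W : ℝ) * √(diffD f N W * alpha z * η)) := by
    have : c / 2 * P = c / (2 * (W : ℝ) * √(diffD f N W * alpha z * η)) := by rw [hPd]; field_simp
    rw [this]
    gcongr
  calc _ = c / 4 * (1 / √(d₁ * a₁) * (1 / (W * √η)) + 1 / a₁ * (1 / (N * η))) := by ring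
    _ ≤ c / 4 * (P + P * (1 / (lam * N))) := by gcongr
    _ = c / 2 * P * ((1 + 1 / (lam * N)) / 2) := by ring
    _ ≤ _ := mul_le_mul hP2 hE (by positivity) (by positivity)

end Main

theorem inv_le_bracket_zpow {η d W : ℝ} (hη : 0 ≤ η) (K : ℕ) :
    ((1 + η * (d / W) ^ 2) ^ (K + 1))⁻¹ ≤ bracket (√η * d / W) ^ (-(K : ℤ)) := by
  have h1 : bracket (√η * d / W) ^ 2 = 1 + η * (d / W) ^ 2 := by
    rw [bracket, sq_sqrt (by positivity), mul_div_assoc, mul_pow, sq_sqrt hη]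
  have h2 : 1 ≤ bracket (√η * d / W) := by
    rw [bracket]; exact one_le_sqrt.2 (le_add_of_nonneg_right (sq_nonneg _))
  rw [← h1, ← pow_mul, zpow_neg, zpow_natCast]
  exact inv_anti₀ (by positivity) (pow_le_pow_right₀ h2 (by omega))

end BandProfile

/-! ### Assembly of the three estimates. -/

open BandProfile in
theorem mainTheorem5 (f : ℝ → ℝ) (hf : BandProfile.IsBandDensity f)
    (δ κ γ c₀ : ℝ) (hδ : 0 < δ) (hκ : 0 < κ) (hγ : 0 < γ) (hc₀ : 0 < c₀) :
    -- the asymptotics of the profile, for `η ≤ N ^ (-c)`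
    (∀ c : ℝ, 0 < c → ∃ (C : ℝ) (N₀ : ℕ), ∀ K : ℕ, ∃ CK : ℝ,
      ∀ N W : ℕ, N₀ ≤ N → BandProfile.Admissible f δ c₀ N W →
      ∀ z ∈ BandProfile.specDomain f κ γ N W, z.im ≤ (N : ℝ) ^ (-c) →
      ∀ x y : BandProfile.Torus N,
        |BandProfile.Theta f N W z x y - BandProfile.theta f N W z (x.1 - y.1)|
          ≤ C / (W : ℝ) ^ 2
            + CK * (1 / (W : ℝ) * BandProfile.bracket
                (Real.sqrt z.im * BandProfile.perAbs N (x.1 - y.1) / (W : ℝ)) ^ (-(K : ℤ))))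
    -- the size of the maximum, for `η ≤ N ^ (-c)`
    ∧ (∀ c : ℝ, 0 < c → ∃ (a b : ℝ) (N₀ : ℕ), 0 < a ∧ 0 < b ∧
      ∀ N W : ℕ, N₀ ≤ N → BandProfile.Admissible f δ c₀ N W →
      ∀ z ∈ BandProfile.specDomain f κ γ N W, z.im ≤ (N : ℝ) ^ (-c) →
        a * BandProfile.PhiSq N W z ≤ BandProfile.maxTheta f N W z ∧
        BandProfile.maxTheta f N W z ≤ b * BandProfile.PhiSq N W z)
    -- the upper bound
    ∧ (∃ N₀ : ℕ, ∀ K : ℕ, ∃ C : ℝ,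
      ∀ N W : ℕ, N₀ ≤ N → BandProfile.Admissible f δ c₀ N W → N ≤ W ^ 2 →
      ∀ z ∈ BandProfile.specDomain f κ γ N W,
        ((W : ℝ) / (N : ℝ)) ^ 2 ≤ z.im → z.im ≤ 1 →
      ∀ x y : BandProfile.Torus N,
        BandProfile.Theta f N W z x y ≤ C * BandProfile.Upsilon f K N W z x y) := by
  obtain ⟨η₀, W₁, hη₀, hη₀1, hcore⟩ := hf.exists_abs_Theta_sub_theta_le hκ hc₀
  obtain ⟨W₂, hbound⟩ := hf.exists_Theta_le hκ hc₀
  obtain ⟨d₀, d₁, W₃, hd₀, hd₁, hdiff⟩ := hf.exists_diffD_bounds (κ := κ) hc₀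
  obtain ⟨W₄, hM⟩ := hf.exists_M_pos hc₀
  obtain ⟨cm, Cm, hcm, hCm, hm⟩ := norm_msc_sq_bounds hκ
  set Wmax := max (max W₁ W₂) (max W₃ W₄) with hWmax
  have hlim : Filter.Tendsto (fun N : ℕ ↦ (N : ℝ) ^ δ) Filter.atTop Filter.atTop :=
    (tendsto_rpow_atTop hδ).comp tendsto_natCast_atTop_atTop
  obtain ⟨N₁, hN₁⟩ := Filter.eventually_atTop.1 (hlim.eventually_ge_atTop (max Wmax 1))
  have hsmall : ∀ c : ℝ, 0 < c → ∀ ε : ℝ, 0 < ε → ∃ N₂ : ℕ, ∀ N : ℕ, N₂ ≤ N → (N : ℝ) ^ (-c) ≤ ε :=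
    fun c hc ε hε ↦ Filter.eventually_atTop.1 (((tendsto_rpow_neg_atTop hc).comp
      tendsto_natCast_atTop_atTop).eventually (ge_mem_nhds hε))
  have hreg : ∀ N W : ℕ, N₁ ≤ N → Admissible f δ c₀ N W → ∀ z ∈ specDomain f κ γ N W,
      Regular f κ c₀ Wmax N W z := by
    intro N W hN had z hz
    have h1 := (hN₁ N hN).trans had.lower
    have hW1 : (1 : ℝ) ≤ W := (le_max_right _ _).trans h1
    have hW : 0 < W := by exact_mod_cast (by linarith : (0 : ℝ) < W)
    have hWm := (le_max_left _ _).trans h1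
    have hMp := hM N W hW (((le_max_right W₃ W₄).trans (le_max_right _ _)).trans hWm) had.upper
      had.mass
    exact ⟨hW, hWm, had.upper, had.mass, hz.1, hz.2.1,
      (Real.rpow_pos_of_pos hMp _).trans_le hz.2.2.1, hz.2.2.2⟩
  have hle1 : W₁ ≤ Wmax := (le_max_left W₁ W₂).trans (le_max_left _ _)
  have hle2 : W₂ ≤ Wmax := (le_max_right W₁ W₂).trans (le_max_left _ _)
  have hle3 : W₃ ≤ Wmax := (le_max_left W₃ W₄).trans (le_max_right _ _)
  refine ⟨fun c hc ↦ ?_, fun c hc ↦ ?_, ?_⟩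
  · obtain ⟨N₂, hN₂⟩ := hsmall c hc η₀ hη₀
    -- The geometric comparison has no W⁻² error, so the first constant can be 0.
    refine ⟨0, max N₁ N₂, fun K ↦ ?_⟩
    -- The exponent K + 1 covers K = 0, as the comparison requires an exponent of at least 1.
    obtain ⟨C, hC0, hC⟩ := hcore (K + 1) (by omega)
    refine ⟨C, fun N W hN had z hz hzc x y ↦ ?_⟩
    have hr := hreg N W ((le_max_left _ _).trans hN) had z hz
    have h1 := hC N W z (hr.mono hle1) (hzc.trans (hN₂ N ((le_max_right _ _).trans hN))) x y
    rw [zero_div, zero_add]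
    refine h1.trans ?_
    gcongr
    exact inv_le_bracket_zpow hr.im_pos.le K
  · obtain ⟨C, hC0, hC⟩ := hcore 1 le_rfl
    set a₁ := 2 / √(2 * κ) with ha₁
    have ha₁0 : 0 < a₁ := by positivity
    -- Half of the lower constant for θ(0): that bound is at least 2a(X + Y), and the error C/W ≤ aX
    -- still leaves a max(X, Y).
    set a := min (cm / 4 * (1 / √(d₁ * a₁))) (cm / 4 * (1 / a₁)) / 2 with ha
    have ha0 : 0 < a := by positivity
    -- The second smallness condition makes C/W = C√η X at most aX.
    obtain ⟨N₂, hN₂⟩ := hsmall c hc (min η₀ ((a / (C + 1)) ^ 2)) (by positivity)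
    refine ⟨a, 2 / √d₀ + 1 + C, max N₁ N₂, ha0, by positivity, fun N W hN had z hz hzc ↦ ?_⟩
    have hr := hreg N W ((le_max_left _ _).trans hN) had z hz
    have hη := hr.im_pos
    have hzs := hzc.trans (hN₂ N ((le_max_right _ _).trans hN))
    have hη₀' : z.im ≤ η₀ := hzs.trans (min_le_left _ _)
    have hsq : √z.im ≤ a / (C + 1) :=
      Real.sqrt_le_iff.2 ⟨by positivity, hzs.trans (min_le_right _ _)⟩
    have hN0 : 0 < N := hr.pos.trans_le hr.le
    have hW' : (0 : ℝ) < W := by exact_mod_cast hr.pos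
    have hN' : (0 : ℝ) < N := by exact_mod_cast hN0
    have hs0 := Real.sqrt_pos.2 hη
    obtain ⟨hD0, hD1⟩ := hdiff N W z (hr.mono hle3)
    set X := 1 / ((W : ℝ) * √z.im) with hX
    set Y := 1 / ((N : ℝ) * z.im) with hY
    have hX0 : 0 < X := by positivity
    have hY0 : 0 < Y := by positivity
    have hCW : C * (1 / W) ≤ a * X := by
      have h1 : (C + 1) * √z.im ≤ a := by
        rw [le_div_iff₀ (by positivity)] at hsq; linarith
      have h2 : C * √z.im ≤ a := by nlinarith
      calc C * (1 / W) = C * √z.im * X := by rw [hX]; field_simp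
        _ ≤ _ := by gcongr
    have hCW' : C * (1 / W) ≤ C * X := by
      have : √z.im ≤ 1 := Real.sqrt_le_one.2 (hη₀'.trans hη₀1)
      rw [hX]
      gcongr
      exact mul_le_of_le_one_right hW'.le this
    have hTh : ∀ x y : Torus N, |Theta f N W z x y - theta f N W z (x.1 - y.1)| ≤ C * (1 / W) :=
      fun x y ↦ by
        refine (hC N W z (hr.mono hle1) hη₀' x y).trans ?_
        refine mul_le_mul_of_nonneg_left (mul_le_of_le_one_right (by positivity) ?_) hC0
        rw [pow_one]
        exact inv_le_one_of_one_le₀ (le_add_of_nonneg_right (by positivity))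
    have hPhi : PhiSq N W z = max Y X := rfl
    have : Nonempty (Torus N) := ⟨⟨0, zero_mem_torus hN0⟩⟩
    rw [hPhi]
    constructor
    · have x₀ : Torus N := ⟨0, zero_mem_torus hN0⟩
      have h1 : Theta f N W z x₀ x₀ ≤ maxTheta f N W z :=
        le_ciSup (f := fun p : Torus N × Torus N ↦ Theta f N W z p.1 p.2)
          (Set.finite_range _).bddAbove (x₀, x₀)
      have h2 := (abs_le.1 (hTh x₀ x₀)).1
      rw [sub_self] at h2
      have h3 := le_theta_zero hκ hd₀ hr.pos hN0 hD0 hD1 hr.lower hr.upper hη hcm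
        (hm z hr.lower hr.upper hη hr.im_le).1
      have h4 : 2 * a * X ≤ cm / 4 * (1 / √(d₁ * a₁)) * X := by
        refine mul_le_mul_of_nonneg_right ?_ hX0.le
        rw [ha]; linarith [min_le_left (cm / 4 * (1 / √(d₁ * a₁))) (cm / 4 * (1 / a₁))]
      have h5 : 2 * a * Y ≤ cm / 4 * (1 / a₁) * Y := by
        refine mul_le_mul_of_nonneg_right ?_ hY0.le
        rw [ha]; linarith [min_le_right (cm / 4 * (1 / √(d₁ * a₁))) (cm / 4 * (1 / a₁))]
      have h6 : a * max Y X ≤ a * (X + 2 * Y) := by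
        gcongr
        exact max_le (by linarith) (by linarith)
      rw [← ha₁, ← hX, ← hY] at h3
      linarith
    · refine ciSup_le fun p ↦ ?_
      have h1 := (abs_le.1 (hTh p.1 p.2)).2
      have h2 := theta_le hκ hd₀ hr.pos hN0 hD0 hr.lower hr.upper hη (p.1.1 - p.2.1)
      have h3 : 1 / (W * √z.im) * Real.exp (-(rate f N W z * perAbs N (p.1.1 - p.2.1))) ≤ X := by
        refine mul_le_of_le_one_right hX0.le (Real.exp_le_one_iff.2 (neg_nonpos.2 ?_))
        exact mul_nonneg (by unfold rate; positivity) (perAbs_nonneg _ _)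
      have h4 : 2 / √d₀ * (1 / (W * √z.im) *
          Real.exp (-(rate f N W z * perAbs N (p.1.1 - p.2.1)))) ≤ 2 / √d₀ * X := by gcongr
      have h5 := le_max_left Y X
      have h6 : (2 / √d₀ + C) * X ≤ (2 / √d₀ + C) * max Y X := by
        gcongr; exact le_max_right _ _
      linarith
  · refine ⟨N₁, fun K ↦ ?_⟩
    obtain ⟨C, hC0, hC⟩ := hcore (K + 1) (by omega)
    obtain ⟨C', hC'0, hC'⟩ := hbound (K + 1) (by omega)
    refine ⟨2 / √d₀ + 1 + C + C' / η₀, fun N W hN had _ z hz _ _ x y ↦ ?_⟩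
    have hr := hreg N W hN had z hz
    have hη := hr.im_pos
    have hN0 : 0 < N := hr.pos.trans_le hr.le
    have hW' : (0 : ℝ) < W := by exact_mod_cast hr.pos
    have hN' : (0 : ℝ) < N := by exact_mod_cast hN0
    have hbr := inv_le_bracket_zpow (d := perAbs N (x.1 - y.1)) (W := W) hη.le K
    set ω := bracket (√z.im * perAbs N (x.1 - y.1) / W) ^ (-(K : ℤ)) with hω
    have hω0 : 0 ≤ ω := le_trans (by positivity) hbr
    have hU : Upsilon f K N W z x y = 1 / (N * z.im) + 1 / (W * √z.im) *
        Real.exp (-(rate f N W z * perAbs N (x.1 - y.1))) + 1 / W * ω := rfl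
    set P := 1 / ((N : ℝ) * z.im)
    set R := 1 / (W * √z.im) * Real.exp (-(rate f N W z * perAbs N (x.1 - y.1)))
    have hP0 : 0 ≤ P := by positivity
    have hR0 : 0 ≤ R := by positivity
    have hQ0 : 0 ≤ 1 / (W : ℝ) * ω := by positivity
    have hd : 0 ≤ 2 / √d₀ := by positivity
    have hCη : 0 ≤ C' / η₀ := by positivity
    rw [hU]
    have key : ∀ A : ℝ, A ≤ 2 / √d₀ + 1 + C + C' / η₀ → ∀ t : ℝ, 0 ≤ t →
        A * t ≤ (2 / √d₀ + 1 + C + C' / η₀) * t := fun A hA t ht ↦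
      mul_le_mul_of_nonneg_right hA ht
    rw [mul_add, mul_add]
    -- Below η₀ combine the comparison with `theta_le`. Above it 1/η ≤ 1/η₀, so the tail bound alone
    -- is dominated by the last term of Υ.
    rcases le_total z.im η₀ with h | h
    · obtain ⟨hD0, -⟩ := hdiff N W z (hr.mono hle3)
      have h1 := (abs_le.1 (hC N W z (hr.mono hle1) h x y)).2
      have h2 := theta_le hκ hd₀ hr.pos hN0 hD0 hr.lower hr.upper hη (x.1 - y.1)
      have h3 : C * (1 / W * ((1 + z.im * (perAbs N (x.1 - y.1) / W) ^ 2) ^ (K + 1))⁻¹)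
          ≤ C * (1 / W * ω) := by gcongr
      have k1 := key 1 (by linarith) P hP0
      have k2 := key (2 / √d₀) (by linarith) R hR0
      have k3 := key C (by linarith) _ hQ0
      linarith
    · have h1 := hC' N W z (hr.mono hle2) x y
      have h2 : C' / z.im * (1 / W * ((1 + z.im * (perAbs N (x.1 - y.1) / W) ^ 2) ^ (K + 1))⁻¹)
          ≤ C' / η₀ * (1 / W * ω) := by gcongr
      have k1 := key 0 (by linarith) P hP0
      have k2 := key 0 (by linarith) R hR0
      have k3 := key (C' / η₀) (by linarith) _ hQ0
      linarith
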